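/- **Theorem (Linear convergence of overlapping Schwarz).** *Problem.* Let $T>0$ and consider the linear-quadratic optimal control problem $$\min_{x,u}\ \tfrac12\int_0^T \begin{bmatrix}x\\u\end{bmatrix}^{\!\top}\begin{bmatrix}Q&H^\top\\H&R\end{bmatrix}\begin{bmatrix}x\\u\end{bmatrix}dt+\tfrac12x(T)^\top Q_Tx(T)\quad\text{s.t. }\dot x=Ax+Bu,\ x(0)=x_0,$$ with $x(t)\in\mathbb R^{n_x}$, $u(t)\in\mathbb R^{n_u}$, over bounded measurable controls. A *solution* $(x,u,\lambda)$ of such a problem on an interval $[a,b]$ with initial state $p$ and terminal cost $L$ consists of the optimal pair $(x,u)$ with $u$ continuous, and its adjoint, $\dot\lambda=-A^\top\lambda-Qx-H^\top u$, $\lambda(b)=\nabla L(x(b))$. Let $(x^*,u^*,\lambda^*)$ be the solution of the full problem ($a=0$, $b=T$, $p=x_0$, $L(y)=\tfrac12y^\top Q_Ty$). *Assumptions*, with positive constants $\lambda_A,\lambda_B,\lambda_Q,\lambda_H,\lambda_R,\gamma_R,\gamma_Q,\alpha_0,\alpha_1,\beta_0,\beta_1$ and $\sigma\in(0,T)$;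 $\|\cdot\|$ is the Euclidean or operator norm and $\preceq$ the Loewner order of symmetric matrices: (1) $A,B,Q,H,R$ are continuous on $[0,T]$ with $\|A\|\le\lambda_A$, $\|B\|\le\lambda_B$, $\|Q\|\le\lambda_Q$, $\|H\|\le\lambda_H$, $\|R\|\le\lambda_R$. (2) (Uniform complete controllability.) Let $\Phi(t,s)$ be the evolution operator of $\dot x=Ax$ and $W(t_0,t_1)=\int_{t_0}^{t_1}\Phi(t_0,s)B(s)B(s)^\top\Phi(t_0,s)^\top ds$. For every $t_0\in[0,T-\sigma]$ there is $t_1\in[t_0,t_0+\sigma]$ with $\alpha_0I\preceq W(t_0,t_1)\preceq\alpha_1I$ and $\beta_0I\preceq\Phi(t_1,t_0)W(t_0,t_1)\Phi(t_1,t_0)^\top\preceq\beta_1I$. (3) (Coercivity.) $R(t)\succeq\gamma_RI$ and $Q(t)-H(t)^\top R(t)^{-1}H(t)\succeq\gamma_QI$ on $[0,T]$, and $\gamma_QI\preceq Q_T\preceq\lambda_QI$. *Algorithm.* Let $0=t_0<t_1<\dots<t_m=T$, let $\tau_j^0,\tau_j^1>0$ for $1\le j\le m$, and put $t_j^0=\max\{t_{j-1}-\tau_j^0,0\}$,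 $t_j^1=\min\{t_j+\tau_j^1,T\}$ and $\tau=\min_{1\le j\le m}\min\{\tau_j^0,\tau_j^1\}$. Assume $t_j+\tau\le T$ for all $1\le j<m$. Start with arbitrary functions $(x^{(0)},u^{(0)},\lambda^{(0)})$ on $[0,T]$ with $x^{(0)}(0)=x_0$. Given $(x^{(k)},u^{(k)},\lambda^{(k)})$, for each $j$ let $(x_j,u_j,\lambda_j)$ be the solution, in the sense above with the same $A,B,Q,H,R$, on $[t_j^0,t_j^1]$ with initial state $x^{(k)}(t_j^0)$ and terminal cost $\tfrac12y^\top Q(t_j^1)y-y^\top Q(t_j^1)q_j$, $q_j=x^{(k)}(t_j^1)-Q(t_j^1)^{-1}\lambda^{(k)}(t_j^1)$, if $j<m$, and $\tfrac12y^\top Q_Ty$ if $j=m$. Then $(x^{(k+1)},u^{(k+1)},\lambda^{(k+1)})$ equals $(x_j,u_j,\lambda_j)$ on $[t_{j-1},t_j)$ for $j<m$ and on $[t_{m-1},t_m]$ for $j=m$. *Conclusion.* Let $\omega^{(k)}\in[0,\infty]$ be the maximum of $\sup_{[0,T]}\|x^{(k)}-x^*\|$, $\sup_{[0,T]}\|u^{(k)}-u^*\|$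 and $\sup_{[0,T]}\|\lambda^{(k)}-\lambda^*\|$. Then for all $k\ge0$ $$\omega^{(k+1)}\le 3\,c(\sigma)\,e^{-\rho_Z(\sigma)\tau}\,\omega^{(k)},$$ where $c(\sigma),\rho_Z(\sigma)>0$ are the following constants, which depend only on the constants in (1)–(3) and not on $T$. With $a=\lambda_A+\lambda_B\lambda_H/\gamma_R$, $$\alpha_0'=\Big(\tfrac2{\alpha_0}+\tfrac{(\lambda_H/\gamma_R)^2}{\lambda_A}\big(1+\tfrac{\alpha_1}{\alpha_0}\big)^2(e^{2\lambda_A\sigma}-1)\Big)^{-1},\quad \alpha_1'=\tfrac{\lambda_B^2(e^{2a\sigma}-1)}{2a},\quad \tilde\alpha_0=\tfrac{1-e^{-2a\sigma}}{2a},\quad \tilde\alpha_1=\tfrac{e^{2a\sigma}-1}{2a},$$ $$c_0=e^{-2a\sigma}\min\Big\{2a\Big(\tfrac{\lambda_B^2}{\gamma_R}\big(1+\tfrac{\tilde\alpha_1}{\tilde\alpha_0}\big)^2+\tfrac1{\gamma_Q\tilde\alpha_0^2}\Big)^{-1},\ \Big(\tfrac{\lambda_B^2}{2\gamma_Ra}+\tfrac1{\gamma_Q}\Big)^{-1}\Big\},$$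 $$c_1=e^{2a\sigma}\max\Big\{\tfrac1{2a}\Big(\big(\lambda_Q+\tfrac{\lambda_H^2}{\gamma_R}\big)\big(1+\tfrac{\alpha_1'}{\alpha_0'}\big)^2+\tfrac{\lambda_R\lambda_B^2}{(\alpha_0')^2}\Big),\ \big(\lambda_Q+\tfrac{\lambda_H^2}{\gamma_R}\big)\big(1+\tfrac1{2a}\big)\Big\},$$ $$c_Z=\sqrt{c_1/c_0},\qquad \rho_Z(\sigma)=\frac{\gamma_Q}{2c_1},\qquad c(\sigma)=\Big(1+\tfrac1{\gamma_Q}\Big)\Big(1+\tfrac{\lambda_H}{\gamma_R}+\big(1+\tfrac{\lambda_B}{\gamma_R}\big)(c_1+\lambda_Q)\Big)\max\Big\{c_Z,\ \frac{c_Z^2\lambda_B^2\lambda_Q}{2\rho_Z(\sigma)\gamma_R}\Big\}.$$ -/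

import Mathlib

open Set MeasureTheory
open scoped Matrix Matrix.Norms.L2Operator MatrixOrder ENNReal

noncomputable section

namespace Schwarz

/-- `ℝⁿ` with the Euclidean norm. -/
abbrev Vec (n : ℕ) := EuclideanSpace ℝ (Fin n)

/-- Real matrices; `‖·‖` is the `ℓ²` operator norm and `≤` is the Loewner order
(`M ≤ N` iff `N - M` is symmetric positive semidefinite). -/
abbrev Mat (p q : ℕ) := Matrix (Fin p) (Fin q) ℝ

/-- The matrix-vector product on Euclidean spaces. -/
abbrev mulV {p q : ℕ} (M : Mat p q) (v : Vec q) : Vec p := Matrix.toEuclideanLin M v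

/-- The bilinear expression `vᵀ M w`. -/
def bil {p q : ℕ} (v : Vec p) (M : Mat p q) (w : Vec q) : ℝ := inner ℝ v (mulV M w)

/-! ### The linear-quadratic problem -/

/-- The coefficients of the linear-quadratic optimal control problem. Only their values on the
horizon `[0, T]` matter. -/
structure LQData (nx nu : ℕ) where
  A : ℝ → Mat nx nx
  B : ℝ → Mat nx nu
  Q : ℝ → Mat nx nx
  H : ℝ → Mat nu nx
  R : ℝ → Mat nu nu
  QT : Mat nx nx

/-- State, control and adjoint trajectories. -/
structure Trajectory (nx nu : ℕ) where
  x : ℝ → Vec nx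
  u : ℝ → Vec nu
  lam : ℝ → Vec nx

variable {nx nu : ℕ}

/-- The running cost `[x; u]ᵀ [Q Hᵀ; H R] [x; u]` at time `t`. -/
def LQData.stage (D : LQData nx nu) (t : ℝ) (x : Vec nx) (u : Vec nu) : ℝ :=
  bil x (D.Q t) x + bil x (D.H t)ᵀ u + bil u (D.H t) x + bil u (D.R t) u

/-- The cost functional on `[a, b]` with terminal cost `L`. -/
def LQData.cost (D : LQData nx nu) (a b : ℝ) (L : Vec nx → ℝ)
    (x : ℝ → Vec nx) (u : ℝ → Vec nu) : ℝ :=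
  (1 / 2) * (∫ t in a..b, D.stage t (x t) (u t)) + L (x b)

/-- Admissible pairs on `[a, b]` with initial state `p`: the control is bounded and measurable and
the state is the continuous solution of `ẋ = A x + B u`, `x(a) = p`, in integrated form. -/
structure LQData.Admissible (D : LQData nx nu) (a b : ℝ) (p : Vec nx)
    (x : ℝ → Vec nx) (u : ℝ → Vec nu) : Prop where
  control_meas : AEStronglyMeasurable u (volume.restrict (Icc a b))
  control_bdd : ∃ M : ℝ, ∀ t ∈ Icc a b, ‖u t‖ ≤ M
  state_cont : ContinuousOn x (Icc a b)
  state_eq : ∀ t ∈ Icc a b, x t = p + ∫ s in a..t, (mulV (D.A s) (x s) + mulV (D.B s) (u s))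

/-- `z = (x, u, λ)` solves the optimal control problem on `[a, b]` with initial state `p` and
terminal cost `L`: the pair `(x, u)` is an admissible minimizer with `u` its continuous
representative (an optimal control is only determined up to null sets), and `λ` is the associated
adjoint, `λ̇ = -Aᵀ λ - Q x - Hᵀ u` with `λ(b) = ∇ L (x(b))`. -/
structure LQData.IsSolution (D : LQData nx nu) (a b : ℝ) (p : Vec nx) (L : Vec nx → ℝ)
    (z : Trajectory nx nu) : Prop where
  admissible : D.Admissible a b p z.x z.u
  control_cont : ContinuousOn z.u (Icc a b)
  optimal : ∀ (x : ℝ → Vec nx) (u : ℝ → Vec nu), D.Admissible a b p x u →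
    D.cost a b L z.x z.u ≤ D.cost a b L x u
  adjoint_eq : ∀ t ∈ Icc a b,
    HasDerivWithinAt z.lam
      (-(mulV (D.A t)ᵀ (z.lam t)) - mulV (D.Q t) (z.x t) - mulV (D.H t)ᵀ (z.u t)) (Icc a b) t
  adjoint_end : z.lam b = gradient L (z.x b)

/-- The terminal cost `½ xᵀ Q_T x` of the full problem. -/
def LQData.fullTerminal (D : LQData nx nu) (y : Vec nx) : ℝ := (1 / 2) * bil y D.QT y

/-- `z` is the solution of the full problem on `[0, T]` with initial state `x0`. -/
def LQData.IsFullSolution (D : LQData nx nu) (T : ℝ) (x0 : Vec nx) (z : Trajectory nx nu) : Prop :=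
  D.IsSolution 0 T x0 D.fullTerminal z

/-! ### The assumptions -/

/-- The scalar constants of the assumptions; none of them refers to the horizon `T`. -/
structure Constants where
  lA : ℝ
  lB : ℝ
  lQ : ℝ
  lH : ℝ
  lR : ℝ
  gR : ℝ
  gQ : ℝ
  σ : ℝ
  α₀ : ℝ
  α₁ : ℝ
  β₀ : ℝ
  β₁ : ℝ

structure Constants.Positive (C : Constants) : Prop where
  lA : 0 < C.lA
  lB : 0 < C.lB
  lQ : 0 < C.lQ
  lH : 0 < C.lH
  lR : 0 < C.lR
  gR : 0 < C.gR
  gQ : 0 < C.gQ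
  σ : 0 < C.σ
  α₀ : 0 < C.α₀
  α₁ : 0 < C.α₁
  β₀ : 0 < C.β₀
  β₁ : 0 < C.β₁

/-- Continuity and boundedness of the coefficients. -/
structure LQData.Bounded (D : LQData nx nu) (T : ℝ) (C : Constants) : Prop where
  contA : ContinuousOn D.A (Icc 0 T)
  contB : ContinuousOn D.B (Icc 0 T)
  contQ : ContinuousOn D.Q (Icc 0 T)
  contH : ContinuousOn D.H (Icc 0 T)
  contR : ContinuousOn D.R (Icc 0 T)
  boundA : ∀ t ∈ Icc 0 T, ‖D.A t‖ ≤ C.lA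
  boundB : ∀ t ∈ Icc 0 T, ‖D.B t‖ ≤ C.lB
  boundQ : ∀ t ∈ Icc 0 T, ‖D.Q t‖ ≤ C.lQ
  boundH : ∀ t ∈ Icc 0 T, ‖D.H t‖ ≤ C.lH
  boundR : ∀ t ∈ Icc 0 T, ‖D.R t‖ ≤ C.lR

/-- `Φ t s` is the evolution operator of `ẋ = A x` on `[0, T]`: `∂ₜ Φ(t, s) = A(t) Φ(t, s)` and
`Φ(s, s) = I` for all `s, t` in `[0, T]` (in either order). -/
def IsEvolution (A : ℝ → Mat nx nx) (T : ℝ) (Φ : ℝ → ℝ → Mat nx nx) : Prop :=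
  ∀ s ∈ Icc 0 T, Φ s s = 1 ∧
    ∀ t ∈ Icc 0 T, HasDerivWithinAt (fun r => Φ r s) (A t * Φ t s) (Icc 0 T) t

/-- The evolution operator `Φ_A(t, s)` on `[0, T]`. For continuous `A` there is exactly one
on `[0, T] × [0, T]`. -/
def evolution (A : ℝ → Mat nx nx) (T : ℝ) : ℝ → ℝ → Mat nx nx :=
  Classical.epsilon (IsEvolution A T)

/-- The controllability Gramian `∫ Φ_A(t₀, s) B(s) B(s)ᵀ Φ_A(t₀, s)ᵀ ds` over `[t₀, t₁]`. -/
def gramian (A : ℝ → Mat nx nx) (B : ℝ → Mat nx nu) (T t₀ t₁ : ℝ) : Mat nx nx :=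
  ∫ s in t₀..t₁, evolution A T t₀ s * B s * (B s)ᵀ * (evolution A T t₀ s)ᵀ

/-- Uniform complete controllability with parameter `σ` and constants `α₀, α₁, β₀, β₁`. -/
def LQData.UCC (D : LQData nx nu) (T : ℝ) (C : Constants) : Prop :=
  ∀ t₀ ∈ Icc 0 (T - C.σ), ∃ t₁ ∈ Icc t₀ (t₀ + C.σ),
    C.α₀ • (1 : Mat nx nx) ≤ gramian D.A D.B T t₀ t₁ ∧
    gramian D.A D.B T t₀ t₁ ≤ C.α₁ • (1 : Mat nx nx) ∧
    C.β₀ • (1 : Mat nx nx) ≤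
      evolution D.A T t₁ t₀ * gramian D.A D.B T t₀ t₁ * (evolution D.A T t₁ t₀)ᵀ ∧
    evolution D.A T t₁ t₀ * gramian D.A D.B T t₀ t₁ * (evolution D.A T t₁ t₀)ᵀ ≤
      C.β₁ • (1 : Mat nx nx)

/-- Coercivity of the cost. -/
structure LQData.Coercive (D : LQData nx nu) (T : ℝ) (C : Constants) : Prop where
  R_lower : ∀ t ∈ Icc 0 T, C.gR • (1 : Mat nu nu) ≤ D.R t
  Q_lower : ∀ t ∈ Icc 0 T, C.gQ • (1 : Mat nx nx) ≤ D.Q t - (D.H t)ᵀ * (D.R t)⁻¹ * D.H t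
  QT_lower : C.gQ • (1 : Mat nx nx) ≤ D.QT
  QT_upper : D.QT ≤ C.lQ • (1 : Mat nx nx)

/-! ### The constants of the rate -/

namespace Constants

/-- `λ_A + λ_B λ_H / γ_R`, a bound for `A - B R⁻¹ H`. -/
def a (C : Constants) : ℝ := C.lA + C.lB * C.lH / C.gR

/-- Gramian lower bound for the pair `(A - B R⁻¹ H, B)`. -/
def α₀' (C : Constants) : ℝ :=
  (2 / C.α₀ + (C.lH / C.gR) ^ 2 / C.lA * (1 + C.α₁ / C.α₀) ^ 2 *
    (Real.exp (2 * C.lA * C.σ) - 1))⁻¹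

/-- Gramian upper bound for the pair `(A - B R⁻¹ H, B)`. -/
def α₁' (C : Constants) : ℝ := C.lB ^ 2 * (Real.exp (2 * C.σ * C.a) - 1) / (2 * C.a)

/-- Gramian lower bound for the dual pair `(-(A - B R⁻¹ H)ᵀ, I)`. -/
def αd₀ (C : Constants) : ℝ := 1 / (2 * C.a) * (1 - Real.exp (-2 * C.a * C.σ))

/-- Gramian upper bound for the dual pair `(-(A - B R⁻¹ H)ᵀ, I)`. -/
def αd₁ (C : Constants) : ℝ := 1 / (2 * C.a) * (Real.exp (2 * C.a * C.σ) - 1)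

/-- Lower bound for the Riccati matrix. -/
def c₀ (C : Constants) : ℝ :=
  min (2 * C.a * (C.lB ^ 2 / C.gR * (1 + C.αd₁ / C.αd₀) ^ 2 + 1 / (C.gQ * C.αd₀ ^ 2))⁻¹)
      ((C.lB ^ 2 / (2 * C.gR * C.a) + 1 / C.gQ)⁻¹)
    * Real.exp (-2 * C.a * C.σ)

/-- Upper bound for the Riccati matrix. -/
def c₁ (C : Constants) : ℝ :=
  max (((C.lQ + C.lH ^ 2 / C.gR) * (1 + C.α₁' / C.α₀') ^ 2 + C.lR * C.lB ^ 2 / C.α₀' ^ 2)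
        * (1 / (2 * C.a)))
      ((C.lQ + C.lH ^ 2 / C.gR) * (1 + 1 / (2 * C.a)))
    * Real.exp (2 * C.a * C.σ)

/-- `c_Z(σ)`. -/
def cZ (C : Constants) : ℝ := Real.sqrt (C.c₁ / C.c₀)

/-- The decay rate `ρ_Z(σ)`. -/
def ρZ (C : Constants) : ℝ := C.gQ / (2 * C.c₁)

/-- `Λ_b(σ)`, the sensitivity constant for boundary perturbations, with `λ_G = λ_Q`. -/
def Λb (C : Constants) : ℝ :=
  (1 + C.lH / C.gR + (1 + C.lB / C.gR) * (C.c₁ + C.lQ)) *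
    max C.cZ (C.cZ ^ 2 * C.lB ^ 2 * C.lQ / (2 * C.ρZ * C.gR))

/-- `c(σ)`. -/
def c (C : Constants) : ℝ := C.Λb * (1 + 1 / C.gQ)

end Constants

/-! ### The overlapping Schwarz algorithm -/

/-- A decomposition `0 = t₀ < t₁ < ⋯ < t_m = T` with overlap sizes. The index `j : Fin m` stands
for the subdomain number `j + 1`, that is `[t_j, t_{j+1}]`. -/
structure Decomposition (T : ℝ) (m : ℕ) where
  t : Fin (m + 1) → ℝ
  t_first : t 0 = 0
  t_last : t (Fin.last m) = T
  t_mono : StrictMono t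
  τ₀ : Fin m → ℝ
  τ₁ : Fin m → ℝ
  τ₀_pos : ∀ j, 0 < τ₀ j
  τ₁_pos : ∀ j, 0 < τ₁ j

namespace Decomposition

variable {T : ℝ} {m : ℕ}

/-- Left end of the overlapping subdomain. -/
def left (P : Decomposition T m) (j : Fin m) : ℝ := max (P.t j.castSucc - P.τ₀ j) 0

/-- Right end of the overlapping subdomain. -/
def right (P : Decomposition T m) (j : Fin m) : ℝ := min (P.t j.succ + P.τ₁ j) T

/-- The smallest overlap size (a minimum over the finite nonempty set of subdomains). -/
def τ (P : Decomposition T m) : ℝ := ⨅ j : Fin m, min (P.τ₀ j) (P.τ₁ j)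

/-- The set of times at which the aggregated iterate is taken from subdomain `j`. -/
def piece (P : Decomposition T m) (j : Fin m) : Set ℝ :=
  if (j : ℕ) + 1 = m then Icc (P.t j.castSucc) (P.t j.succ)
  else Ico (P.t j.castSucc) (P.t j.succ)

end Decomposition

variable {T : ℝ} {m : ℕ}

/-- The terminal cost of the `j`-th subproblem with boundary parameter `q`. -/
def LQData.subTerminal (D : LQData nx nu) (P : Decomposition T m) (j : Fin m) (q : Vec nx)
    (y : Vec nx) : ℝ :=
  if (j : ℕ) + 1 = m then (1 / 2) * bil y D.QT y
  else (1 / 2) * bil y (D.Q (P.right j)) y - bil y (D.Q (P.right j)) q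

/-- `z` solves the `j`-th subproblem with boundary parameters `p, q`. -/
def LQData.IsSubSolution (D : LQData nx nu) (P : Decomposition T m) (j : Fin m)
    (p q : Vec nx) (z : Trajectory nx nu) : Prop :=
  D.IsSolution (P.left j) (P.right j) p (D.subTerminal P j q) z

/-- One iteration of the overlapping Schwarz algorithm: on every subdomain solve the subproblem
with boundary parameters read off the current iterate, and concatenate. -/
def LQData.SchwarzStep (D : LQData nx nu) (P : Decomposition T m)
    (cur next : Trajectory nx nu) : Prop :=
  ∀ j : Fin m, ∃ z : Trajectory nx nu,
    D.IsSubSolution P j (cur.x (P.left j))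
      (cur.x (P.right j) - mulV (D.Q (P.right j))⁻¹ (cur.lam (P.right j))) z ∧
    ∀ t ∈ P.piece j, next.x t = z.x t ∧ next.u t = z.u t ∧ next.lam t = z.lam t

/-- `z k`, `k = 0, 1, 2, …`, are the iterates of the algorithm started from some `z 0` whose state
has the prescribed initial value. -/
structure LQData.IsSchwarzRun (D : LQData nx nu) (P : Decomposition T m) (x0 : Vec nx)
    (z : ℕ → Trajectory nx nu) : Prop where
  init : (z 0).x 0 = x0
  step : ∀ k, D.SchwarzStep P (z k) (z (k + 1))

/-- `‖f‖_∞` over `[0, T]`, as an extended nonnegative real. -/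
def supNorm {n : ℕ} (T : ℝ) (f : ℝ → Vec n) : ℝ≥0∞ := ⨆ t ∈ Icc 0 T, ‖f t‖ₑ

/-- The error `ω`: the maximum of the sup-norm errors in state, control and adjoint. -/
def omega (T : ℝ) (z zs : Trajectory nx nu) : ℝ≥0∞ :=
  max (supNorm T (fun t => z.x t - zs.x t))
    (max (supNorm T (fun t => z.u t - zs.u t)) (supNorm T (fun t => z.lam t - zs.lam t)))

end Schwarz

end

noncomputable section

namespace Schwarz

open scoped NNReal InnerProductSpace

/-! ### Ordinary differential equations and differential inequalities -/

section ODE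

variable {F : Type*} [NormedAddCommGroup F] [NormedSpace ℝ F]

/-! A minimizer with continuous control satisfies the optimality system (state equation, adjoint
equation, stationarity in `u`). This system is linear, so on each overlapping subdomain the
difference between the local solution and the full solution solves it again. Its only data are the
initial error and a defect `e` in the terminal relation `l b = G (x b) + e`. The theorem thus
reduces to showing that the influence of both boundary errors decays exponentially, at a rate
independent of `T`.

If `e = 0`, the pairing `⟪l, x⟫` is a Lyapunov function: its derivative is minus the running cost,
hence at most `-γ_Q ‖x‖²`, and it lies between `c₀ ‖x‖²` and `c₁ ‖x‖²`. The upper bound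
(`inner_upper`) compares with a trajectory steered to zero within time `σ`, which controllability
supplies (`steersToZero_of_gramian`). The lower bound (`inner_lower`) tests the state equation
against an explicit curve. Together they give decay at rate `ρZ = γ_Q / (2 c₁)` (`norm_state_le`).

For `e ≠ 0`, let `X`, `Λ` be the operator solution with final value `(1, G)`. Decay makes `X`
invertible, `P = Λ X⁻¹` is the Riccati operator, and conservation of the symplectic form yields `l =
P x + (X⁻¹)* e`. Substituting this into the state equation leaves a forced linear equation with a
known decaying propagator, so the effect of `e` decays away from `b` (`Problem.sensitivity`).

In the iteration every point of a piece is at distance at least `τ` from each artificial boundary of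
its subdomain, and the true ends carry no error: the initial state is exact and the last subproblem
has the true terminal cost (`LQData.norm_error_le`). -/

lemma hasDerivWithinAt_Ici_of_Icc {f : ℝ → F} {f' : F} {a b t : ℝ}
    (h : HasDerivWithinAt f f' (Icc a b) t) (ht : t ∈ Ico a b) :
    HasDerivWithinAt f f' (Ici t) t := by
  refine h.mono_of_mem_nhdsWithin ?_
  filter_upwards [Ico_mem_nhdsGE ht.2] with s hs
  exact ⟨ht.1.trans hs.1, hs.2.le⟩

/-- Comparison of increments from comparison of derivatives. -/
lemma sub_le_sub_of_hasDerivWithinAt_le {f g f' g' : ℝ → ℝ} {a b : ℝ} (hab : a ≤ b)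
    (hf : ∀ t ∈ Icc a b, HasDerivWithinAt f (f' t) (Icc a b) t)
    (hg : ∀ t ∈ Icc a b, HasDerivWithinAt g (g' t) (Icc a b) t)
    (h : ∀ t ∈ Icc a b, f' t ≤ g' t) : f b - f a ≤ g b - g a := by
  have hd : ∀ t ∈ Icc a b,
      HasDerivWithinAt (fun s => g s - f s) (g' t - f' t) (Icc a b) t :=
    fun t ht => (hg t ht).sub (hf t ht)
  have hm : MonotoneOn (fun s => g s - f s) (Icc a b) :=
    monotoneOn_of_hasDerivWithinAt_nonneg (convex_Icc a b)
      (fun t ht => (hd t ht).continuousWithinAt)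
      (fun t ht => (hd t (interior_subset ht)).mono interior_subset)
      (fun t ht => sub_nonneg.2 (h t (interior_subset ht)))
  have := hm (left_mem_Icc.2 hab) (right_mem_Icc.2 hab) hab
  simp only at this
  linarith

lemma eq_of_hasDerivWithinAt_zero {f : ℝ → F} {a b : ℝ}
    (hf : ∀ t ∈ Icc a b, HasDerivWithinAt f 0 (Icc a b) t) {s t : ℝ} (hs : s ∈ Icc a b)
    (ht : t ∈ Icc a b) : f s = f t := by
  have h := (convex_Icc a b).norm_image_sub_le_of_norm_hasDerivWithin_le
    (f := f) (f' := fun _ => 0) (C := 0) hf (by simp) ht hs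
  simpa [sub_eq_zero] using h

lemma norm_le_mul_exp_of_norm_deriv_le {y y' : ℝ → F} {a b k : ℝ}
    (hy : ∀ t ∈ Icc a b, HasDerivWithinAt y (y' t) (Icc a b) t)
    (hk : ∀ t ∈ Icc a b, ‖y' t‖ ≤ k * ‖y t‖) {t : ℝ} (ht : t ∈ Icc a b) :
    ‖y t‖ ≤ ‖y a‖ * Real.exp (k * (t - a)) := by
  have := norm_le_gronwallBound_of_norm_deriv_right_le (f := y) (f' := y') (δ := ‖y a‖) (K := k)
    (ε := 0) (a := a) (b := b) (fun s hs => (hy s hs).continuousWithinAt)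
    (fun s hs => hasDerivWithinAt_Ici_of_Icc (hy s ⟨hs.1, hs.2.le⟩) hs) le_rfl
    (fun s hs => by simpa using hk s ⟨hs.1, hs.2.le⟩) t ht
  rwa [gronwallBound_ε0] at this

/-- The radial retraction onto the closed ball of radius `r`. -/
def radialRetraction (r : ℝ) (x : F) : F := if ‖x‖ ≤ r then x else (r / ‖x‖) • x

lemma norm_radialRetraction_le {r : ℝ} (hr : 0 ≤ r) (x : F) :
    ‖radialRetraction r x‖ ≤ r ∧ ‖radialRetraction r x‖ ≤ ‖x‖ := by
  unfold radialRetraction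
  split_ifs with h
  · exact ⟨h, le_rfl⟩
  · have hx : 0 < ‖x‖ := hr.trans_lt (not_le.1 h)
    have : ‖(r / ‖x‖) • x‖ = r := by
      rw [norm_smul, Real.norm_of_nonneg (by positivity)]; field_simp
    rw [this]
    exact ⟨le_rfl, (not_le.1 h).le⟩

/-- The constant is 2 rather than 1 because `F` is only a normed space. Any finite constant serves
the truncation argument below. -/
lemma lipschitzWith_radialRetraction {r : ℝ} (hr : 0 ≤ r) :
    LipschitzWith 2 (radialRetraction r : F → F) := by
  have mixed : ∀ x y : F, ‖x‖ ≤ r → ¬ ‖y‖ ≤ r → ‖x - (r / ‖y‖) • y‖ ≤ 2 * ‖x - y‖ := by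
    intro x y hx hy
    have hy0 : 0 < ‖y‖ := hr.trans_lt (not_le.1 hy)
    have h1 : ‖y - (r / ‖y‖) • y‖ = ‖y‖ - r := by
      have : y - (r / ‖y‖) • y = (1 - r / ‖y‖) • y := by rw [sub_smul, one_smul]
      rw [this, norm_smul, Real.norm_of_nonneg]
      · field_simp
      · rw [sub_nonneg, div_le_one hy0]; exact (not_le.1 hy).le
    have h2 : ‖y‖ - ‖x‖ ≤ ‖x - y‖ := by rw [norm_sub_rev]; exact norm_sub_norm_le y x
    have h3 : ‖x - (r / ‖y‖) • y‖ ≤ ‖x - y‖ + ‖y - (r / ‖y‖) • y‖ := by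
      simpa using norm_add_le (x - y) (y - (r / ‖y‖) • y)
    linarith
  refine LipschitzWith.of_dist_le_mul fun x y => ?_
  rw [dist_eq_norm, dist_eq_norm]
  push_cast
  unfold radialRetraction
  split_ifs with hx hy hy
  · linarith [norm_nonneg (x - y)]
  · exact mixed x y hx hy
  · rw [norm_sub_rev, norm_sub_rev x y]; exact mixed y x hy hx
  · have hx0 : 0 < ‖x‖ := hr.trans_lt (not_le.1 hx)
    have hy0 : 0 < ‖y‖ := hr.trans_lt (not_le.1 hy)
    have e : (r / ‖x‖) • x - (r / ‖y‖) • y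
        = (r / ‖x‖) • ((x - y) + ((‖y‖ - ‖x‖) / ‖y‖) • y) := by
      rw [smul_add, smul_sub, smul_smul]
      have : r / ‖x‖ * ((‖y‖ - ‖x‖) / ‖y‖) = r / ‖x‖ - r / ‖y‖ := by field_simp
      rw [this, sub_smul]; abel
    have h1 : ‖((‖y‖ - ‖x‖) / ‖y‖) • y‖ ≤ ‖x - y‖ := by
      rw [norm_smul, norm_div, norm_norm, div_mul_cancel₀ _ hy0.ne', norm_sub_rev x y]
      exact abs_norm_sub_norm_le y x
    have h2 : r / ‖x‖ ≤ 1 := by rw [div_le_one hx0]; exact (not_le.1 hx).le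
    rw [e, norm_smul, Real.norm_of_nonneg (by positivity)]
    calc r / ‖x‖ * ‖(x - y) + ((‖y‖ - ‖x‖) / ‖y‖) • y‖
        ≤ 1 * ‖(x - y) + ((‖y‖ - ‖x‖) / ‖y‖) • y‖ := by gcongr
      _ ≤ 2 * ‖x - y‖ := by linarith [norm_add_le (x - y) (((‖y‖ - ‖x‖) / ‖y‖) • y)]

/-- Global existence for globally Lipschitz vector fields. -/
theorem exists_solution_of_lipschitz [CompleteSpace F] {a b : ℝ} (hab : a ≤ b) {f : ℝ → F → F}
    {K : ℝ≥0} (hlip : ∀ t ∈ Icc a b, LipschitzWith K (f t))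
    (hcont : ∀ x, ContinuousOn (fun t => f t x) (Icc a b)) (x₀ : F) :
    ∃ x : ℝ → F, x a = x₀ ∧ ∀ t ∈ Icc a b, HasDerivWithinAt x (f t (x t)) (Icc a b) t := by
  obtain ⟨M, hM⟩ := isCompact_Icc.exists_bound_of_continuousOn (hcont 0)
  have hM0 : 0 ≤ M := (norm_nonneg _).trans (hM a (left_mem_Icc.2 hab))
  have hgrow : ∀ t ∈ Icc a b, ∀ x, ‖f t x‖ ≤ K * ‖x‖ + M := by
    intro t ht x
    have h1 := (hlip t ht).dist_le_mul x 0
    rw [dist_eq_norm, dist_zero_right] at h1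
    linarith [norm_le_norm_add_norm_sub' (f t x) (f t 0), hM t ht]
  -- `r` is the a priori Grönwall bound for any solution on the whole interval. The field truncated
  -- at radius `r` is globally bounded, so Picard–Lindelöf covers `[a, b]` in one step. Its solution
  -- never leaves the ball, where truncation changes nothing.
  set r : ℝ := gronwallBound ‖x₀‖ K M (b - a) with hr
  have hr0 : 0 ≤ r := by
    have := gronwallBound_mono (norm_nonneg x₀) hM0 K.2 (sub_nonneg.2 hab)
    rw [gronwallBound_x0] at this
    exact (norm_nonneg _).trans this
  set g : ℝ → F → F := fun t x => f t (radialRetraction r x) with hg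
  have hL0 : 0 ≤ K * r + M := by positivity
  have hpl : IsPicardLindelof g (⟨a, left_mem_Icc.2 hab⟩ : Icc a b) x₀
      (⟨(K * r + M) * (b - a), mul_nonneg hL0 (sub_nonneg.2 hab)⟩) 0 ⟨K * r + M, hL0⟩ (K * 2) := by
    constructor
    · intro t ht
      exact ((hlip t ht).comp (lipschitzWith_radialRetraction hr0)).lipschitzOnWith
    · intro x _; exact hcont _
    · intro t ht x _
      refine (hgrow t ht _).trans ?_
      change _ ≤ (K : ℝ) * r + M
      have := (norm_radialRetraction_le hr0 x).1
      gcongr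
    · rw [max_eq_left (by simp [hab])]
      simp only [NNReal.coe_zero, sub_zero]
      exact le_rfl
  obtain ⟨x, hxa, hx⟩ := hpl.exists_eq_forall_mem_Icc_hasDerivWithinAt₀
  refine ⟨x, hxa, fun t ht => ?_⟩
  have hb := norm_le_gronwallBound_of_norm_deriv_right_le (f := x) (f' := fun t => g t (x t))
    (δ := ‖x₀‖) (K := K)
    (ε := M) (a := a) (b := b) (fun s hs => (hx s hs).continuousWithinAt)
    (fun s hs => hasDerivWithinAt_Ici_of_Icc (hx s ⟨hs.1, hs.2.le⟩) hs) (by rw [← hxa])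
    (fun s hs => (hgrow s ⟨hs.1, hs.2.le⟩ _).trans (by
      have := (norm_radialRetraction_le hr0 (x s)).2
      gcongr)) t ht
  have hxr : ‖x t‖ ≤ r :=
    hb.trans (gronwallBound_mono (norm_nonneg x₀) hM0 K.2 (by linarith [ht.2]))
  have := hx t ht
  simpa only [hg, radialRetraction, if_pos hxr] using this

/-- Global existence for linear equations with a forcing term. -/
theorem exists_linear_solution [CompleteSpace F] {a b : ℝ} (hab : a ≤ b) {M : ℝ → F →L[ℝ] F}
    {g : ℝ → F} (hM : ContinuousOn M (Icc a b)) (hg : ContinuousOn g (Icc a b)) (x₀ : F) :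
    ∃ x : ℝ → F, x a = x₀ ∧ ∀ t ∈ Icc a b, HasDerivWithinAt x (M t (x t) + g t) (Icc a b) t := by
  obtain ⟨K, hK⟩ := isCompact_Icc.exists_bound_of_continuousOn hM
  have hK0 : 0 ≤ K := (norm_nonneg _).trans (hK a (left_mem_Icc.2 hab))
  refine exists_solution_of_lipschitz hab (f := fun t x => M t x + g t) (K := ⟨K, hK0⟩) ?_ ?_ x₀
  · intro t ht
    refine LipschitzWith.of_dist_le_mul fun x y => ?_
    rw [dist_add_right, dist_eq_norm, dist_eq_norm, ← map_sub]
    exact (M t).le_of_opNorm_le (hK t ht) _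
  · intro x
    exact (hM.clm_apply continuousOn_const).add hg

lemma hasDerivWithinAt_comp_reflect {f : ℝ → F} {f' : F} {a b t : ℝ}
    (h : HasDerivWithinAt f f' (Icc a b) (a + b - t)) :
    HasDerivWithinAt (fun s => f (a + b - s)) (-f') (Icc a b) t := by
  have h1 : HasDerivWithinAt (fun s : ℝ => a + b - s) (-1) (Icc a b) t := by
    simpa using (hasDerivWithinAt_id t (Icc a b)).const_sub (a + b)
  have := h.scomp t h1 (fun s hs => ⟨by linarith [hs.2], by linarith [hs.1]⟩)
  simpa [Function.comp_def] using this

/-- Fundamental solution of a linear equation, normalized at the left end. -/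
theorem exists_fundamental_left [CompleteSpace F] {a b : ℝ} (hab : a ≤ b) {M : ℝ → F →L[ℝ] F}
    (hM : ContinuousOn M (Icc a b)) :
    ∃ Ψ : ℝ → F →L[ℝ] F, Ψ a = 1 ∧
      ∀ t ∈ Icc a b, HasDerivWithinAt Ψ (M t * Ψ t) (Icc a b) t := by
  have hc : ContinuousOn (fun t => ContinuousLinearMap.mul ℝ (F →L[ℝ] F) (M t)) (Icc a b) :=
    (ContinuousLinearMap.mul ℝ (F →L[ℝ] F)).continuous.comp_continuousOn hM
  obtain ⟨Ψ, h0, h1⟩ := exists_linear_solution hab hc (g := fun _ => 0) continuousOn_const 1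
  exact ⟨Ψ, h0, fun t ht => by simpa using h1 t ht⟩

/-- Fundamental solution of a linear equation, normalized at the right end. -/
theorem exists_fundamental_right [CompleteSpace F] {a b : ℝ} (hab : a ≤ b) {M : ℝ → F →L[ℝ] F}
    (hM : ContinuousOn M (Icc a b)) :
    ∃ Ψ : ℝ → F →L[ℝ] F, Ψ b = 1 ∧
      ∀ t ∈ Icc a b, HasDerivWithinAt Ψ (M t * Ψ t) (Icc a b) t := by
  have hmaps : ∀ t ∈ Icc a b, a + b - t ∈ Icc a b :=
    fun s hs => ⟨by linarith [hs.2], by linarith [hs.1]⟩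
  have hc : ContinuousOn (fun t => -M (a + b - t)) (Icc a b) :=
    (hM.comp (by fun_prop) hmaps).neg
  obtain ⟨Ψ, h0, h1⟩ := exists_fundamental_left hab hc
  refine ⟨fun t => Ψ (a + b - t), by simpa using h0, fun t ht => ?_⟩
  have := hasDerivWithinAt_comp_reflect (h1 _ (hmaps t ht))
  simpa using this

lemma hasDerivWithinAt_ringInverse {R : Type*} [NormedRing R] [NormedAlgebra ℝ R] [CompleteSpace R]
    {f : ℝ → R} {f' : R} {s : Set ℝ} {t : ℝ} (hf : HasDerivWithinAt f f' s t)
    (hu : IsUnit (f t)) :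
    HasDerivWithinAt (fun r => Ring.inverse (f r))
      (-(Ring.inverse (f t) * f' * Ring.inverse (f t))) s t := by
  obtain ⟨u, hu⟩ := hu
  have h := hasFDerivAt_ringInverse (𝕜 := ℝ) u
  rw [hu] at h
  have := h.comp_hasDerivWithinAt t hf
  rw [← hu, Ring.inverse_unit]
  simpa [Function.comp_def] using this

end ODE

/-! ### Scalar estimates for the constants -/

namespace Constants

variable {C : Constants}

lemma Positive.a_pos (h : C.Positive) : 0 < C.a := by
  have := h.lA; have := h.lB; have := h.lH; have := h.gR
  unfold a; positivity

lemma Positive.lA_le_a (h : C.Positive) : C.lA ≤ C.a := by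
  have := h.lB; have := h.lH; have := h.gR
  unfold a
  have : 0 ≤ C.lB * C.lH / C.gR := by positivity
  linarith

lemma Positive.one_lt_exp (h : C.Positive) : 1 < Real.exp (2 * C.a * C.σ) := by
  have := h.a_pos; have := h.σ
  exact Real.one_lt_exp_iff.2 (by positivity)

lemma Positive.αd₀_pos (h : C.Positive) : 0 < C.αd₀ := by
  have := h.a_pos; have := h.σ
  have : Real.exp (-2 * C.a * C.σ) < 1 := Real.exp_lt_one_iff.2 (by nlinarith [mul_pos h.a_pos h.σ])
  unfold αd₀
  exact mul_pos (by positivity) (by linarith)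

lemma Positive.αd₁_pos (h : C.Positive) : 0 < C.αd₁ := by
  have := h.a_pos; have := h.one_lt_exp
  unfold αd₁
  exact mul_pos (by positivity) (by linarith)

lemma Positive.α₀'_pos (h : C.Positive) : 0 < C.α₀' := by
  have := h.α₀; have := h.α₁; have := h.lH; have := h.gR; have := h.lA; have := h.σ
  have : 1 < Real.exp (2 * C.lA * C.σ) := Real.one_lt_exp_iff.2 (by positivity)
  have : 0 < Real.exp (2 * C.lA * C.σ) - 1 := by linarith
  unfold α₀'
  positivity

lemma Positive.α₁'_pos (h : C.Positive) : 0 < C.α₁' := by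
  have := h.lB; have := h.a_pos; have := h.σ
  have : 1 < Real.exp (2 * C.σ * C.a) := Real.one_lt_exp_iff.2 (by positivity)
  have : 0 < Real.exp (2 * C.σ * C.a) - 1 := by linarith
  unfold α₁'
  positivity

lemma Positive.c₀_pos (h : C.Positive) : 0 < C.c₀ := by
  have := h.lB; have := h.gR; have := h.gQ; have := h.a_pos; have := h.αd₀_pos
  have := h.αd₁_pos
  unfold c₀
  positivity

lemma Positive.c₁_pos (h : C.Positive) : 0 < C.c₁ := by
  have := h.lB; have := h.lQ; have := h.lH; have := h.gR; have := h.a_pos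
  unfold c₁
  positivity

lemma Positive.ρZ_pos (h : C.Positive) : 0 < C.ρZ := by
  have := h.c₁_pos; have := h.gQ
  unfold ρZ; positivity

lemma Positive.cZ_pos (h : C.Positive) : 0 < C.cZ := by
  have := h.c₁_pos; have := h.c₀_pos
  unfold cZ; positivity

lemma Positive.Λb_pos (h : C.Positive) : 0 < C.Λb := by
  have := h.cZ_pos; have := h.c₁_pos; have := h.lQ; have := h.lH; have := h.lB; have := h.gR
  unfold Λb; positivity

lemma Positive.c_pos (h : C.Positive) : 0 < C.c := by
  have := h.Λb_pos; have := h.gQ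
  unfold c; positivity

/-- Secant slopes of the convex function `exp` from 0 increase. This compares a Gramian bound with
growth rate `λ_A` to `α₁'`, which is built on the larger rate `a`. -/
lemma Positive.exp_sub_one_div_mono (h : C.Positive) :
    (Real.exp (2 * C.lA * C.σ) - 1) / (2 * C.lA) ≤ (Real.exp (2 * C.a * C.σ) - 1) / (2 * C.a) := by
  have hA := h.lA; have ha := h.a_pos; have hσ := h.σ; have hle := h.lA_le_a
  have hc := convexOn_exp.secant_mono (a := 0) (x := 2 * C.lA * C.σ) (y := 2 * C.a * C.σ)
    (mem_univ _) (mem_univ _) (mem_univ _) (by positivity) (by positivity) (by gcongr)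
  simp only [Real.exp_zero, sub_zero] at hc
  have e : ∀ l : ℝ, (Real.exp (2 * l * C.σ) - 1) / (2 * l)
      = C.σ * ((Real.exp (2 * l * C.σ) - 1) / (2 * l * C.σ)) := by
    intro l
    rw [mul_div_assoc', mul_comm (2 * l) C.σ, mul_div_mul_left _ _ hσ.ne']
  rw [e, e]
  gcongr

/-- The left side is the price of a test curve that falls linearly to zero over time `σ`. The first
entry of the minimum in `c₀` leaves room for it. -/
lemma Positive.lower_const_far (h : C.Positive) :
    C.σ * ((1 / C.σ + C.a) ^ 2 / C.gQ + C.lB ^ 2 / C.gR) ≤ 1 / C.c₀ := by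
  have ha := h.a_pos; have hσ := h.σ; have hB := h.lB; have hQ := h.gQ; have hR := h.gR
  have hd0 := h.αd₀_pos; have hd1 := h.αd₁_pos; have hc0 := h.c₀_pos
  set y := Real.exp (2 * C.a * C.σ) with hy
  have hy2 : 1 + 2 * C.a * C.σ + 2 * (C.a * C.σ) ^ 2 ≤ y := by
    have := Real.quadratic_le_exp_of_nonneg (x := 2 * C.a * C.σ) (by positivity)
    rw [hy]; linarith [this]
  have hy0 : 0 < y := by positivity
  set q := C.lB ^ 2 / C.gR * (1 + C.αd₁ / C.αd₀) ^ 2 + 1 / (C.gQ * C.αd₀ ^ 2) with hq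
  have hq0 : 0 < q := by positivity
  have hc : C.c₀ ≤ 2 * C.a * q⁻¹ * Real.exp (-2 * C.a * C.σ) := by
    unfold c₀; gcongr; exact min_le_left _ _
  have hexp : Real.exp (-2 * C.a * C.σ) = y⁻¹ := by
    rw [hy, ← Real.exp_neg]; congr 1; ring
  rw [hexp] at hc
  have h1 : q * y / (2 * C.a) ≤ 1 / C.c₀ := by
    rw [le_div_iff₀ hc0]
    calc q * y / (2 * C.a) * C.c₀ ≤ q * y / (2 * C.a) * (2 * C.a * q⁻¹ * y⁻¹) := by gcongr
      _ = 1 := by field_simp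
  refine le_trans ?_ h1
  have hdle : C.αd₀ ≤ C.σ := by
    have : 1 - 2 * C.a * C.σ ≤ Real.exp (-2 * C.a * C.σ) := by
      linarith [Real.add_one_le_exp (-2 * C.a * C.σ)]
    unfold αd₀
    rw [one_div_mul_eq_div, div_le_iff₀ (by positivity)]
    linarith
  have hdle' : C.αd₀ ≤ 1 / (2 * C.a) := by
    unfold αd₀
    have := Real.exp_pos (-2 * C.a * C.σ)
    exact mul_le_of_le_one_right (by positivity) (by linarith)
  -- One factor is bounded by each of the two estimates, so that `2a` cancels against the prefactor
  -- in `c₀`.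
  have hd2 : C.αd₀ ^ 2 ≤ C.σ * (1 / (2 * C.a)) := by
    rw [sq]; gcongr
  have p1 : C.σ * ((1 / C.σ + C.a) ^ 2 / C.gQ) ≤ 1 / (C.gQ * C.αd₀ ^ 2) * y / (2 * C.a) := by
    have e1 : C.σ * ((1 / C.σ + C.a) ^ 2 / C.gQ)
        = (1 + 2 * C.a * C.σ + (C.a * C.σ) ^ 2) / (C.gQ * C.σ) := by field_simp; ring
    have e2 : 1 / (C.gQ * C.αd₀ ^ 2) * y / (2 * C.a) = y / (C.gQ * (C.αd₀ ^ 2 * (2 * C.a))) := by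
      field_simp
    rw [e1, e2]
    have : C.αd₀ ^ 2 * (2 * C.a) ≤ C.σ := by
      calc C.αd₀ ^ 2 * (2 * C.a) ≤ C.σ * (1 / (2 * C.a)) * (2 * C.a) := by gcongr
        _ = C.σ := by field_simp
    gcongr
    nlinarith [sq_nonneg (C.a * C.σ)]
  have p2 : C.σ * (C.lB ^ 2 / C.gR) ≤ C.lB ^ 2 / C.gR * (1 + C.αd₁ / C.αd₀) ^ 2 * y / (2 * C.a) := by
    have s1 : (1 : ℝ) ≤ (1 + C.αd₁ / C.αd₀) ^ 2 := by
      have : 0 < C.αd₁ / C.αd₀ := by positivity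
      nlinarith
    have s2 : C.σ ≤ y / (2 * C.a) := by
      rw [le_div_iff₀ (by positivity)]; nlinarith [sq_nonneg (C.a * C.σ)]
    calc C.σ * (C.lB ^ 2 / C.gR) ≤ y / (2 * C.a) * (C.lB ^ 2 / C.gR * (1 + C.αd₁ / C.αd₀) ^ 2) := by
          gcongr
          exact le_mul_of_one_le_right (by positivity) s1
      _ = _ := by ring
  calc _ = C.σ * ((1 / C.σ + C.a) ^ 2 / C.gQ) + C.σ * (C.lB ^ 2 / C.gR) := by ring
    _ ≤ 1 / (C.gQ * C.αd₀ ^ 2) * y / (2 * C.a)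
        + C.lB ^ 2 / C.gR * (1 + C.αd₁ / C.αd₀) ^ 2 * y / (2 * C.a) := add_le_add p1 p2
    _ = _ := by rw [hq]; ring

/-- Price of a test curve following the dual flow on a horizon shorter than `σ`, plus its terminal
term. It is matched with the second entry of the minimum in `c₀`. -/
lemma Positive.lower_const_near (h : C.Positive) :
    Real.exp (2 * C.a * C.σ) / C.gQ
      + C.lB ^ 2 / C.gR * (Real.exp (2 * C.a * C.σ) / (2 * C.a)) ≤ 1 / C.c₀ := by
  have ha := h.a_pos; have hB := h.lB; have hQ := h.gQ; have hR := h.gR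
  have hc0 := h.c₀_pos
  set y := Real.exp (2 * C.a * C.σ) with hy
  have hy0 : 0 < y := by positivity
  set q := C.lB ^ 2 / (2 * C.gR * C.a) + 1 / C.gQ with hq
  have hq0 : 0 < q := by positivity
  have hc : C.c₀ ≤ q⁻¹ * Real.exp (-2 * C.a * C.σ) := by
    unfold c₀; gcongr; exact min_le_right _ _
  have hexp : Real.exp (-2 * C.a * C.σ) = y⁻¹ := by
    rw [hy, ← Real.exp_neg]; congr 1; ring
  rw [hexp] at hc
  have h1 : q * y ≤ 1 / C.c₀ := by
    rw [le_div_iff₀ hc0]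
    calc q * y * C.c₀ ≤ q * y * (q⁻¹ * y⁻¹) := by gcongr
      _ = 1 := by field_simp
  refine le_trans (le_of_eq ?_) h1
  rw [hq]; field_simp; ring

/-- Cost of applying no control on a horizon shorter than `σ`: terminal cost plus running cost. -/
lemma Positive.upper_const_near (h : C.Positive) :
    C.lQ * (Real.exp (2 * C.a * C.σ) + Real.exp (2 * C.a * C.σ) / (2 * C.a)) ≤ C.c₁ := by
  have ha := h.a_pos; have hQ := h.lQ; have hR := h.gR; have hH := h.lH
  have h2 : (C.lQ + C.lH ^ 2 / C.gR) * (1 + 1 / (2 * C.a)) * Real.exp (2 * C.a * C.σ) ≤ C.c₁ := by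
    unfold c₁; gcongr; exact le_max_right _ _
  refine le_trans ?_ h2
  calc _ = C.lQ * (1 + 1 / (2 * C.a)) * Real.exp (2 * C.a * C.σ) := by ring
    _ ≤ _ := by
      gcongr
      have : 0 ≤ C.lH ^ 2 / C.gR := by positivity
      linarith

/-- Growth constant of the running cost along a trajectory steered to the origin. -/
def steerCost (C : Constants) : ℝ :=
  C.lQ * (C.α₁' / C.α₀) ^ 2
    + C.lR * (2 * (C.lB / C.α₀) ^ 2 + 2 * (C.lH / C.gR * (C.α₁ / C.α₀)) ^ 2)

lemma Positive.steerCost_pos (h : C.Positive) : 0 < C.steerCost := by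
  have := h.lQ; have := h.lR; have := h.lB; have := h.α₀; have := h.α₁'_pos
  unfold steerCost; positivity

/-- Steering uses the Gramian of `(A, B)`, while `c₁` is written with the constants `α₀'`, `α₁'` of
the pair `(A - B R⁻¹ H, B)`. Since `1 / α₀' = 2 / α₀ + Y` with `Y > 0`, the latter are the weaker
ones. The hypothesis `hα` prevents `Y` from being too small relative to the `H` contribution. -/
lemma Positive.upper_const_far (h : C.Positive)
    (hα : C.α₀ ≤ C.lB ^ 2 * ((Real.exp (2 * C.lA * C.σ) - 1) / (2 * C.lA))) :
    C.steerCost * (Real.exp (2 * C.a * C.σ) / (2 * C.a)) ≤ C.c₁ := by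
  have ha := h.a_pos; have hQ := h.lQ; have hR := h.gR; have hH := h.lH; have hlR := h.lR
  have hB := h.lB; have h0 := h.α₀; have h1 := h.α₁; have h0' := h.α₀'_pos; have h1' := h.α₁'_pos
  have hA := h.lA
  set E := (Real.exp (2 * C.lA * C.σ) - 1) / (2 * C.lA) with hE
  have hE0 : 0 < E := by
    have : 0 < C.lB ^ 2 * E := h0.trans_le hα
    exact (pos_iff_pos_of_mul_pos this).1 (by positivity)
  set Y := 2 * (C.lH / C.gR) ^ 2 * (1 + C.α₁ / C.α₀) ^ 2 * E with hY
  have hY0 : 0 < Y := by positivity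
  have hinv : 1 / C.α₀' = 2 / C.α₀ + Y := by
    unfold α₀'
    rw [one_div, inv_inv, hY, hE]; field_simp
  have s1 : C.α₁' / C.α₀ ≤ 1 + C.α₁' / C.α₀' := by
    have e1 : C.α₁' / C.α₀' = C.α₁' * (2 / C.α₀ + Y) := by rw [← hinv]; ring
    have e2 : C.α₁' * (2 / C.α₀ + Y) = 2 * (C.α₁' / C.α₀) + C.α₁' * Y := by ring
    rw [e1, e2]
    have : 0 < C.α₁' / C.α₀ := by positivity
    have : 0 < C.α₁' * Y := by positivity
    linarith
  have s2 : 2 * (C.lB / C.α₀) ^ 2 + 2 * (C.lH / C.gR * (C.α₁ / C.α₀)) ^ 2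
      ≤ C.lB ^ 2 / C.α₀' ^ 2 := by
    have e1 : C.lB ^ 2 / C.α₀' ^ 2 = C.lB ^ 2 * (2 / C.α₀ + Y) ^ 2 := by rw [← hinv]; ring
    have e2 : C.lB ^ 2 * (2 / C.α₀ + Y) ^ 2
        = 4 * (C.lB / C.α₀) ^ 2 + 4 * (C.lB ^ 2 * Y / C.α₀) + C.lB ^ 2 * Y ^ 2 := by
      field_simp; ring
    have e3 : (C.lH / C.gR) ^ 2 * (1 + C.α₁ / C.α₀) ^ 2 ≤ C.lB ^ 2 * Y / C.α₀ := by
      rw [le_div_iff₀ h0, hY]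
      calc (C.lH / C.gR) ^ 2 * (1 + C.α₁ / C.α₀) ^ 2 * C.α₀
          ≤ (C.lH / C.gR) ^ 2 * (1 + C.α₁ / C.α₀) ^ 2 * (2 * (C.lB ^ 2 * E)) := by
            gcongr; nlinarith
        _ = _ := by ring
    have e4 : (C.lH / C.gR * (C.α₁ / C.α₀)) ^ 2
        ≤ (C.lH / C.gR) ^ 2 * (1 + C.α₁ / C.α₀) ^ 2 := by
      rw [mul_pow]; gcongr; linarith
    rw [e1, e2]
    have : 0 ≤ C.lB ^ 2 * Y ^ 2 := by positivity
    have : 0 ≤ (C.lB / C.α₀) ^ 2 := by positivity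
    have : 0 ≤ C.lB ^ 2 * Y / C.α₀ := by positivity
    linarith
  have h2 : ((C.lQ + C.lH ^ 2 / C.gR) * (1 + C.α₁' / C.α₀') ^ 2 + C.lR * C.lB ^ 2 / C.α₀' ^ 2)
        * (1 / (2 * C.a)) * Real.exp (2 * C.a * C.σ) ≤ C.c₁ := by
    unfold c₁; gcongr; exact le_max_left _ _
  refine le_trans ?_ h2
  have h3 : C.steerCost ≤ (C.lQ + C.lH ^ 2 / C.gR) * (1 + C.α₁' / C.α₀') ^ 2
      + C.lR * C.lB ^ 2 / C.α₀' ^ 2 := by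
    unfold steerCost
    rw [mul_div_assoc]
    gcongr
    have : 0 ≤ C.lH ^ 2 / C.gR := by positivity
    linarith
  calc C.steerCost * (Real.exp (2 * C.a * C.σ) / (2 * C.a))
      = C.steerCost * (1 / (2 * C.a)) * Real.exp (2 * C.a * C.σ) := by ring
    _ ≤ _ := by gcongr

end Constants

/-! ### The Hamiltonian system of a coercive linear-quadratic problem -/

section Hamiltonian

set_option linter.unusedSectionVars false

variable {E U : Type*} [NormedAddCommGroup E] [InnerProductSpace ℝ E] [CompleteSpace E]
  [NormedAddCommGroup U] [InnerProductSpace ℝ U] [CompleteSpace U]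

/-- The coefficients of a linear-quadratic problem as bounded operators, together with a
candidate `Ri` for the inverse of `R`. -/
structure LQOps (E U : Type*) [NormedAddCommGroup E] [InnerProductSpace ℝ E]
    [NormedAddCommGroup U] [InnerProductSpace ℝ U] where
  A : ℝ → E →L[ℝ] E
  B : ℝ → U →L[ℝ] E
  Q : ℝ → E →L[ℝ] E
  H : ℝ → E →L[ℝ] U
  R : ℝ → U →L[ℝ] U
  Ri : ℝ → U →L[ℝ] U

namespace LQOps

/-- Pointwise boundedness, symmetry and coercivity at time `t`. -/
structure RegularAt (S : LQOps E U) (C : Constants) (t : ℝ) : Prop where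
  boundA : ‖S.A t‖ ≤ C.lA
  boundB : ‖S.B t‖ ≤ C.lB
  boundQ : ‖S.Q t‖ ≤ C.lQ
  boundH : ‖S.H t‖ ≤ C.lH
  boundR : ‖S.R t‖ ≤ C.lR
  symmQ : ∀ x y, ⟪S.Q t x, y⟫_ℝ = ⟪x, S.Q t y⟫_ℝ
  symmR : ∀ x y, ⟪S.R t x, y⟫_ℝ = ⟪x, S.R t y⟫_ℝ
  R_Ri : ∀ w, S.R t (S.Ri t w) = w
  Ri_R : ∀ w, S.Ri t (S.R t w) = w
  R_lower : ∀ w, C.gR * ‖w‖ ^ 2 ≤ ⟪w, S.R t w⟫_ℝ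
  Q_lower : ∀ x, C.gQ * ‖x‖ ^ 2 ≤ ⟪x, S.Q t x⟫_ℝ - ⟪S.H t x, S.Ri t (S.H t x)⟫_ℝ

/-- Continuity of the coefficients on a set of times. -/
structure Cont (S : LQOps E U) (s : Set ℝ) : Prop where
  A : ContinuousOn S.A s
  B : ContinuousOn S.B s
  Q : ContinuousOn S.Q s
  H : ContinuousOn S.H s
  R : ContinuousOn S.R s
  Ri : ContinuousOn S.Ri s

lemma Cont.mono {S : LQOps E U} {s s' : Set ℝ} (h : S.Cont s) (hs : s' ⊆ s) : S.Cont s' :=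
  ⟨h.A.mono hs, h.B.mono hs, h.Q.mono hs, h.H.mono hs, h.R.mono hs, h.Ri.mono hs⟩

/-- The symmetric bilinear form of the running cost. -/
def form (S : LQOps E U) (t : ℝ) (x : E) (u : U) (y : E) (w : U) : ℝ :=
  ⟪x, S.Q t y⟫_ℝ + ⟪u, S.H t y⟫_ℝ + ⟪w, S.H t x⟫_ℝ + ⟪w, S.R t u⟫_ℝ

/-- The closed-loop input `u + R⁻¹ H x`. -/
def shifted (S : LQOps E U) (t : ℝ) (x : E) (u : U) : U := u + S.Ri t (S.H t x)

/-- The drift `A - B R⁻¹ H`. -/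
def drift (S : LQOps E U) (t : ℝ) : E →L[ℝ] E := S.A t - S.B t ∘L S.Ri t ∘L S.H t

variable {S : LQOps E U} {C : Constants} {t : ℝ}

namespace RegularAt

lemma norm_Ri_le (h : S.RegularAt C t) (hC : C.Positive) (w : U) :
    ‖S.Ri t w‖ ≤ ‖w‖ / C.gR := by
  have h1 := h.R_lower (S.Ri t w)
  rw [h.R_Ri] at h1
  have h2 := real_inner_le_norm (S.Ri t w) w
  rw [le_div_iff₀ hC.gR]
  by_cases h0 : ‖S.Ri t w‖ = 0
  · rw [h0]; simp
  · have h3 : 0 < ‖S.Ri t w‖ := lt_of_le_of_ne (norm_nonneg _) (Ne.symm h0)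
    refine le_of_mul_le_mul_left ?_ h3
    nlinarith

lemma norm_H_le (h : S.RegularAt C t) (x : E) : ‖S.H t x‖ ≤ C.lH * ‖x‖ :=
  (S.H t).le_of_opNorm_le h.boundH x

lemma norm_B_le (h : S.RegularAt C t) (w : U) : ‖S.B t w‖ ≤ C.lB * ‖w‖ :=
  (S.B t).le_of_opNorm_le h.boundB w

lemma norm_A_le (h : S.RegularAt C t) (x : E) : ‖S.A t x‖ ≤ C.lA * ‖x‖ :=
  (S.A t).le_of_opNorm_le h.boundA x

lemma norm_adjoint_B_le (h : S.RegularAt C t) (x : E) :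
    ‖(S.B t).adjoint x‖ ≤ C.lB * ‖x‖ :=
  (S.B t).adjoint.le_of_opNorm_le
    ((ContinuousLinearMap.adjoint.norm_map (S.B t)).trans_le h.boundB) x

lemma norm_Ri_H_le (h : S.RegularAt C t) (hC : C.Positive) (x : E) :
    ‖S.Ri t (S.H t x)‖ ≤ C.lH / C.gR * ‖x‖ := by
  have hg := hC.gR
  calc ‖S.Ri t (S.H t x)‖ ≤ ‖S.H t x‖ / C.gR := h.norm_Ri_le hC _
    _ ≤ C.lH * ‖x‖ / C.gR := by gcongr; exact h.norm_H_le x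
    _ = _ := by ring

lemma norm_drift_le (h : S.RegularAt C t) (hC : C.Positive) : ‖S.drift t‖ ≤ C.a := by
  have ha := hC.a_pos
  have hB := hC.lB
  refine ContinuousLinearMap.opNorm_le_bound _ ha.le fun x => ?_
  have h1 : ‖S.B t (S.Ri t (S.H t x))‖ ≤ C.lB * (C.lH / C.gR * ‖x‖) :=
    (h.norm_B_le _).trans (by gcongr; exact h.norm_Ri_H_le hC x)
  calc ‖S.drift t x‖ = ‖S.A t x - S.B t (S.Ri t (S.H t x))‖ := rfl
    _ ≤ ‖S.A t x‖ + ‖S.B t (S.Ri t (S.H t x))‖ := norm_sub_le _ _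
    _ ≤ C.lA * ‖x‖ + C.lB * (C.lH / C.gR * ‖x‖) := add_le_add (h.norm_A_le x) h1
    _ = C.a * ‖x‖ := by unfold Constants.a; ring

/-- Completing the square in `u`. The Schur complement `Q - Hᵀ R⁻¹ H` and the shifted control
appear, so both parts of coercivity apply at once. -/
lemma form_self_eq (h : S.RegularAt C t) (x : E) (u : U) :
    S.form t x u x u = (⟪x, S.Q t x⟫_ℝ - ⟪S.H t x, S.Ri t (S.H t x)⟫_ℝ)
      + ⟪S.shifted t x u, S.R t (S.shifted t x u)⟫_ℝ := by
  have h1 : ⟪S.Ri t (S.H t x), S.R t u⟫_ℝ = ⟪u, S.H t x⟫_ℝ := by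
    rw [← h.symmR, h.R_Ri, real_inner_comm]
  have h2 : ⟪S.Ri t (S.H t x), S.H t x⟫_ℝ = ⟪S.H t x, S.Ri t (S.H t x)⟫_ℝ := real_inner_comm _ _
  simp only [form, shifted, map_add, h.R_Ri, inner_add_left, inner_add_right, h1, h2]
  ring

lemma le_form_self (h : S.RegularAt C t) (x : E) (u : U) :
    C.gQ * ‖x‖ ^ 2 + C.gR * ‖S.shifted t x u‖ ^ 2 ≤ S.form t x u x u := by
  rw [h.form_self_eq]
  exact add_le_add (h.Q_lower x) (h.R_lower _)

lemma form_self_nonneg (h : S.RegularAt C t) (hC : C.Positive) (x : E) (u : U) :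
    0 ≤ S.form t x u x u := by
  have := hC.gQ; have := hC.gR
  exact le_trans (by positivity) (h.le_form_self x u)

lemma inner_Ri_nonneg (h : S.RegularAt C t) (hC : C.Positive) (w : U) :
    0 ≤ ⟪w, S.Ri t w⟫_ℝ := by
  have h1 := h.R_lower (S.Ri t w)
  rw [h.R_Ri, real_inner_comm] at h1
  have := hC.gR
  exact le_trans (by positivity) h1

lemma inner_Q_le (h : S.RegularAt C t) (x : E) : ⟪x, S.Q t x⟫_ℝ ≤ C.lQ * ‖x‖ ^ 2 := by
  calc ⟪x, S.Q t x⟫_ℝ ≤ ‖x‖ * ‖S.Q t x‖ := real_inner_le_norm _ _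
    _ ≤ ‖x‖ * (C.lQ * ‖x‖) := by gcongr; exact (S.Q t).le_of_opNorm_le h.boundQ x
    _ = _ := by ring

lemma form_self_le (h : S.RegularAt C t) (hC : C.Positive) (x : E) (u : U) :
    S.form t x u x u ≤ C.lQ * ‖x‖ ^ 2 + C.lR * ‖S.shifted t x u‖ ^ 2 := by
  rw [h.form_self_eq]
  have h1 := h.inner_Q_le x
  have h2 := h.inner_Ri_nonneg hC (S.H t x)
  have h3 : ⟪S.shifted t x u, S.R t (S.shifted t x u)⟫_ℝ ≤ C.lR * ‖S.shifted t x u‖ ^ 2 := by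
    calc _ ≤ ‖S.shifted t x u‖ * ‖S.R t (S.shifted t x u)‖ := real_inner_le_norm _ _
      _ ≤ ‖S.shifted t x u‖ * (C.lR * ‖S.shifted t x u‖) := by
        gcongr; exact (S.R t).le_of_opNorm_le h.boundR _
      _ = _ := by ring
  linarith

lemma form_comm (h : S.RegularAt C t) (x : E) (u : U) (y : E) (w : U) :
    S.form t x u y w = S.form t y w x u := by
  unfold form
  rw [← h.symmQ x y, real_inner_comm y, ← h.symmR w u, real_inner_comm u (S.R t w)]
  ring

/-- Convexity of the running cost: expand the nonnegative form at `(y - x, w - u)`. -/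
lemma two_mul_form_sub_le (h : S.RegularAt C t) (hC : C.Positive) (x : E) (u : U) (y : E) (w : U) :
    2 * S.form t x u y w - S.form t x u x u ≤ S.form t y w y w := by
  have h0 := h.form_self_nonneg hC (y - x) (w - u)
  have h1 := h.form_comm x u y w
  have h2 : S.form t (y - x) (w - u) (y - x) (w - u)
      = S.form t y w y w - S.form t x u y w - S.form t y w x u + S.form t x u x u := by
    simp only [form, map_sub, inner_sub_left, inner_sub_right]; ring
  linarith

end RegularAt

/-- Dynamics `ẋ = A x + B u` on `[a, b]`. -/
def IsTraj (S : LQOps E U) (a b : ℝ) (x : ℝ → E) (u : ℝ → U) : Prop :=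
  ∀ s ∈ Icc a b, HasDerivWithinAt x (S.A s (x s) + S.B s (u s)) (Icc a b) s

/-- The optimality system: state equation, adjoint equation and stationarity in the control. -/
structure IsHam (S : LQOps E U) (a b : ℝ) (x : ℝ → E) (u : ℝ → U) (l : ℝ → E) : Prop where
  traj : S.IsTraj a b x u
  adj : ∀ s ∈ Icc a b, HasDerivWithinAt l
    (-((S.A s).adjoint (l s)) - S.Q s (x s) - (S.H s).adjoint (u s)) (Icc a b) s
  stat : ∀ s ∈ Icc a b, S.R s (u s) + S.H s (x s) + (S.B s).adjoint (l s) = 0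

variable {a b : ℝ} {x y l l₁ l₂ x₁ x₂ : ℝ → E} {u w u₁ u₂ : ℝ → U}

lemma IsTraj.mono {a' b' : ℝ} (h : S.IsTraj a b x u) (hs : Icc a' b' ⊆ Icc a b) :
    S.IsTraj a' b' x u :=
  fun s hs' => (h s (hs hs')).mono hs

lemma IsHam.mono {a' b' : ℝ} (h : S.IsHam a b x u l) (hs : Icc a' b' ⊆ Icc a b) :
    S.IsHam a' b' x u l :=
  ⟨h.traj.mono hs, fun s hs' => (h.adj s (hs hs')).mono hs, fun s hs' => h.stat s (hs hs')⟩

lemma IsHam.sub (h₁ : S.IsHam a b x₁ u₁ l₁) (h₂ : S.IsHam a b x₂ u₂ l₂) :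
    S.IsHam a b (fun s => x₁ s - x₂ s) (fun s => u₁ s - u₂ s) (fun s => l₁ s - l₂ s) := by
  refine ⟨fun s hs => ?_, fun s hs => ?_, fun s hs => ?_⟩
  · convert! (h₁.traj s hs).sub (h₂.traj s hs) using 1
    simp only [map_sub]; abel
  · convert! (h₁.adj s hs).sub (h₂.adj s hs) using 1
    simp only [map_sub]; abel
  · have := congrArg₂ (· - ·) (h₁.stat s hs) (h₂.stat s hs)
    simp only [sub_self] at this
    rw [← this]
    simp only [map_sub]; abel

/-- Stationarity replaces `⟪l, B w⟫` by control terms and the `A` terms cancel against the adjoint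
equation. The partner `(y, w)` may be any trajectory; the choices `y = x`, another solution, or a
competitor give energy decay, symplecticity and cost comparison respectively. -/
lemma IsHam.hasDerivWithinAt_inner (h : S.IsHam a b x u l) (hr : ∀ s ∈ Icc a b, S.RegularAt C s)
    (hy : S.IsTraj a b y w) :
    ∀ s ∈ Icc a b, HasDerivWithinAt (fun s => ⟪l s, y s⟫_ℝ)
      (-S.form s (x s) (u s) (y s) (w s)) (Icc a b) s := by
  intro s hs
  convert! (h.adj s hs).inner ℝ (hy s hs) using 1
  have h1 : ⟪l s, S.B s (w s)⟫_ℝ = -⟪w s, S.R s (u s)⟫_ℝ - ⟪w s, S.H s (x s)⟫_ℝ := by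
    rw [← ContinuousLinearMap.adjoint_inner_left]
    have : (S.B s).adjoint (l s) = -(S.R s (u s) + S.H s (x s)) :=
      eq_neg_of_add_eq_zero_right (h.stat s hs)
    rw [this, inner_neg_left, inner_add_left, real_inner_comm (w s), real_inner_comm (w s)]
    ring
  simp only [inner_add_right, inner_sub_left, inner_neg_left,
    ContinuousLinearMap.adjoint_inner_left, h1, form, (hr s hs).symmQ]
  ring

/-- The canonical symplectic form is constant along pairs of solutions. -/
lemma IsHam.symplectic (h₁ : S.IsHam a b x₁ u₁ l₁) (h₂ : S.IsHam a b x₂ u₂ l₂)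
    (hr : ∀ s ∈ Icc a b, S.RegularAt C s) {s t : ℝ} (hs : s ∈ Icc a b) (ht : t ∈ Icc a b) :
    ⟪l₁ s, x₂ s⟫_ℝ - ⟪l₂ s, x₁ s⟫_ℝ = ⟪l₁ t, x₂ t⟫_ℝ - ⟪l₂ t, x₁ t⟫_ℝ := by
  refine eq_of_hasDerivWithinAt_zero (f := fun s => ⟪l₁ s, x₂ s⟫_ℝ - ⟪l₂ s, x₁ s⟫_ℝ)
    (fun r hr' => ?_) hs ht
  convert! (h₁.hasDerivWithinAt_inner hr h₂.traj r hr').sub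
    (h₂.hasDerivWithinAt_inner hr h₁.traj r hr') using 1
  rw [(hr r hr').form_comm (x₁ r)]; ring

/-- `⟪l, x⟫` is nonincreasing along solutions of the optimality system. -/
lemma IsHam.inner_antitone (h : S.IsHam a b x u l) (hC : C.Positive)
    (hr : ∀ s ∈ Icc a b, S.RegularAt C s) (hab : a ≤ b) : ⟪l b, x b⟫_ℝ ≤ ⟪l a, x a⟫_ℝ := by
  have := sub_le_sub_of_hasDerivWithinAt_le hab (h.hasDerivWithinAt_inner hr h.traj)
    (fun s _ => hasDerivWithinAt_const s _ (0 : ℝ))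
    (fun s hs => by linarith [(hr s hs).form_self_nonneg hC (x s) (u s)])
  simp only [sub_self] at this
  linarith

/-- Solutions of the optimality system are no more expensive than competing trajectories. -/
lemma IsHam.inner_le_of_competitor (h : S.IsHam a b x u l) (hC : C.Positive)
    (hr : ∀ s ∈ Icc a b, S.RegularAt C s) (hab : a ≤ b) (hy : S.IsTraj a b y w)
    (hya : y a = x a) {κ κ' : ℝ → ℝ}
    (hκ : ∀ s ∈ Icc a b, HasDerivWithinAt κ (κ' s) (Icc a b) s)
    (hle : ∀ s ∈ Icc a b, S.form s (y s) (w s) (y s) (w s) ≤ κ' s) :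
    ⟪l a, x a⟫_ℝ ≤ 2 * ⟪l b, y b⟫_ℝ - ⟪l b, x b⟫_ℝ + (κ b - κ a) := by
  -- The compared quantity is `⟪l, x⟫ - 2 ⟪l, y⟫`. Its derivative is bounded by the cost of the
  -- competitor, and at `a` it equals `-⟪l a, x a⟫` because the states agree there.
  have := sub_le_sub_of_hasDerivWithinAt_le hab
    (fun s hs => ((h.hasDerivWithinAt_inner hr h.traj s hs).sub
      ((h.hasDerivWithinAt_inner hr hy s hs).const_mul 2))) hκ
    (fun s hs => by
      have := (hr s hs).two_mul_form_sub_le hC (x s) (u s) (y s) (w s)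
      have := hle s hs
      linarith)
  simp only [hya, Pi.sub_apply] at this
  linarith

/-- Lower bound for `⟪l, x⟫` by testing the state equation against a curve `μ`. -/
lemma IsHam.norm_sq_le_of_test (h : S.IsHam a b x u l) (hC : C.Positive)
    (hr : ∀ s ∈ Icc a b, S.RegularAt C s) (hab : a ≤ b) {μ μ' : ℝ → E} {ρ m κ κ' : ℝ → ℝ}
    (hμ : ∀ s ∈ Icc a b, HasDerivWithinAt μ (μ' s) (Icc a b) s)
    (hρ : ∀ s ∈ Icc a b, ‖μ' s + (S.drift s).adjoint (μ s)‖ ≤ ρ s)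
    (hm : ∀ s ∈ Icc a b, ‖μ s‖ ≤ m s)
    (hκ : ∀ s ∈ Icc a b, HasDerivWithinAt κ (κ' s) (Icc a b) s)
    (hκ' : ∀ s ∈ Icc a b, ρ s ^ 2 / C.gQ + C.lB ^ 2 * m s ^ 2 / C.gR ≤ κ' s)
    {K : ℝ} (hK : 0 < K) :
    ⟪μ a, x a⟫_ℝ ≤ ⟪μ b, x b⟫_ℝ + K / 2 * (⟪l a, x a⟫_ℝ - ⟪l b, x b⟫_ℝ)
      + 1 / (2 * K) * (κ b - κ a) := by
  have hgQ := hC.gQ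
  have hgR := hC.gR
  have hlB := hC.lB
  have key := sub_le_sub_of_hasDerivWithinAt_le hab
    (fun s hs => (((hμ s hs).inner ℝ (h.traj s hs)).neg))
    (fun s hs => ((h.hasDerivWithinAt_inner hr h.traj s hs).const_mul (-(K / 2))).add
      ((hκ s hs).const_mul (1 / (2 * K))))
    (fun s hs => by
      set v := S.shifted s (x s) (u s) with hv
      -- The dynamics are rewritten as `ẋ = (drift) x + B v` with `v` the shifted control, since the
      -- coercive bound controls exactly `‖x‖` and `‖v‖`.
      have e : ⟪μ s, S.A s (x s) + S.B s (u s)⟫_ℝ + ⟪μ' s, x s⟫_ℝ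
          = ⟪μ' s + (S.drift s).adjoint (μ s), x s⟫_ℝ + ⟪μ s, S.B s v⟫_ℝ := by
        rw [inner_add_left, ContinuousLinearMap.adjoint_inner_left, hv]
        simp only [drift, shifted, map_add, sub_apply,
          ContinuousLinearMap.comp_apply, inner_add_right, inner_sub_right]
        ring
      rw [e]
      have ρ0 : 0 ≤ ρ s := (norm_nonneg _).trans (hρ s hs)
      have m0 : 0 ≤ m s := (norm_nonneg _).trans (hm s hs)
      have i1 : -⟪μ' s + (S.drift s).adjoint (μ s), x s⟫_ℝ ≤ ρ s * ‖x s‖ :=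
        (neg_le_abs _).trans ((abs_real_inner_le_norm _ _).trans (by
          gcongr; exact hρ s hs))
      have i2 : -⟪μ s, S.B s v⟫_ℝ ≤ m s * (C.lB * ‖v‖) :=
        (neg_le_abs _).trans ((abs_real_inner_le_norm _ _).trans (by
          gcongr
          · exact hm s hs
          · exact (hr s hs).norm_B_le v))
      have i3 := (hr s hs).le_form_self (x s) (u s)
      rw [← hv] at i3
      -- Young's inequality with free weight `K`: the `q` part goes into the running cost, the `p`
      -- part into `κ`.
      have young : ∀ p q g : ℝ, 0 < g → p * q ≤ K / 2 * (g * q ^ 2) + 1 / (2 * K) * (p ^ 2 / g) := by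
        intro p q g hg
        have : K / 2 * (g * q ^ 2) + 1 / (2 * K) * (p ^ 2 / g) - p * q
            = (K * g * q - p) ^ 2 / (2 * K * g) := by field_simp; ring
        have : 0 ≤ (K * g * q - p) ^ 2 / (2 * K * g) := by positivity
        linarith
      have i4 := young (ρ s) ‖x s‖ C.gQ hgQ
      have i5 := young (C.lB * m s) ‖v‖ C.gR hgR
      rw [mul_pow] at i5
      have i6 := mul_le_mul_of_nonneg_left i3 (show 0 ≤ K / 2 by positivity)
      have i7 := mul_le_mul_of_nonneg_left (hκ' s hs) (show 0 ≤ 1 / (2 * K) by positivity)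
      rw [mul_add] at i6 i7
      nlinarith)
  simp only [Pi.neg_apply, Pi.add_apply] at key
  linarith

end LQOps

end Hamiltonian

/-! ### Two-sided quadratic bounds for `⟪l, x⟫` and exponential decay. -/

section RiccatiBounds

set_option linter.unusedSectionVars false

variable {E U : Type*} [NormedAddCommGroup E] [InnerProductSpace ℝ E] [CompleteSpace E]
  [NormedAddCommGroup U] [InnerProductSpace ℝ U] [CompleteSpace U]

/-- A symmetric terminal weight with `γ_Q ≤ G ≤ λ_Q`. -/
structure IsWeight (C : Constants) (G : E →L[ℝ] E) : Prop where
  symm : ∀ x y, ⟪G x, y⟫_ℝ = ⟪x, G y⟫_ℝ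
  lower : ∀ x, C.gQ * ‖x‖ ^ 2 ≤ ⟪x, G x⟫_ℝ
  upper : ∀ x, ⟪x, G x⟫_ℝ ≤ C.lQ * ‖x‖ ^ 2

lemma IsWeight.nonneg {C : Constants} {G : E →L[ℝ] E} (hG : IsWeight C G) (hC : C.Positive) (x : E) :
    0 ≤ ⟪x, G x⟫_ℝ := by
  have := hC.gQ
  exact le_trans (by positivity) (hG.lower x)

lemma hasDerivWithinAt_mul_exp (c k a t : ℝ) (s : Set ℝ) :
    HasDerivWithinAt (fun r => c * Real.exp (k * (r - a))) (c * (k * Real.exp (k * (t - a)))) s t := by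
  have h : HasDerivAt (fun r => k * (r - a)) k t := by
    simpa using ((hasDerivAt_id t).sub_const a).const_mul k
  have := (h.exp.const_mul c).hasDerivWithinAt (s := s)
  convert! this using 1
  ring

namespace LQOps

variable {S : LQOps E U} {C : Constants}

/-- From time `t` every state can be steered to the origin within time `σ` at a running cost
compatible with the constant `c₁`. -/
def SteersToZero (S : LQOps E U) (C : Constants) (t : ℝ) : Prop :=
  ∀ ξ : E, ∃ t₁ ∈ Icc t (t + C.σ), ∃ (y : ℝ → E) (w : ℝ → U) (K : ℝ),
    S.IsTraj t t₁ y w ∧ y t = ξ ∧ y t₁ = 0 ∧ 0 ≤ K ∧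
      K * (Real.exp (2 * C.a * C.σ) / (2 * C.a)) ≤ C.c₁ ∧
      ∀ s ∈ Icc t t₁, S.form s (y s) (w s) (y s) (w s) ≤ K * Real.exp (2 * C.a * (s - t)) * ‖ξ‖ ^ 2

variable {G : E →L[ℝ] E} {a b : ℝ} {x l : ℝ → E} {u : ℝ → U}

lemma IsHam.inner_nonneg (h : S.IsHam a b x u l) (hC : C.Positive)
    (hr : ∀ s ∈ Icc a b, S.RegularAt C s) (hG : IsWeight C G) (hl : l b = G (x b))
    {t : ℝ} (ht : t ∈ Icc a b) : 0 ≤ ⟪l t, x t⟫_ℝ := by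
  have hsub : Icc t b ⊆ Icc a b := Icc_subset_Icc_left ht.1
  have h1 := (h.mono hsub).inner_antitone hC (fun s hs => hr s (hsub hs)) ht.2
  rw [hl, real_inner_comm] at h1
  exact (hG.nonneg hC _).trans h1

/-- A state of size `‖x a‖` cannot be removed cheaply. Testing with a curve `μ` that starts at `x a`
produces `‖x a‖²`, and the weight `K = 1 / c₀` makes the price of `μ` at most half of it, to be
absorbed on the left. -/
lemma IsHam.inner_lower (h : S.IsHam a b x u l) (hc : S.Cont (Icc a b)) (hC : C.Positive)
    (hr : ∀ s ∈ Icc a b, S.RegularAt C s) (hab : a ≤ b) (hG : IsWeight C G) (hl : l b = G (x b)) :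
    C.c₀ * ‖x a‖ ^ 2 ≤ ⟪l a, x a⟫_ℝ := by
  have hc0 := hC.c₀_pos
  have hσ := hC.σ
  have ha := hC.a_pos
  have hgQ := hC.gQ
  have hgR := hC.gR
  have hlB := hC.lB
  set ξ := x a with hξ
  have hK : (0 : ℝ) < 1 / C.c₀ := by positivity
  suffices hmain : ‖ξ‖ ^ 2 ≤ 1 / C.c₀ / 2 * ⟪l a, ξ⟫_ℝ + ‖ξ‖ ^ 2 / 2 by
    have : ‖ξ‖ ^ 2 ≤ 1 / C.c₀ * ⟪l a, ξ⟫_ℝ := by linarith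
    rw [one_div, inv_mul_eq_div, le_div_iff₀ hc0] at this
    linarith
  have hdr : ∀ s ∈ Icc a b, ∀ z, ‖(S.drift s).adjoint z‖ ≤ C.a * ‖z‖ := fun s hs z =>
    (S.drift s).adjoint.le_of_opNorm_le
      ((ContinuousLinearMap.adjoint.norm_map (S.drift s)).trans_le ((hr s hs).norm_drift_le hC)) z
  by_cases hfar : a + C.σ ≤ b
  · set t₁ := a + C.σ with ht₁
    have hat : a ≤ t₁ := by linarith
    have hsub : Icc a t₁ ⊆ Icc a b := Icc_subset_Icc_right hfar
    have hsc : ∀ s ∈ Icc a t₁, 0 ≤ 1 - (s - a) / C.σ ∧ 1 - (s - a) / C.σ ≤ 1 := by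
      intro s hs
      have h1 : (s - a) / C.σ ≤ 1 := by rw [div_le_one hσ]; linarith [hs.2]
      have h2 : 0 ≤ (s - a) / C.σ := div_nonneg (by linarith [hs.1]) hσ.le
      constructor <;> linarith
    set k := ((1 / C.σ + C.a) * ‖ξ‖) ^ 2 / C.gQ + C.lB ^ 2 * ‖ξ‖ ^ 2 / C.gR with hk
    have hm : ∀ s ∈ Icc a t₁, ‖(1 - (s - a) / C.σ) • ξ‖ ≤ ‖ξ‖ := by
      intro s hs
      rw [norm_smul, Real.norm_of_nonneg (hsc s hs).1]
      exact mul_le_of_le_one_left (norm_nonneg _) (hsc s hs).2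
    -- The ramp vanishes at `a + σ`, so no boundary term survives there and only `⟪l, x⟫ ≥ 0` is
    -- needed at that time.
    have key := (h.mono hsub).norm_sq_le_of_test hC (fun s hs => hr s (hsub hs)) hat
      (μ := fun s => (1 - (s - a) / C.σ) • ξ) (μ' := fun _ => (-(1 / C.σ)) • ξ)
      (ρ := fun _ => (1 / C.σ + C.a) * ‖ξ‖) (m := fun _ => ‖ξ‖) (κ := fun s => k * s)
      (κ' := fun _ => k)
      (fun s _ => by
        have : HasDerivAt (fun s : ℝ => 1 - (s - a) / C.σ) (-(1 / C.σ)) s :=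
          (((hasDerivAt_id s).sub_const a).div_const C.σ).const_sub 1
        exact (this.smul_const ξ).hasDerivWithinAt)
      (fun s hs => by
        refine (norm_add_le _ _).trans ?_
        rw [norm_smul, norm_neg, Real.norm_of_nonneg (by positivity), add_mul]
        gcongr
        refine (hdr s (hsub hs) _).trans ?_
        gcongr
        exact hm s hs)
      hm (fun s _ => by simpa using ((hasDerivAt_id s).const_mul k).hasDerivWithinAt)
      (fun s _ => le_rfl) hK
    have e1 : (1 - (t₁ - a) / C.σ) = 0 := by rw [ht₁]; field_simp; ring
    have e2 : (1 - (a - a) / C.σ) = 1 := by simp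
    simp only [e1, e2, zero_smul, one_smul, inner_zero_left, ← hξ, real_inner_self_eq_norm_sq] at key
    have hV := h.inner_nonneg hC hr hG hl (t := t₁) ⟨hat, hfar⟩
    have hkle : k * t₁ - k * a ≤ 1 / C.c₀ * ‖ξ‖ ^ 2 := by
      have := mul_le_mul_of_nonneg_right hC.lower_const_far (sq_nonneg ‖ξ‖)
      calc k * t₁ - k * a = C.σ * ((1 / C.σ + C.a) ^ 2 / C.gQ + C.lB ^ 2 / C.gR) * ‖ξ‖ ^ 2 := by
            rw [hk, ht₁]; ring
        _ ≤ _ := this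
    have h3 : 1 / (2 * (1 / C.c₀)) * (k * t₁ - k * a) ≤ ‖ξ‖ ^ 2 / 2 := by
      calc _ ≤ 1 / (2 * (1 / C.c₀)) * (1 / C.c₀ * ‖ξ‖ ^ 2) := by gcongr
        _ = _ := by field_simp
    have h4 := mul_nonneg (show 0 ≤ 1 / C.c₀ / 2 by positivity) hV
    rw [mul_sub] at key
    linarith
  -- On a short horizon there is no time for a ramp. Here `μ` solves the dual equation, so its
  -- residual is zero, and the boundary term at `b` is absorbed by the terminal weight `G ≥ γ_Q`.
  · have hcd : ContinuousOn (fun s => -(S.drift s).adjoint) (Icc a b) := by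
      have : ContinuousOn (fun s => S.drift s) (Icc a b) :=
        hc.A.sub (hc.B.clm_comp (hc.Ri.clm_comp hc.H))
      exact (ContinuousLinearMap.adjoint.continuous.comp_continuousOn this).neg
    obtain ⟨μ, hμa, hμ⟩ := exists_linear_solution hab hcd (g := fun _ => 0) continuousOn_const ξ
    have hμ' : ∀ s ∈ Icc a b, HasDerivWithinAt μ (-((S.drift s).adjoint (μ s))) (Icc a b) s :=
      fun s hs => by simpa using hμ s hs
    have hμn : ∀ s ∈ Icc a b, ‖μ s‖ ≤ ‖ξ‖ * Real.exp (C.a * (s - a)) := by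
      intro s hs
      have := norm_le_mul_exp_of_norm_deriv_le hμ' (k := C.a)
        (fun r hr' => by rw [norm_neg]; exact hdr r hr' _) hs
      rwa [hμa] at this
    set q := C.lB ^ 2 / C.gR * ‖ξ‖ ^ 2 / (2 * C.a) with hq
    have hsq : ∀ s, (‖ξ‖ * Real.exp (C.a * (s - a))) ^ 2
        = ‖ξ‖ ^ 2 * Real.exp (2 * C.a * (s - a)) := by
      intro s
      rw [mul_pow, ← Real.exp_nat_mul]; congr 2; push_cast; ring
    have key := h.norm_sq_le_of_test hC hr hab (ρ := fun _ => 0)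
      (m := fun s => ‖ξ‖ * Real.exp (C.a * (s - a)))
      (κ := fun s => q * Real.exp (2 * C.a * (s - a)))
      (κ' := fun s => q * (2 * C.a * Real.exp (2 * C.a * (s - a)))) hμ'
      (fun s hs => by simp) hμn
      (fun s _ => hasDerivWithinAt_mul_exp _ _ _ _ _)
      (fun s _ => by
        rw [hsq, hq]
        apply le_of_eq; field_simp; ring) hK
    have hexp : Real.exp (2 * C.a * (b - a)) ≤ Real.exp (2 * C.a * C.σ) := by
      gcongr; linarith
    have hVb : C.gQ * ‖x b‖ ^ 2 ≤ ⟪l b, x b⟫_ℝ := by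
      rw [hl, real_inner_comm]; exact hG.lower _
    have hμb : ‖μ b‖ ^ 2 ≤ ‖ξ‖ ^ 2 * Real.exp (2 * C.a * C.σ) := by
      calc ‖μ b‖ ^ 2 ≤ (‖ξ‖ * Real.exp (C.a * (b - a))) ^ 2 := by
            gcongr; exact hμn b (right_mem_Icc.2 hab)
        _ = ‖ξ‖ ^ 2 * Real.exp (2 * C.a * (b - a)) := hsq b
        _ ≤ _ := by gcongr
    have hin : ⟪μ b, x b⟫_ℝ ≤ 1 / C.c₀ / 2 * (C.gQ * ‖x b‖ ^ 2)
        + 1 / (2 * (1 / C.c₀)) * (‖μ b‖ ^ 2 / C.gQ) := by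
      refine (real_inner_le_norm _ _).trans ?_
      have : 1 / C.c₀ / 2 * (C.gQ * ‖x b‖ ^ 2) + 1 / (2 * (1 / C.c₀)) * (‖μ b‖ ^ 2 / C.gQ)
          - ‖μ b‖ * ‖x b‖ = (C.gQ * ‖x b‖ - C.c₀ * ‖μ b‖) ^ 2 / (2 * C.c₀ * C.gQ) := by
        field_simp; ring
      have : 0 ≤ (C.gQ * ‖x b‖ - C.c₀ * ‖μ b‖) ^ 2 / (2 * C.c₀ * C.gQ) := by positivity
      linarith
    rw [hμa, ← hξ, real_inner_self_eq_norm_sq] at key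
    have h4 := mul_le_mul_of_nonneg_left hVb (show 0 ≤ 1 / C.c₀ / 2 by positivity)
    have hq0 : 0 ≤ q := by positivity
    have hsum : ‖μ b‖ ^ 2 / C.gQ + (q * Real.exp (2 * C.a * (b - a)) - q * Real.exp (2 * C.a * (a - a)))
        ≤ 1 / C.c₀ * ‖ξ‖ ^ 2 := by
      have := mul_le_mul_of_nonneg_right hC.lower_const_near (sq_nonneg ‖ξ‖)
      calc _ ≤ ‖ξ‖ ^ 2 * Real.exp (2 * C.a * C.σ) / C.gQ + (q * Real.exp (2 * C.a * C.σ) - 0) := by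
            gcongr
            positivity
        _ = (Real.exp (2 * C.a * C.σ) / C.gQ
          + C.lB ^ 2 / C.gR * (Real.exp (2 * C.a * C.σ) / (2 * C.a))) * ‖ξ‖ ^ 2 := by
            rw [hq]; ring
        _ ≤ _ := this
    have h5 := mul_le_mul_of_nonneg_left hsum (show 0 ≤ 1 / (2 * (1 / C.c₀)) by positivity)
    have h6 : 1 / (2 * (1 / C.c₀)) * (1 / C.c₀ * ‖ξ‖ ^ 2) = ‖ξ‖ ^ 2 / 2 := by field_simp
    rw [mul_sub] at key
    rw [mul_add, h6] at h5
    linarith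

/-- Compare with a competitor: a trajectory steered to zero if time `σ` is available, and otherwise
the uncontrolled one, whose growth over less than `σ` is bounded. -/
lemma IsHam.inner_upper (h : S.IsHam a b x u l) (hc : S.Cont (Icc a b)) (hC : C.Positive)
    (hr : ∀ s ∈ Icc a b, S.RegularAt C s) (hab : a ≤ b) (hG : IsWeight C G) (hl : l b = G (x b))
    (hst : a + C.σ ≤ b → S.SteersToZero C a) :
    ⟪l a, x a⟫_ℝ ≤ C.c₁ * ‖x a‖ ^ 2 := by
  have ha := hC.a_pos
  have hlQ := hC.lQ
  by_cases hfar : a + C.σ ≤ b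
  · obtain ⟨t₁, ht₁, y, w, K, hy, hya, hy1, hK0, hK, hle⟩ := hst hfar (x a)
    have hsub : Icc a t₁ ⊆ Icc a b := Icc_subset_Icc_right (ht₁.2.trans hfar)
    have key := (h.mono hsub).inner_le_of_competitor hC (fun s hs => hr s (hsub hs)) ht₁.1 hy hya
      (κ := fun s => K / (2 * C.a) * ‖x a‖ ^ 2 * Real.exp (2 * C.a * (s - a)))
      (fun s _ => hasDerivWithinAt_mul_exp _ _ _ _ _)
      (fun s hs => (hle s hs).trans (by apply le_of_eq; field_simp))
    have hV := h.inner_nonneg hC hr hG hl (t := t₁) ⟨ht₁.1, ht₁.2.trans hfar⟩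
    have hexp : Real.exp (2 * C.a * (t₁ - a)) ≤ Real.exp (2 * C.a * C.σ) := by
      gcongr; linarith [ht₁.2]
    have h1 : K / (2 * C.a) * ‖x a‖ ^ 2 * Real.exp (2 * C.a * (t₁ - a)) ≤ C.c₁ * ‖x a‖ ^ 2 := by
      calc _ ≤ K / (2 * C.a) * ‖x a‖ ^ 2 * Real.exp (2 * C.a * C.σ) := by gcongr
        _ = K * (Real.exp (2 * C.a * C.σ) / (2 * C.a)) * ‖x a‖ ^ 2 := by ring
        _ ≤ _ := by gcongr
    have h2 : 0 ≤ K / (2 * C.a) * ‖x a‖ ^ 2 * Real.exp (2 * C.a * (a - a)) := by positivity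
    rw [hy1, inner_zero_right] at key
    linarith
  · obtain ⟨y, hya, hy⟩ := exists_linear_solution hab hc.A (g := fun _ => 0) continuousOn_const (x a)
    have hy' : S.IsTraj a b y (fun _ => 0) := fun s hs => by simpa using hy s hs
    have hyn : ∀ s ∈ Icc a b, ‖y s‖ ^ 2 ≤ ‖x a‖ ^ 2 * Real.exp (2 * C.a * (s - a)) := by
      intro s hs
      have := norm_le_mul_exp_of_norm_deriv_le hy (k := C.a) (fun r hr' => by
        rw [add_zero]
        exact ((hr r hr').norm_A_le _).trans (by gcongr; exact hC.lA_le_a)) hs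
      rw [hya] at this
      calc ‖y s‖ ^ 2 ≤ (‖x a‖ * Real.exp (C.a * (s - a))) ^ 2 := by gcongr
        _ = _ := by rw [mul_pow, ← Real.exp_nat_mul]; congr 2; push_cast; ring
    have key := h.inner_le_of_competitor hC hr hab hy' hya
      (κ := fun s => C.lQ / (2 * C.a) * ‖x a‖ ^ 2 * Real.exp (2 * C.a * (s - a)))
      (fun s _ => hasDerivWithinAt_mul_exp _ _ _ _ _)
      (fun s hs => by
        have h1 : S.form s (y s) 0 (y s) 0 = ⟪y s, S.Q s (y s)⟫_ℝ := by simp [form]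
        rw [h1]
        calc _ ≤ C.lQ * ‖y s‖ ^ 2 := (hr s hs).inner_Q_le _
          _ ≤ C.lQ * (‖x a‖ ^ 2 * Real.exp (2 * C.a * (s - a))) := by gcongr; exact hyn s hs
          _ = _ := by field_simp)
    have hexp : Real.exp (2 * C.a * (b - a)) ≤ Real.exp (2 * C.a * C.σ) := by
      gcongr; linarith
    -- Convexity of the terminal cost, from `⟪y b - x b, G (y b - x b)⟫ ≥ 0`.
    have hGy : 2 * ⟪l b, y b⟫_ℝ - ⟪l b, x b⟫_ℝ ≤ C.lQ * ‖y b‖ ^ 2 := by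
      have h1 := hG.nonneg hC (y b - x b)
      have h2 := hG.upper (y b)
      have h3 : ⟪x b, G (y b)⟫_ℝ = ⟪y b, G (x b)⟫_ℝ := by rw [← hG.symm, real_inner_comm]
      rw [hl, real_inner_comm, real_inner_comm (x b)]
      simp only [map_sub, inner_sub_left, inner_sub_right] at h1
      linarith
    have h1 : C.lQ * ‖y b‖ ^ 2 ≤ C.lQ * (‖x a‖ ^ 2 * Real.exp (2 * C.a * C.σ)) := by
      gcongr
      exact (hyn b (right_mem_Icc.2 hab)).trans (by gcongr)
    have h2 : C.lQ / (2 * C.a) * ‖x a‖ ^ 2 * Real.exp (2 * C.a * (b - a))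
        ≤ C.lQ / (2 * C.a) * ‖x a‖ ^ 2 * Real.exp (2 * C.a * C.σ) := by gcongr
    have h3 : 0 ≤ C.lQ / (2 * C.a) * ‖x a‖ ^ 2 * Real.exp (2 * C.a * (a - a)) := by positivity
    have h4 := mul_le_mul_of_nonneg_right hC.upper_const_near (sq_nonneg ‖x a‖)
    have h5 : C.lQ * (Real.exp (2 * C.a * C.σ) + Real.exp (2 * C.a * C.σ) / (2 * C.a)) * ‖x a‖ ^ 2
        = C.lQ * (‖x a‖ ^ 2 * Real.exp (2 * C.a * C.σ))
          + C.lQ / (2 * C.a) * ‖x a‖ ^ 2 * Real.exp (2 * C.a * C.σ) := by ring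
    linarith

/-- Everything that is assumed of a problem on `[a, b]` with terminal weight `G`. -/
structure Problem (S : LQOps E U) (C : Constants) (a b : ℝ) (G : E →L[ℝ] E) : Prop where
  pos : C.Positive
  le : a ≤ b
  cont : S.Cont (Icc a b)
  reg : ∀ s ∈ Icc a b, S.RegularAt C s
  weight : IsWeight C G
  steers : ∀ t ∈ Icc a b, t + C.σ ≤ b → S.SteersToZero C t

/-- The restriction to `[t, b]` solves the tail problem with the same terminal weight, so the bounds
at the initial time hold at every time. -/
lemma Problem.inner_bounds (p : S.Problem C a b G) (h : S.IsHam a b x u l) (hl : l b = G (x b))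
    {t : ℝ} (ht : t ∈ Icc a b) :
    C.c₀ * ‖x t‖ ^ 2 ≤ ⟪l t, x t⟫_ℝ ∧ ⟪l t, x t⟫_ℝ ≤ C.c₁ * ‖x t‖ ^ 2 := by
  have hsub : Icc t b ⊆ Icc a b := Icc_subset_Icc_left ht.1
  exact ⟨(h.mono hsub).inner_lower (p.cont.mono hsub) p.pos (fun s hs => p.reg s (hsub hs)) ht.2
    p.weight hl, (h.mono hsub).inner_upper (p.cont.mono hsub) p.pos (fun s hs => p.reg s (hsub hs))
    ht.2 p.weight hl (p.steers t ht)⟩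

/-- Exponential decay of the optimal state. -/
lemma Problem.norm_state_le (p : S.Problem C a b G) (h : S.IsHam a b x u l) (hl : l b = G (x b))
    {r t : ℝ} (har : a ≤ r) (hrt : r ≤ t) (htb : t ≤ b) :
    ‖x t‖ ≤ C.cZ * Real.exp (-C.ρZ * (t - r)) * ‖x r‖ := by
  have hc0 := p.pos.c₀_pos
  have hc1 := p.pos.c₁_pos
  have hgQ := p.pos.gQ
  have hsub : Icc r t ⊆ Icc a b := Icc_subset_Icc har htb
  -- The Lyapunov function `⟪l s, x s⟫ exp (2 ρZ (s - r))` is nonincreasing; its rate is `γ_Q / c₁ =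
  -- 2 ρZ`.
  have hmono := sub_le_sub_of_hasDerivWithinAt_le hrt
    (fun s hs => ((((h.mono hsub).hasDerivWithinAt_inner (fun s hs => p.reg s (hsub hs))
      (h.mono hsub).traj s hs).mul (hasDerivWithinAt_mul_exp 1 (2 * C.ρZ) r s (Icc r t)))))
    (fun s _ => hasDerivWithinAt_const s _ (0 : ℝ))
    (fun s hs => by
      have h1 := (p.inner_bounds h hl (hsub hs)).2
      have h2 := (p.reg s (hsub hs)).le_form_self (x s) (u s)
      have h3 : 0 ≤ C.gR * ‖S.shifted s (x s) (u s)‖ ^ 2 := by have := p.pos.gR; positivity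
      have h4 : 2 * C.ρZ * ⟪l s, x s⟫_ℝ ≤ C.gQ * ‖x s‖ ^ 2 := by
        have e : 2 * C.ρZ = C.gQ / C.c₁ := by unfold Constants.ρZ; field_simp
        rw [e, div_mul_eq_mul_div, div_le_iff₀ hc1]
        nlinarith
      have h5 := Real.exp_pos (2 * C.ρZ * (s - r))
      have : -S.form s (x s) (u s) (x s) (u s) * (1 * Real.exp (2 * C.ρZ * (s - r)))
          + ⟪l s, x s⟫_ℝ * (1 * (2 * C.ρZ * Real.exp (2 * C.ρZ * (s - r))))
          = (2 * C.ρZ * ⟪l s, x s⟫_ℝ - S.form s (x s) (u s) (x s) (u s))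
            * Real.exp (2 * C.ρZ * (s - r)) := by ring
      rw [this]
      exact mul_nonpos_of_nonpos_of_nonneg (by linarith) h5.le)
  simp only [Pi.mul_apply, sub_self, mul_zero, Real.exp_zero, mul_one, one_mul] at hmono
  have h1 := (p.inner_bounds h hl (t := t) ⟨har.trans hrt, htb⟩).1
  have h2 := (p.inner_bounds h hl (t := r) ⟨har, hrt.trans htb⟩).2
  have hE := Real.exp_pos (2 * C.ρZ * (t - r))
  have h3 : C.c₀ * ‖x t‖ ^ 2 * Real.exp (2 * C.ρZ * (t - r)) ≤ C.c₁ * ‖x r‖ ^ 2 := by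
    have := mul_le_mul_of_nonneg_right h1 hE.le
    linarith
  have hcZ := p.pos.cZ_pos
  refine (sq_le_sq₀ (norm_nonneg _) (by positivity)).1 ?_
  have e1 : (C.cZ * Real.exp (-C.ρZ * (t - r)) * ‖x r‖) ^ 2
      = C.c₁ / C.c₀ * ‖x r‖ ^ 2 / Real.exp (2 * C.ρZ * (t - r)) := by
    have : Real.exp (-C.ρZ * (t - r)) ^ 2 = 1 / Real.exp (2 * C.ρZ * (t - r)) := by
      rw [← Real.exp_nat_mul, one_div, ← Real.exp_neg]; congr 1; push_cast; ring
    rw [mul_pow, mul_pow, this, Constants.cZ, Real.sq_sqrt (by positivity)]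
    ring
  rw [e1, le_div_iff₀ hE, div_mul_eq_mul_div, le_div_iff₀ hc0]
  linarith

end LQOps

end RiccatiBounds

/-! ### Sensitivity of the optimality system to its boundary data. -/

section Sensitivity

set_option linter.unusedSectionVars false

variable {E U : Type*} [NormedAddCommGroup E] [InnerProductSpace ℝ E] [CompleteSpace E]
  [NormedAddCommGroup U] [InnerProductSpace ℝ U] [CompleteSpace U]

/-- Cauchy–Schwarz for the semi-inner product `⟪P ·, ·⟫` at `x` and `P x` bounds `‖P x‖⁴` by `c²
‖x‖² ‖P x‖²`. -/
lemma norm_le_of_symm_of_quadratic_le {P : E →L[ℝ] E} {c : ℝ} (hc : 0 ≤ c)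
    (hs : ∀ x y, ⟪P x, y⟫_ℝ = ⟪x, P y⟫_ℝ) (h0 : ∀ x, 0 ≤ ⟪P x, x⟫_ℝ)
    (h1 : ∀ x, ⟪P x, x⟫_ℝ ≤ c * ‖x‖ ^ 2) (x : E) : ‖P x‖ ≤ c * ‖x‖ := by
  have hcs : ⟪P x, P x⟫_ℝ ^ 2 ≤ ⟪P x, x⟫_ℝ * ⟪P (P x), P x⟫_ℝ := by
    have hd := discrim_le_zero (a := ⟪P (P x), P x⟫_ℝ) (b := 2 * ⟪P x, P x⟫_ℝ) (c := ⟪P x, x⟫_ℝ)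
      (fun r => by
        have := h0 (x + r • P x)
        have e : ⟪P (x + r • P x), x + r • P x⟫_ℝ
            = ⟪P (P x), P x⟫_ℝ * (r * r) + 2 * ⟪P x, P x⟫_ℝ * r + ⟪P x, x⟫_ℝ := by
          simp only [map_add, map_smul, inner_add_left, inner_add_right, inner_smul_left,
            inner_smul_right, hs (P x) x, RCLike.conj_to_real]
          ring
        linarith)
    unfold discrim at hd
    nlinarith
  rw [real_inner_self_eq_norm_sq] at hcs
  have h2 : (‖P x‖ ^ 2) ^ 2 ≤ (c * ‖x‖ ^ 2) * (c * ‖P x‖ ^ 2) :=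
    hcs.trans (mul_le_mul (h1 x) (h1 (P x)) (h0 _) (by positivity))
  by_cases hz : ‖P x‖ = 0
  · rw [hz]; positivity
  · have hp : 0 < ‖P x‖ ^ 2 := by positivity
    refine (sq_le_sq₀ (norm_nonneg _) (by positivity)).1 ?_
    refine le_of_mul_le_mul_right ?_ hp
    nlinarith

namespace LQOps

variable {S : LQOps E U} {C : Constants} {G : E →L[ℝ] E} {a b : ℝ} {x l : ℝ → E} {u : ℝ → U}

/-- The stationary control as a function of state and adjoint. -/
def feedback (S : LQOps E U) (t : ℝ) : E × E →L[ℝ] U :=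
  -(S.Ri t ∘L (S.H t ∘L ContinuousLinearMap.fst ℝ E E
    + (S.B t).adjoint ∘L ContinuousLinearMap.snd ℝ E E))

/-- The generator of the Hamiltonian flow. -/
def hamGen (S : LQOps E U) (t : ℝ) : E × E →L[ℝ] E × E :=
  ContinuousLinearMap.inl ℝ E E ∘L
      (S.A t ∘L ContinuousLinearMap.fst ℝ E E + S.B t ∘L S.feedback t)
    + ContinuousLinearMap.inr ℝ E E ∘L
      (-((S.A t).adjoint ∘L ContinuousLinearMap.snd ℝ E E)
        - S.Q t ∘L ContinuousLinearMap.fst ℝ E E - (S.H t).adjoint ∘L S.feedback t)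

lemma Cont.hamGen {s : Set ℝ} (h : S.Cont s) : ContinuousOn S.hamGen s := by
  have hA := h.A; have hB := h.B; have hQ := h.Q; have hH := h.H; have hRi := h.Ri
  have hAa : ContinuousOn (fun t => (S.A t).adjoint) s :=
    ContinuousLinearMap.adjoint.continuous.comp_continuousOn hA
  have hBa : ContinuousOn (fun t => (S.B t).adjoint) s :=
    ContinuousLinearMap.adjoint.continuous.comp_continuousOn hB
  have hHa : ContinuousOn (fun t => (S.H t).adjoint) s :=
    ContinuousLinearMap.adjoint.continuous.comp_continuousOn hH
  have hf : ContinuousOn S.feedback s :=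
    (hRi.clm_comp ((hH.clm_comp continuousOn_const).add (hBa.clm_comp continuousOn_const))).neg
  exact (continuousOn_const.clm_comp ((hA.clm_comp continuousOn_const).add (hB.clm_comp hf))).add
    (continuousOn_const.clm_comp
      (((hAa.clm_comp continuousOn_const).neg.sub (hQ.clm_comp continuousOn_const)).sub
        (hHa.clm_comp hf)))

lemma IsHam.control_eq (h : S.IsHam a b x u l) {s : ℝ} (hs : s ∈ Icc a b)
    (hr : S.RegularAt C s) : u s = S.feedback s (x s, l s) := by
  have h1 := h.stat s hs
  have h2 : S.R s (u s) = -(S.H s (x s) + (S.B s).adjoint (l s)) := by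
    rw [add_assoc] at h1; exact eq_neg_of_add_eq_zero_left h1
  rw [← hr.Ri_R (u s), h2]
  simp [feedback]

/-- The operator solution of the optimality system with final value `(1, G)`. -/
lemma Problem.exists_flow (p : S.Problem C a b G) :
    ∃ X Λ : ℝ → E →L[ℝ] E, X b = 1 ∧ Λ b = G ∧
      (∀ t ∈ Icc a b, HasDerivWithinAt X
        (S.A t ∘L X t + S.B t ∘L S.feedback t ∘L (X t).prod (Λ t)) (Icc a b) t) ∧
      ∀ η, S.IsHam a b (fun t => X t η) (fun t => S.feedback t (X t η, Λ t η))
        (fun t => Λ t η) := by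
  obtain ⟨Ψ, hb, hΨ⟩ := exists_fundamental_right p.le p.cont.hamGen
  set J : E →L[ℝ] E × E := (ContinuousLinearMap.id ℝ E).prod G with hJ
  have hz : ∀ t ∈ Icc a b, ∀ η, HasDerivWithinAt (fun t => Ψ t (J η))
      (S.hamGen t (Ψ t (J η))) (Icc a b) t := by
    intro t ht η
    simpa using (hΨ t ht).clm_apply (hasDerivWithinAt_const t (Icc a b) (J η))
  refine ⟨fun t => ContinuousLinearMap.fst ℝ E E ∘L Ψ t ∘L J,
    fun t => ContinuousLinearMap.snd ℝ E E ∘L Ψ t ∘L J, ?_, ?_, ?_, ?_⟩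
  · ext η; simp [hb, hJ]
  · ext η; simp [hb, hJ]
  · intro t ht
    have h1 : HasDerivWithinAt (fun t => ContinuousLinearMap.fst ℝ E E ∘L Ψ t ∘L J)
        (ContinuousLinearMap.fst ℝ E E ∘L (S.hamGen t * Ψ t) ∘L J) (Icc a b) t := by
      have := (hasDerivWithinAt_const t (Icc a b) (ContinuousLinearMap.fst ℝ E E)).clm_comp
        ((hΨ t ht).clm_comp (hasDerivWithinAt_const t (Icc a b) J))
      simpa using this
    convert! h1 using 1
    ext η
    simp [hamGen]
  · intro η
    refine ⟨fun s hs => ?_, fun s hs => ?_, fun s hs => ?_⟩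
    · have := (ContinuousLinearMap.fst ℝ E E).hasFDerivAt.comp_hasDerivWithinAt s (hz s hs η)
      convert! this using 1
      simp [hamGen]
    · have := (ContinuousLinearMap.snd ℝ E E).hasFDerivAt.comp_hasDerivWithinAt s (hz s hs η)
      convert! this using 1
      simp [hamGen]
    · simp only [feedback, neg_apply, ContinuousLinearMap.comp_apply,
        map_neg, (p.reg s hs).R_Ri]
      simp

/-- Sensitivity of the optimality system with respect to its boundary data. -/
theorem Problem.sensitivity [FiniteDimensional ℝ E] (p : S.Problem C a b G)
    (h : S.IsHam a b x u l) {e : E} (hl : l b = G (x b) + e) {t : ℝ} (ht : t ∈ Icc a b) :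
    ‖x t‖ ≤ C.cZ * Real.exp (-C.ρZ * (t - a)) * ‖x a‖
        + C.cZ ^ 2 * C.lB ^ 2 / (2 * C.ρZ * C.gR) * Real.exp (-C.ρZ * (b - t)) * ‖e‖ ∧
      ‖l t‖ ≤ C.c₁ * ‖x t‖ + C.cZ * Real.exp (-C.ρZ * (b - t)) * ‖e‖ ∧
      ‖u t‖ ≤ C.lH / C.gR * ‖x t‖ + C.lB / C.gR * ‖l t‖ := by
  have hgR := p.pos.gR
  have hlB := p.pos.lB
  have hlH := p.pos.lH
  have hρ := p.pos.ρZ_pos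
  have hcZ := p.pos.cZ_pos
  obtain ⟨X, Λ, hXb, hΛb, hX, hXΛ⟩ := p.exists_flow
  have hdec : ∀ η r s, a ≤ r → r ≤ s → s ≤ b →
      ‖X s η‖ ≤ C.cZ * Real.exp (-C.ρZ * (s - r)) * ‖X r η‖ := fun η r s h1 h2 h3 =>
    p.norm_state_le (hXΛ η) (by simp [hXb, hΛb]) h1 h2 h3
  -- A solution vanishing at `r` vanishes at `b` by the decay estimate, but its value at `b` is `η`.
  -- Injectivity suffices in finite dimension.
  have hunit : ∀ r ∈ Icc a b, IsUnit (X r) := by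
    intro r hr
    have hinj : Function.Injective (X r) := by
      refine (injective_iff_map_eq_zero (X r)).2 fun η hη => ?_
      have := hdec η r b hr.1 hr.2 le_rfl
      rw [hη, hXb] at this
      simpa using this
    rw [ContinuousLinearMap.isUnit_iff_bijective]
    exact ⟨hinj, LinearMap.injective_iff_surjective.1
      (show Function.Injective (X r : E →ₗ[ℝ] E) from hinj)⟩
  set Y : ℝ → E →L[ℝ] E := fun r => Ring.inverse (X r) with hY
  have hXY : ∀ r ∈ Icc a b, ∀ ζ, X r (Y r ζ) = ζ := fun r hr ζ => by
    have := Ring.mul_inverse_cancel _ (hunit r hr)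
    simpa using congrArg (fun M : E →L[ℝ] E => M ζ) this
  have hYdec : ∀ ζ r s, a ≤ r → r ≤ s → s ≤ b →
      ‖X s (Y r ζ)‖ ≤ C.cZ * Real.exp (-C.ρZ * (s - r)) * ‖ζ‖ := fun ζ r s h1 h2 h3 => by
    have := hdec (Y r ζ) r s h1 h2 h3
    rwa [hXY r ⟨h1, h2.trans h3⟩] at this
  set P : ℝ → E →L[ℝ] E := fun r => Λ r ∘L Y r with hP
  set σ : ℝ → E := fun r => (Y r).adjoint e with hσ
  have hb : b ∈ Icc a b := right_mem_Icc.2 p.le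
  -- The symplectic form of two columns of the flow vanishes at `b` because `G` is symmetric, hence
  -- at all times.
  have hPsymm : ∀ r ∈ Icc a b, ∀ ζ ζ', ⟪P r ζ, ζ'⟫_ℝ = ⟪ζ, P r ζ'⟫_ℝ := by
    intro r hr ζ ζ'
    have := (hXΛ (Y r ζ)).symplectic (hXΛ (Y r ζ')) p.reg hr hb
    simp only [hXY r hr, hXb, hΛb, one_apply_eq_self, p.weight.symm] at this
    have e1 : ⟪Y r ζ', G (Y r ζ)⟫_ℝ = ⟪Y r ζ, G (Y r ζ')⟫_ℝ := by
      rw [← p.weight.symm, real_inner_comm]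
    have e2 : ⟪Λ r (Y r ζ'), ζ⟫_ℝ = ⟪ζ, P r ζ'⟫_ℝ := real_inner_comm _ _
    rw [e1, e2, sub_self] at this
    exact sub_eq_zero.1 this
  have hPle : ∀ r ∈ Icc a b, ∀ ζ, ‖P r ζ‖ ≤ C.c₁ * ‖ζ‖ := by
    intro r hr ζ
    refine norm_le_of_symm_of_quadratic_le p.pos.c₁_pos.le (hPsymm r hr) (fun z => ?_)
      (fun z => ?_) ζ
    · have := (hXΛ (Y r z)).inner_nonneg p.pos p.reg p.weight (by simp [hXb, hΛb]) hr
      rwa [hXY r hr] at this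
    · have := (p.inner_bounds (hXΛ (Y r z)) (by simp [hXb, hΛb]) hr).2
      rwa [hXY r hr] at this
  -- Pair the given solution symplectically with the column of the flow through `ζ` at time `r`. At
  -- `b` the `G` terms cancel and only `⟪e, Y r ζ⟫` remains. No Riccati equation has to be solved.
  have hlP : ∀ r ∈ Icc a b, l r = P r (x r) + σ r := by
    intro r hr
    refine ext_inner_right ℝ fun ζ => ?_
    have := h.symplectic (hXΛ (Y r ζ)) p.reg hr hb
    simp only [hXY r hr, hXb, hΛb, hl, one_apply_eq_self, inner_add_left,
      p.weight.symm (Y r ζ)] at this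
    rw [p.weight.symm, ← p.weight.symm (Y r ζ) (x b), real_inner_comm (x b)] at this
    rw [inner_add_left, hPsymm r hr, hσ]
    simp only [ContinuousLinearMap.adjoint_inner_left]
    have e1 : ⟪x r, P r ζ⟫_ℝ = ⟪Λ r (Y r ζ), x r⟫_ℝ := real_inner_comm _ _
    have e2 : ⟪G (Y r ζ), x b⟫_ℝ = ⟪x b, G (Y r ζ)⟫_ℝ := real_inner_comm _ _
    linarith
  -- Since `X b = 1`, `Y r` is the propagator from `r` to `b`; its adjoint inherits the decay bound.
  have hσle : ∀ r ∈ Icc a b, ‖σ r‖ ≤ C.cZ * Real.exp (-C.ρZ * (b - r)) * ‖e‖ := by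
    intro r hr
    refine (Y r).adjoint.le_of_opNorm_le ?_ e
    rw [ContinuousLinearMap.adjoint.norm_map]
    refine ContinuousLinearMap.opNorm_le_bound _ (by positivity) fun ζ => ?_
    simpa [hXb] using hYdec ζ r b hr.1 hr.2 le_rfl
  have hcontrol : ‖u t‖ ≤ C.lH / C.gR * ‖x t‖ + C.lB / C.gR * ‖l t‖ := by
    have hrt := p.reg t ht
    rw [h.control_eq ht hrt]
    have : S.feedback t (x t, l t) = -S.Ri t (S.H t (x t) + (S.B t).adjoint (l t)) := rfl
    rw [this, norm_neg]
    calc _ ≤ ‖S.H t (x t) + (S.B t).adjoint (l t)‖ / C.gR := hrt.norm_Ri_le p.pos _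
      _ ≤ (C.lH * ‖x t‖ + C.lB * ‖l t‖) / C.gR := by
        gcongr
        exact (norm_add_le _ _).trans (add_le_add (hrt.norm_H_le _) (hrt.norm_adjoint_B_le _))
      _ = _ := by ring
  have hadj : ‖l t‖ ≤ C.c₁ * ‖x t‖ + C.cZ * Real.exp (-C.ρZ * (b - t)) * ‖e‖ := by
    rw [hlP t ht]
    exact (norm_add_le _ _).trans (add_le_add (hPle t ht _) (hσle t ht))
  refine ⟨?_, hadj, hcontrol⟩
  have hsub : Icc a t ⊆ Icc a b := Icc_subset_Icc_right ht.2
  -- Variation of constants: `f r` carries the state at time `r` to time `t` by the unperturbed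
  -- flow. It ends at `x t`, and its derivative contains only the forcing by `σ`.
  set f : ℝ → E := fun r => X t (Y r (x r)) with hf
  have hder : ∀ r ∈ Icc a t, HasDerivWithinAt f
      (-(X t (Y r (S.B r (S.Ri r ((S.B r).adjoint (σ r))))))) (Icc a t) r := by
    intro r hr
    have hr' := hsub hr
    have h1 := (hasDerivWithinAt_ringInverse (hX r hr') (hunit r hr')).mono hsub
    have h2 := h1.clm_apply ((h.traj r hr').mono hsub)
    have h3 := (X t).hasFDerivAt.comp_hasDerivWithinAt r h2
    convert! h3 using 1
    rw [← map_neg]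
    congr 1
    have e1 : u r = S.feedback r (x r, P r (x r)) - S.Ri r ((S.B r).adjoint (σ r)) := by
      rw [h.control_eq hr' (p.reg r hr'), hlP r hr']
      simp only [feedback, neg_apply, ContinuousLinearMap.comp_apply,
        add_apply, ContinuousLinearMap.coe_fst', ContinuousLinearMap.coe_snd',
        map_add]
      abel
    have e2 : X r (Ring.inverse (X r) (x r)) = x r := hXY r hr' _
    have e3 : Λ r (Ring.inverse (X r) (x r)) = P r (x r) := rfl
    simp only [neg_apply, mul_apply_eq_comp,
      add_apply, ContinuousLinearMap.comp_apply,
      ContinuousLinearMap.prod_apply, e2, e3]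
    rw [e1]
    simp only [hY, map_sub, map_add]
    abel
  set k := C.cZ ^ 2 * C.lB ^ 2 / (2 * C.ρZ * C.gR) * ‖e‖ with hk
  -- The forcing at `r` decays over `b - r` and its propagation over `t - r`. The product of the two
  -- exponentials is `exp (2 ρZ (r - (t + b) / 2))`, whose primitive gives the `2 ρZ` in the
  -- denominator of `k` and equals `exp (-ρZ (b - t))` up to that factor at `r = t`.
  have hbound := image_norm_le_of_norm_deriv_right_le_deriv_boundary' (f := f)
    (B := fun r => C.cZ * Real.exp (-C.ρZ * (t - a)) * ‖x a‖
      + k * Real.exp (2 * C.ρZ * (r - (t + b) / 2)))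
    (B' := fun r => k * (2 * C.ρZ * Real.exp (2 * C.ρZ * (r - (t + b) / 2))))
    (fun r hr => (hder r hr).continuousWithinAt)
    (fun r hr => hasDerivWithinAt_Ici_of_Icc (hder r ⟨hr.1, hr.2.le⟩) hr)
    (by
      have h1 := hYdec (x a) a t le_rfl ht.1 ht.2
      have h2 : 0 ≤ k * Real.exp (2 * C.ρZ * (a - (t + b) / 2)) := by positivity
      simp only [hf]; linarith)
    (by fun_prop)
    (fun r _ => (hasDerivWithinAt_mul_exp _ _ _ _ _).const_add _)
    (fun r hr => by
      have hr' : r ∈ Icc a b := ⟨hr.1, hr.2.le.trans ht.2⟩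
      have hrr := p.reg r hr'
      rw [norm_neg]
      refine (hYdec _ r t hr.1 hr.2.le ht.2).trans ?_
      have h1 : ‖S.B r (S.Ri r ((S.B r).adjoint (σ r)))‖
          ≤ C.lB * (C.lB * (C.cZ * Real.exp (-C.ρZ * (b - r)) * ‖e‖) / C.gR) := by
        refine (hrr.norm_B_le _).trans ?_
        gcongr
        refine (hrr.norm_Ri_le p.pos _).trans ?_
        gcongr
        refine (hrr.norm_adjoint_B_le _).trans ?_
        gcongr
        exact hσle r hr'
      have e1 : Real.exp (2 * C.ρZ * (r - (t + b) / 2))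
          = Real.exp (-C.ρZ * (t - r)) * Real.exp (-C.ρZ * (b - r)) := by
        rw [← Real.exp_add]; congr 1; ring
      rw [e1, hk]
      calc _ ≤ C.cZ * Real.exp (-C.ρZ * (t - r))
            * (C.lB * (C.lB * (C.cZ * Real.exp (-C.ρZ * (b - r)) * ‖e‖) / C.gR)) := by gcongr
        _ = _ := by field_simp)
    (right_mem_Icc.2 ht.1)
  have hft : f t = x t := hXY t ht _
  have e2 : 2 * C.ρZ * (t - (t + b) / 2) = -C.ρZ * (b - t) := by ring
  simp only [hft, e2] at hbound
  calc ‖x t‖ ≤ _ := hbound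
    _ = _ := by rw [hk]; ring

/-- Sensitivity in the form used for the Schwarz iteration. -/
theorem Problem.norm_le_Λb [FiniteDimensional ℝ E] (p : S.Problem C a b G)
    (h : S.IsHam a b x u l) {e : E} (hl : l b = G (x b) + e) {q : ℝ} (hq : 0 ≤ q)
    (he : ‖e‖ ≤ C.lQ * q) {t : ℝ} (ht : t ∈ Icc a b) {δ : ℝ}
    (hδ : δ = Real.exp (-C.ρZ * (t - a)) * ‖x a‖ + Real.exp (-C.ρZ * (b - t)) * q) :
    ‖x t‖ ≤ C.Λb * δ ∧ ‖u t‖ ≤ C.Λb * δ ∧ ‖l t‖ ≤ C.Λb * δ := by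
  have hgR := p.pos.gR
  have hlB := p.pos.lB
  have hlH := p.pos.lH
  have hlQ := p.pos.lQ
  have hρ := p.pos.ρZ_pos
  have hcZ := p.pos.cZ_pos
  have hc1 := p.pos.c₁_pos
  obtain ⟨hx, hl', hu⟩ := p.sensitivity h hl ht
  set ea := Real.exp (-C.ρZ * (t - a))
  set eb := Real.exp (-C.ρZ * (b - t))
  have hea : 0 < ea := Real.exp_pos _
  have heb : 0 < eb := Real.exp_pos _
  set M := max C.cZ (C.cZ ^ 2 * C.lB ^ 2 * C.lQ / (2 * C.ρZ * C.gR)) with hM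
  have hM1 : C.cZ ≤ M := le_max_left _ _
  have hM2 : C.cZ ^ 2 * C.lB ^ 2 * C.lQ / (2 * C.ρZ * C.gR) ≤ M := le_max_right _ _
  have hM0 : 0 < M := hcZ.trans_le hM1
  have hδ0 : 0 ≤ δ := by rw [hδ]; positivity
  have hebq : eb * q ≤ δ := by
    rw [hδ]; have : 0 ≤ ea * ‖x a‖ := by positivity
    linarith
  have bx : ‖x t‖ ≤ M * δ := by
    refine hx.trans ?_
    calc _ ≤ M * ea * ‖x a‖ + C.cZ ^ 2 * C.lB ^ 2 / (2 * C.ρZ * C.gR) * eb * (C.lQ * q) := by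
          gcongr
      _ = M * ea * ‖x a‖ + C.cZ ^ 2 * C.lB ^ 2 * C.lQ / (2 * C.ρZ * C.gR) * eb * q := by ring
      _ ≤ M * ea * ‖x a‖ + M * eb * q := by gcongr
      _ = M * δ := by rw [hδ]; ring
  have bl : ‖l t‖ ≤ (C.c₁ + C.lQ) * (M * δ) := by
    refine hl'.trans ?_
    have : C.cZ * eb * ‖e‖ ≤ C.lQ * (M * δ) := by
      calc C.cZ * eb * ‖e‖ ≤ M * eb * (C.lQ * q) := by gcongr
        _ = C.lQ * (M * (eb * q)) := by ring
        _ ≤ _ := by gcongr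
    rw [add_mul]
    gcongr
  have bu : ‖u t‖ ≤ C.lH / C.gR * (M * δ) + C.lB / C.gR * ((C.c₁ + C.lQ) * (M * δ)) := by
    refine hu.trans ?_
    gcongr
  -- The bracket in `Λb` is the sum of the state, adjoint and control bounds, so it dominates each
  -- of them.
  have hΛ : C.Λb * δ = M * δ + C.lH / C.gR * (M * δ) + (C.c₁ + C.lQ) * (M * δ)
      + C.lB / C.gR * ((C.c₁ + C.lQ) * (M * δ)) := by
    unfold Constants.Λb; ring
  have n1 : 0 ≤ M * δ := by positivity
  have n2 : 0 ≤ C.lH / C.gR * (M * δ) := by positivity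
  have n3 : 0 ≤ (C.c₁ + C.lQ) * (M * δ) := by positivity
  have n4 : 0 ≤ C.lB / C.gR * ((C.c₁ + C.lQ) * (M * δ)) := by positivity
  rw [hΛ]
  exact ⟨by linarith, by linarith, by linarith⟩

end LQOps

end Sensitivity

/-! ### Steering to the origin by minimum-energy controls. -/

section Steering

set_option linter.unusedSectionVars false

variable {E U : Type*} [NormedAddCommGroup E] [InnerProductSpace ℝ E] [CompleteSpace E]
  [NormedAddCommGroup U] [InnerProductSpace ℝ U] [CompleteSpace U]

namespace LQOps

variable {S : LQOps E U} {C : Constants}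

/-- Minimum-energy steering: `F s = Φ(s, t)`, `N s = Φ(t, s)` and `D s` is the Gramian over
`[s, t₁]`, transported to time `t`. -/
lemma steersToZero_of_gramian [FiniteDimensional ℝ E] (hC : C.Positive) {t t₁ : ℝ}
    (ht₁ : t₁ ∈ Icc t (t + C.σ)) (hr : ∀ s ∈ Icc t t₁, S.RegularAt C s) {F N D : ℝ → E →L[ℝ] E}
    (hF : ∀ s ∈ Icc t t₁, HasDerivWithinAt F (S.A s * F s) (Icc t t₁) s)
    (hN : ∀ s ∈ Icc t t₁, HasDerivWithinAt N (-(N s * S.A s)) (Icc t t₁) s)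
    (hFN : ∀ s ∈ Icc t t₁, F s * N s = 1) (hFt : F t = 1) (hNt : N t = 1)
    (hD : ∀ s ∈ Icc t t₁, HasDerivWithinAt D
      (-(N s ∘L S.B s ∘L (S.B s).adjoint ∘L (N s).adjoint)) (Icc t t₁) s)
    (hD₁ : D t₁ = 0) (hlow : ∀ ξ, C.α₀ * ‖ξ‖ ^ 2 ≤ ⟪ξ, D t ξ⟫_ℝ)
    (hup : ∀ ξ, ⟪ξ, D t ξ⟫_ℝ ≤ C.α₁ * ‖ξ‖ ^ 2) : S.SteersToZero C t := by
  have h0 := hC.α₀; have h1 := hC.α₁; have hA := hC.lA; have hB := hC.lB; have hσ := hC.σ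
  have ha := hC.a_pos; have hlQ := hC.lQ; have hlR := hC.lR; have hlH := hC.lH; have hgR := hC.gR
  have h1' := hC.α₁'_pos
  have ht₁' : t₁ ∈ Icc t t₁ := right_mem_Icc.2 ht₁.1
  have hone : ‖(1 : E →L[ℝ] E)‖ ≤ 1 := ContinuousLinearMap.norm_id_le
  have hNle : ∀ s ∈ Icc t t₁, ‖N s‖ ≤ Real.exp (C.lA * (s - t)) := by
    intro s hs
    have := norm_le_mul_exp_of_norm_deriv_le hN (k := C.lA) (fun r hr' => by
      rw [norm_neg, mul_comm C.lA]
      exact (norm_mul_le _ _).trans (by gcongr; exact (hr r hr').boundA)) hs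
    rw [hNt] at this
    exact this.trans (mul_le_of_le_one_left (Real.exp_pos _).le hone)
  have hFle : ∀ s ∈ Icc t t₁, ‖F s‖ ≤ Real.exp (C.a * (s - t)) := by
    intro s hs
    have := norm_le_mul_exp_of_norm_deriv_le hF (k := C.a) (fun r hr' => by
      exact (norm_mul_le _ _).trans (by gcongr; exact (hr r hr').boundA.trans hC.lA_le_a)) hs
    rw [hFt] at this
    exact this.trans (mul_le_of_le_one_left (Real.exp_pos _).le hone)
  have hwle : ∀ s ∈ Icc t t₁, ∀ ζ, ‖(S.B s).adjoint ((N s).adjoint ζ)‖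
      ≤ C.lB * (Real.exp (C.lA * (s - t)) * ‖ζ‖) := by
    intro s hs ζ
    refine ((hr s hs).norm_adjoint_B_le _).trans ?_
    gcongr
    exact (N s).adjoint.le_of_opNorm_le
      ((ContinuousLinearMap.adjoint.norm_map (N s)).trans_le (hNle s hs)) ζ
  have hDv : ∀ ζ, ∀ s ∈ Icc t t₁, HasDerivWithinAt (fun s => D s ζ)
      (-(N s (S.B s ((S.B s).adjoint ((N s).adjoint ζ))))) (Icc t t₁) s := by
    intro ζ s hs
    simpa using (hD s hs).clm_apply (hasDerivWithinAt_const s (Icc t t₁) ζ)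
  have hDq : ∀ ζ ζ', ∀ s ∈ Icc t t₁, HasDerivWithinAt (fun s => ⟪D s ζ, ζ'⟫_ℝ)
      (-⟪(S.B s).adjoint ((N s).adjoint ζ), (S.B s).adjoint ((N s).adjoint ζ')⟫_ℝ)
      (Icc t t₁) s := by
    intro ζ ζ' s hs
    have := (hDv ζ s hs).inner ℝ (hasDerivWithinAt_const s (Icc t t₁) ζ')
    convert! this using 1
    simp only [inner_zero_right, zero_add, inner_neg_left]
    rw [ContinuousLinearMap.adjoint_inner_right, ContinuousLinearMap.adjoint_inner_right]
  have hDsymm : ∀ s ∈ Icc t t₁, ∀ ζ ζ', ⟪D s ζ, ζ'⟫_ℝ = ⟪ζ, D s ζ'⟫_ℝ := by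
    intro s hs ζ ζ'
    have := eq_of_hasDerivWithinAt_zero (f := fun s => ⟪D s ζ, ζ'⟫_ℝ - ⟪D s ζ', ζ⟫_ℝ)
      (fun r hr' => by
        convert! (hDq ζ ζ' r hr').sub (hDq ζ' ζ r hr') using 1
        rw [real_inner_comm]; ring) hs ht₁'
    simp only [hD₁, zero_apply, inner_zero_left, sub_self] at this
    rw [real_inner_comm (D s ζ')]
    linarith
  have hD0 : ∀ s ∈ Icc t t₁, ∀ ζ, 0 ≤ ⟪D s ζ, ζ⟫_ℝ := by
    intro s hs ζ
    have hsub : Icc s t₁ ⊆ Icc t t₁ := Icc_subset_Icc_left hs.1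
    have := sub_le_sub_of_hasDerivWithinAt_le hs.2 (fun r hr' => (hDq ζ ζ r (hsub hr')).mono hsub)
      (fun r _ => hasDerivWithinAt_const r _ (0 : ℝ))
      (fun r _ => by
        rw [real_inner_self_eq_norm_sq, neg_nonpos]; positivity)
    simp only [hD₁, zero_apply, inner_zero_left, sub_self] at this
    linarith
  have hDmono : ∀ s ∈ Icc t t₁, ∀ ζ, ⟪D s ζ, ζ⟫_ℝ ≤ ⟪D t ζ, ζ⟫_ℝ := by
    intro s hs ζ
    have hsub : Icc t s ⊆ Icc t t₁ := Icc_subset_Icc_right hs.2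
    have := sub_le_sub_of_hasDerivWithinAt_le hs.1 (fun r hr' => (hDq ζ ζ r (hsub hr')).mono hsub)
      (fun r _ => hasDerivWithinAt_const r _ (0 : ℝ))
      (fun r _ => by
        rw [real_inner_self_eq_norm_sq, neg_nonpos]; positivity)
    simp only [sub_self] at this
    linarith
  -- A Gramian bound computed from the growth of `N`. The rate `λ_A` is kept instead of `a` because
  -- `upper_const_far` compares `α₀` with this exact expression.
  set Eg := C.lB ^ 2 * ((Real.exp (2 * C.lA * C.σ) - 1) / (2 * C.lA)) with hEg
  have hEg1 : Eg ≤ C.α₁' := by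
    unfold Constants.α₁'
    rw [hEg, mul_div_assoc, show 2 * C.σ * C.a = 2 * C.a * C.σ by ring]
    exact mul_le_mul_of_nonneg_left hC.exp_sub_one_div_mono (by positivity)
  have hW : ∀ ζ, ⟪D t ζ, ζ⟫_ℝ ≤ Eg * ‖ζ‖ ^ 2 := by
    intro ζ
    have := sub_le_sub_of_hasDerivWithinAt_le ht₁.1 (fun s hs => (hDq ζ ζ s hs).neg)
      (fun s _ => hasDerivWithinAt_mul_exp (C.lB ^ 2 * ‖ζ‖ ^ 2 / (2 * C.lA)) (2 * C.lA) t s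
        (Icc t t₁))
      (fun s hs => by
        rw [neg_neg, real_inner_self_eq_norm_sq]
        calc _ ≤ (C.lB * (Real.exp (C.lA * (s - t)) * ‖ζ‖)) ^ 2 := by gcongr; exact hwle s hs ζ
          _ = C.lB ^ 2 * ‖ζ‖ ^ 2 * Real.exp (C.lA * (s - t)) ^ 2 := by ring
          _ = C.lB ^ 2 * ‖ζ‖ ^ 2 * Real.exp (2 * C.lA * (s - t)) := by
            rw [← Real.exp_nat_mul]; congr 2; push_cast; ring
          _ = _ := by field_simp)
    simp only [Pi.neg_apply, hD₁, zero_apply, inner_zero_left, sub_self, mul_zero,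
      Real.exp_zero, neg_zero] at this
    have hexp : Real.exp (2 * C.lA * (t₁ - t)) ≤ Real.exp (2 * C.lA * C.σ) := by
      gcongr; linarith [ht₁.2]
    calc ⟪D t ζ, ζ⟫_ℝ ≤ C.lB ^ 2 * ‖ζ‖ ^ 2 / (2 * C.lA) * Real.exp (2 * C.lA * (t₁ - t))
          - C.lB ^ 2 * ‖ζ‖ ^ 2 / (2 * C.lA) * 1 := by linarith
      _ ≤ C.lB ^ 2 * ‖ζ‖ ^ 2 / (2 * C.lA) * Real.exp (2 * C.lA * C.σ)
          - C.lB ^ 2 * ‖ζ‖ ^ 2 / (2 * C.lA) * 1 := by gcongr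
      _ = _ := by rw [hEg]; ring
  have hDn : ∀ m, 0 ≤ m → (∀ ζ, ⟪D t ζ, ζ⟫_ℝ ≤ m * ‖ζ‖ ^ 2) → ∀ s ∈ Icc t t₁, ∀ ζ,
      ‖D s ζ‖ ≤ m * ‖ζ‖ := fun m hm hmb s hs ζ =>
    norm_le_of_symm_of_quadratic_le hm (hDsymm s hs) (hD0 s hs)
      (fun z => (hDmono s hs z).trans (hmb z)) ζ
  have hinj : Function.Injective (D t) := by
    refine (injective_iff_map_eq_zero (D t)).2 fun η hη => ?_
    have := hlow η
    rw [hη, inner_zero_right] at this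
    have h2 : ‖η‖ ^ 2 ≤ 0 := by
      by_contra hcon
      exact absurd (mul_pos h0 (not_le.1 hcon)) (not_lt.2 this)
    simpa using pow_eq_zero_iff (two_ne_zero) |>.1 (le_antisymm h2 (sq_nonneg _))
  have hsurj : Function.Surjective (D t) := LinearMap.injective_iff_surjective.1
      (show Function.Injective (D t : E →ₗ[ℝ] E) from hinj)
  intro ξ
  -- The inequality `α₀ ≤ Eg` is obtained by cancelling `‖η‖²`, so the zero state is treated apart,
  -- with `t₁ = t` and `K = 0`.
  by_cases hξ : ξ = 0
  · refine ⟨t, ⟨le_rfl, by linarith⟩, fun _ => 0, fun _ => 0, 0, ?_, hξ.symm, rfl, le_rfl, ?_, ?_⟩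
    · intro s _
      simpa using hasDerivWithinAt_const s (Icc t t) (0 : E)
    · simpa using hC.c₁_pos.le
    · intro s _; simp [form]
  obtain ⟨η, hη⟩ := hsurj ξ
  have hη0 : η ≠ 0 := by rintro rfl; exact hξ (by simpa using hη.symm)
  have hηpos : 0 < ‖η‖ := norm_pos_iff.2 hη0
  have hηle : ‖η‖ ≤ ‖ξ‖ / C.α₀ := by
    have := (hlow η).trans (real_inner_le_norm _ _)
    rw [hη] at this
    rw [le_div_iff₀ h0]
    refine le_of_mul_le_mul_left ?_ hηpos
    nlinarith
  have hα : C.α₀ ≤ Eg := by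
    have := (hlow η).trans ((real_inner_comm η (D t η)).symm.le.trans (hW η))
    exact le_of_mul_le_mul_right this (by positivity)
  -- With `D t η = ξ`, the state `F D η` starts at `ξ` and vanishes at `t₁` because the remaining
  -- Gramian does.
  refine ⟨t₁, ht₁, fun s => F s (D s η), fun s => -((S.B s).adjoint ((N s).adjoint η)),
    C.steerCost, ?_, by simp [hFt, hη], by simp [hD₁], hC.steerCost_pos.le,
    hC.upper_const_far hα, ?_⟩
  · intro s hs
    have := (hF s hs).clm_apply (hDv η s hs)
    convert! this using 1
    have e : ∀ z, F s (N s z) = z := fun z => by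
      simpa using congrArg (fun M : E →L[ℝ] E => M z) (hFN s hs)
    simp [e]
  · intro s hs
    set ε := Real.exp (C.a * (s - t)) with hε
    have hε0 : 0 < ε := Real.exp_pos _
    have hy : ∀ m, 0 ≤ m → (∀ ζ, ⟪D t ζ, ζ⟫_ℝ ≤ m * ‖ζ‖ ^ 2) →
        ‖F s (D s η)‖ ≤ m / C.α₀ * (ε * ‖ξ‖) := by
      intro m hm hmb
      calc ‖F s (D s η)‖ ≤ ε * ‖D s η‖ := (F s).le_of_opNorm_le (hFle s hs) _
        _ ≤ ε * (m * (‖ξ‖ / C.α₀)) := by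
          gcongr
          exact (hDn m hm hmb s hs η).trans (by gcongr)
        _ = _ := by ring
    -- Two bounds for the same state: `α₁` enters the shifted control, to match the `α₁ / α₀` inside
    -- `α₀'`; `α₁'` enters the `Q` term, to match `c₁`.
    have hy1 := hy C.α₁ h1.le (fun ζ => by rw [real_inner_comm]; exact hup ζ)
    have hy2 := hy C.α₁' h1'.le (fun ζ => (hW ζ).trans (by gcongr))
    have hw : ‖-((S.B s).adjoint ((N s).adjoint η))‖ ≤ C.lB / C.α₀ * (ε * ‖ξ‖) := by
      rw [norm_neg]
      calc _ ≤ C.lB * (Real.exp (C.lA * (s - t)) * ‖η‖) := hwle s hs η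
        _ ≤ C.lB * (ε * (‖ξ‖ / C.α₀)) := by
          rw [hε]
          gcongr
          · linarith [hs.1]
          · exact hC.lA_le_a
        _ = _ := by ring
    have hv : ‖S.shifted s (F s (D s η)) (-((S.B s).adjoint ((N s).adjoint η)))‖ ^ 2
        ≤ 2 * (C.lB / C.α₀ * (ε * ‖ξ‖)) ^ 2
          + 2 * (C.lH / C.gR * (C.α₁ / C.α₀ * (ε * ‖ξ‖))) ^ 2 := by
      have n1 : ‖S.shifted s (F s (D s η)) (-((S.B s).adjoint ((N s).adjoint η)))‖
          ≤ C.lB / C.α₀ * (ε * ‖ξ‖) + C.lH / C.gR * (C.α₁ / C.α₀ * (ε * ‖ξ‖)) := by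
        refine (norm_add_le _ _).trans (add_le_add hw ?_)
        refine ((hr s hs).norm_Ri_H_le hC _).trans ?_
        gcongr
      have n2 := pow_le_pow_left₀ (norm_nonneg _) n1 2
      refine n2.trans ?_
      nlinarith [sq_nonneg (C.lB / C.α₀ * (ε * ‖ξ‖) - C.lH / C.gR * (C.α₁ / C.α₀ * (ε * ‖ξ‖)))]
    refine ((hr s hs).form_self_le hC _ _).trans ?_
    have hε2 : Real.exp (2 * C.a * (s - t)) = ε ^ 2 := by
      rw [hε, ← Real.exp_nat_mul]; congr 1; push_cast; ring
    rw [hε2]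
    calc _ ≤ C.lQ * (C.α₁' / C.α₀ * (ε * ‖ξ‖)) ^ 2 + C.lR * (2 * (C.lB / C.α₀ * (ε * ‖ξ‖)) ^ 2
          + 2 * (C.lH / C.gR * (C.α₁ / C.α₀ * (ε * ‖ξ‖))) ^ 2) := by gcongr
      _ = _ := by unfold Constants.steerCost; ring

end LQOps

end Steering

/-! ### From minimality to the optimality system. -/

section Stationarity

set_option linter.unusedSectionVars false

variable {E U : Type*} [NormedAddCommGroup E] [InnerProductSpace ℝ E] [CompleteSpace E]
  [NormedAddCommGroup U] [InnerProductSpace ℝ U] [CompleteSpace U]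

lemma hasDerivWithinAt_integral {F : Type*} [NormedAddCommGroup F] [NormedSpace ℝ F]
    [CompleteSpace F] {g : ℝ → F} {a b t : ℝ} (hg : ContinuousOn g (Icc a b)) (ht : t ∈ Icc a b) :
    HasDerivWithinAt (fun s => ∫ r in a..s, g r) (g t) (Icc a b) t := by
  have : Fact (t ∈ Icc a b) := ⟨ht⟩
  apply intervalIntegral.integral_hasDerivWithinAt_right _
    (hg.stronglyMeasurableAtFilter_nhdsWithin measurableSet_Icc t) (hg t ht)
  apply ContinuousOn.intervalIntegrable
  exact hg.mono (uIcc_subset_Icc ⟨le_rfl, ht.1.trans ht.2⟩ ht)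

lemma integral_eq_sub_of_hasDerivWithinAt_Icc {F : Type*} [NormedAddCommGroup F] [NormedSpace ℝ F]
    [CompleteSpace F] {f g : ℝ → F} {a b t : ℝ} (hg : ContinuousOn g (Icc a b))
    (hf : ∀ s ∈ Icc a b, HasDerivWithinAt f (g s) (Icc a b) s) (ht : t ∈ Icc a b) :
    ∫ r in a..t, g r = f t - f a := by
  have := eq_of_hasDerivWithinAt_zero (f := fun s => (∫ r in a..s, g r) - f s)
    (fun s hs => by
      convert! (hasDerivWithinAt_integral hg hs).sub (hf s hs) using 1
      rw [sub_self]) ht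
    (left_mem_Icc.2 (ht.1.trans ht.2))
  simp only [intervalIntegral.integral_same, zero_sub] at this
  rw [sub_eq_iff_eq_add] at this
  rw [this]; abel

namespace LQOps

variable {S : LQOps E U} {C : Constants} {a b : ℝ} {x l : ℝ → E} {u : ℝ → U}

lemma Cont.form {s : Set ℝ} (h : S.Cont s) {x y : ℝ → E} {u w : ℝ → U} (hx : ContinuousOn x s)
    (hu : ContinuousOn u s) (hy : ContinuousOn y s) (hw : ContinuousOn w s) :
    ContinuousOn (fun t => S.form t (x t) (u t) (y t) (w t)) s :=
  (((hx.inner (h.Q.clm_apply hy)).add (hu.inner (h.H.clm_apply hy))).add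
    (hw.inner (h.H.clm_apply hx))).add (hw.inner (h.R.clm_apply hu))

/-- The cost with terminal part `½ ⟪y, G y⟫ - ⟪y, g⟫`. -/
def quadCost (S : LQOps E U) (a b : ℝ) (G : E →L[ℝ] E) (g : E) (x : ℝ → E) (u : ℝ → U) : ℝ :=
  (1 / 2) * (∫ t in a..b, S.form t (x t) (u t) (x t) (u t))
    + ((1 / 2) * ⟪x b, G (x b)⟫_ℝ - ⟪x b, g⟫_ℝ)

lemma eq_zero_of_forall_nonneg_quadratic {p q : ℝ} (h : ∀ ε : ℝ, 0 ≤ ε * p + ε ^ 2 * q) : p = 0 := by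
  have hd := discrim_le_zero (a := q) (b := p) (c := 0) (fun ε => by linarith [h ε, sq ε])
  unfold discrim at hd
  nlinarith [sq_nonneg p]

/-- First-order necessary conditions for minimizers with continuous control. -/
theorem isHam_of_optimal (hab : a < b) (hc : S.Cont (Icc a b))
    (hr : ∀ s ∈ Icc a b, S.RegularAt C s) {G : E →L[ℝ] E} {g : E}
    (hG : ∀ x y, ⟪G x, y⟫_ℝ = ⟪x, G y⟫_ℝ) (hu : ContinuousOn u (Icc a b)) (hx : S.IsTraj a b x u)
    (hl : ∀ s ∈ Icc a b, HasDerivWithinAt l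
      (-((S.A s).adjoint (l s)) - S.Q s (x s) - (S.H s).adjoint (u s)) (Icc a b) s)
    (hlb : l b = G (x b) - g)
    (hopt : ∀ y w, ContinuousOn w (Icc a b) → S.IsTraj a b y w → y a = 0 → ∀ ε : ℝ,
      S.quadCost a b G g x u
        ≤ S.quadCost a b G g (fun t => x t + ε • y t) (fun t => u t + ε • w t)) :
    S.IsHam a b x u l := by
  refine ⟨hx, hl, ?_⟩
  have hxc : ContinuousOn x (Icc a b) := fun s hs => (hx s hs).continuousWithinAt
  have hlc : ContinuousOn l (Icc a b) := fun s hs => (hl s hs).continuousWithinAt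
  have hBa : ContinuousOn (fun t => (S.B t).adjoint) (Icc a b) :=
    ContinuousLinearMap.adjoint.continuous.comp_continuousOn hc.B
  -- The stationarity residual itself is used as the direction of variation. The first variation is
  -- then `∫ ‖w‖²`, and continuity forces `w = 0` everywhere.
  set w : ℝ → U := fun s => S.R s (u s) + S.H s (x s) + (S.B s).adjoint (l s) with hw
  have hwc : ContinuousOn w (Icc a b) :=
    ((hc.R.clm_apply hu).add (hc.H.clm_apply hxc)).add (hBa.clm_apply hlc)
  obtain ⟨y, hya, hy⟩ := exists_linear_solution hab.le hc.A (hc.B.clm_apply hwc) 0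
  have hy' : S.IsTraj a b y w := hy
  have hyc : ContinuousOn y (Icc a b) := fun s hs => (hy s hs).continuousWithinAt
  have hsub : uIcc a b ⊆ Icc a b := by rw [uIcc_of_le hab.le]
  have i1 := ((hc.form hxc hu hxc hu).mono hsub).intervalIntegrable (μ := volume)
  have i2 := ((hc.form hxc hu hyc hwc).mono hsub).intervalIntegrable (μ := volume)
  have i3 := ((hc.form hyc hwc hyc hwc).mono hsub).intervalIntegrable (μ := volume)
  have hww : ContinuousOn (fun s => ⟪w s, w s⟫_ℝ) (Icc a b) := hwc.inner hwc
  have i4 := (hww.mono hsub).intervalIntegrable (μ := volume)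
  have hpair : ∫ s in a..b, (⟪w s, w s⟫_ℝ - S.form s (x s) (u s) (y s) (w s)) = ⟪l b, y b⟫_ℝ := by
    have := integral_eq_sub_of_hasDerivWithinAt_Icc (f := fun s => ⟪l s, y s⟫_ℝ)
      (g := fun s => ⟪w s, w s⟫_ℝ - S.form s (x s) (u s) (y s) (w s)) (hww.sub (hc.form hxc hu hyc hwc)) (fun s hs => by
        convert! (hl s hs).inner ℝ (hy' s hs) using 1
        have e1 : ⟪l s, S.B s (w s)⟫_ℝ
            = ⟪w s, w s⟫_ℝ - ⟪w s, S.R s (u s)⟫_ℝ - ⟪w s, S.H s (x s)⟫_ℝ := by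
          rw [← ContinuousLinearMap.adjoint_inner_left, real_inner_comm]
          have : (S.B s).adjoint (l s) = w s - S.R s (u s) - S.H s (x s) := by
            simp only [hw]; abel
          rw [this, inner_sub_right, inner_sub_right]
        simp only [inner_add_right, inner_sub_left, inner_neg_left,
          ContinuousLinearMap.adjoint_inner_left, e1, LQOps.form, (hr s hs).symmQ]
        ring) (right_mem_Icc.2 hab.le)
    simpa [hya] using this
  have hzero : ∫ s in a..b, ⟪w s, w s⟫_ℝ = 0 := by
    refine eq_zero_of_forall_nonneg_quadratic
      (q := (1 / 2) * (∫ s in a..b, S.form s (y s) (w s) (y s) (w s)) + (1 / 2) * ⟪y b, G (y b)⟫_ℝ)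
      fun ε => ?_
    have h1 := hopt y w hwc hy' hya ε
    unfold quadCost at h1
    have e1 : ∫ t in a..b, S.form t (x t + ε • y t) (u t + ε • w t) (x t + ε • y t) (u t + ε • w t)
        = (∫ t in a..b, S.form t (x t) (u t) (x t) (u t))
          + 2 * ε * (∫ t in a..b, S.form t (x t) (u t) (y t) (w t))
          + ε ^ 2 * ∫ t in a..b, S.form t (y t) (w t) (y t) (w t) := by
      rw [← intervalIntegral.integral_const_mul, ← intervalIntegral.integral_const_mul,
        ← intervalIntegral.integral_add i1 (i2.const_mul _),
        ← intervalIntegral.integral_add (i1.add (i2.const_mul _)) (i3.const_mul _)]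
      refine intervalIntegral.integral_congr fun s hs => ?_
      have hcomm := (hr s (hsub hs)).form_comm (x s) (u s) (y s) (w s)
      have e : S.form s (x s + ε • y s) (u s + ε • w s) (x s + ε • y s) (u s + ε • w s)
          = S.form s (x s) (u s) (x s) (u s) + ε * S.form s (x s) (u s) (y s) (w s)
            + ε * S.form s (y s) (w s) (x s) (u s) + ε ^ 2 * S.form s (y s) (w s) (y s) (w s) := by
        simp only [LQOps.form, map_add, map_smul, inner_add_left, inner_add_right, inner_smul_left,
          inner_smul_right, RCLike.conj_to_real]
        ring
      simp only [e, ← hcomm]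
      ring
    have e2 : ⟪x b + ε • y b, G (x b + ε • y b)⟫_ℝ
        = ⟪x b, G (x b)⟫_ℝ + 2 * ε * ⟪G (x b), y b⟫_ℝ + ε ^ 2 * ⟪y b, G (y b)⟫_ℝ := by
      simp only [map_add, map_smul, inner_add_left, inner_add_right, inner_smul_left,
        inner_smul_right, RCLike.conj_to_real, hG (x b) (y b)]
      rw [← hG (x b) (y b), real_inner_comm (y b) (G (x b))]
      ring
    have e3 : ⟪x b + ε • y b, g⟫_ℝ = ⟪x b, g⟫_ℝ + ε * ⟪g, y b⟫_ℝ := by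
      rw [inner_add_left, inner_smul_left, RCLike.conj_to_real, real_inner_comm g (y b)]
    rw [e1, e2, e3] at h1
    rw [intervalIntegral.integral_sub i4 i2, hlb, inner_sub_left] at hpair
    have e4 : ∫ s in a..b, ⟪w s, w s⟫_ℝ = (∫ s in a..b, S.form s (x s) (u s) (y s) (w s))
        + (⟪G (x b), y b⟫_ℝ - ⟪g, y b⟫_ℝ) := by linarith
    rw [e4]
    linarith
  intro s hs
  by_contra hne
  have hpos : 0 < ∫ s in a..b, ⟪w s, w s⟫_ℝ :=
    intervalIntegral.integral_pos hab hww (fun r _ => real_inner_self_nonneg)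
      ⟨s, hs, real_inner_self_pos.2 hne⟩
  linarith

end LQOps

end Stationarity

/-! ### From matrices to operators -/

section Matrices

variable {p q r : ℕ}

/-- The continuous linear map of a matrix. -/
def toCLM : Mat p q →L[ℝ] (Vec q →L[ℝ] Vec p) :=
  LinearMap.toContinuousLinearMap
    ((Matrix.toEuclideanLin (𝕜 := ℝ) (m := Fin p) (n := Fin q)).trans
      LinearMap.toContinuousLinearMap).toLinearMap

@[simp] lemma toCLM_apply (M : Mat p q) (v : Vec q) : toCLM M v = mulV M v := rfl

lemma norm_toCLM (M : Mat p q) : ‖toCLM M‖ = ‖M‖ := rfl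

lemma toCLM_mul (M : Mat p q) (N : Mat q r) : toCLM (M * N) = toCLM M ∘L toCLM N := by
  ext v : 1
  simp [mulV, Matrix.toLpLin_apply]

lemma toCLM_one : toCLM (1 : Mat p p) = 1 := by
  ext v : 1
  simp [mulV]

lemma toCLM_transpose (M : Mat p q) : toCLM Mᵀ = (toCLM M).adjoint := by
  refine (ContinuousLinearMap.eq_adjoint_iff _ _).2 fun v w => ?_
  have := Matrix.toEuclideanLin_conjTranspose_eq_adjoint M
  rw [Matrix.conjTranspose_eq_transpose_of_trivial] at this
  rw [toCLM_apply, toCLM_apply, mulV, mulV, this, LinearMap.adjoint_inner_left]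

lemma inner_toCLM_transpose (M : Mat p q) (v : Vec p) (w : Vec q) :
    ⟪toCLM Mᵀ v, w⟫_ℝ = ⟪v, toCLM M w⟫_ℝ := by
  rw [toCLM_transpose, ContinuousLinearMap.adjoint_inner_left]

lemma inner_toCLM_symm {M : Mat p p} (hM : M.IsHermitian) (v w : Vec p) :
    ⟪toCLM M v, w⟫_ℝ = ⟪v, toCLM M w⟫_ℝ := by
  have : Mᵀ = M := by
    rw [← Matrix.conjTranspose_eq_transpose_of_trivial]; exact hM
  conv_lhs => rw [← this]
  exact inner_toCLM_transpose M v w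

lemma inner_toCLM_nonneg {M : Mat p p} (hM : M.PosSemidef) (v : Vec p) :
    0 ≤ ⟪v, toCLM M v⟫_ℝ := by
  have := (Matrix.isPositive_toEuclideanLin_iff.2 hM).re_inner_nonneg_right v
  simpa using this

lemma inner_toCLM_le {M N : Mat p p} (h : M ≤ N) (v : Vec p) :
    ⟪v, toCLM M v⟫_ℝ ≤ ⟪v, toCLM N v⟫_ℝ := by
  have := inner_toCLM_nonneg (Matrix.le_iff.1 h) v
  rw [map_sub, sub_apply, inner_sub_right] at this
  linarith

lemma inner_toCLM_smul_one (c : ℝ) (v : Vec p) :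
    ⟪v, toCLM (c • (1 : Mat p p)) v⟫_ℝ = c * ‖v‖ ^ 2 := by
  rw [map_smul, toCLM_one, smul_apply, inner_smul_right]
  simp

/-- The Loewner order includes symmetry of the difference; this is the source of every symmetry used
later. -/
lemma isHermitian_of_smul_one_le {M : Mat p p} {c : ℝ} (h : c • (1 : Mat p p) ≤ M) :
    M.IsHermitian := by
  have h1 := (Matrix.le_iff.1 h).isHermitian
  have h2 : (c • (1 : Mat p p)).IsHermitian := by
    rw [Matrix.IsHermitian, Matrix.conjTranspose_smul, Matrix.conjTranspose_one]; simp
  simpa using h1.add h2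

lemma posDef_of_smul_one_le {M : Mat p p} {c : ℝ} (hc : 0 < c) (h : c • (1 : Mat p p) ≤ M) :
    M.PosDef := by
  have h1 : (c • (1 : Mat p p)).PosDef := Matrix.PosDef.one.smul hc
  simpa using h1.add_posSemidef (Matrix.le_iff.1 h)

lemma continuousOn_matrix_inv {f : ℝ → Mat p p} {s : Set ℝ} (hf : ContinuousOn f s)
    (hu : ∀ t ∈ s, IsUnit (f t)) : ContinuousOn (fun t => (f t)⁻¹) s := by
  intro t ht
  obtain ⟨u, hu⟩ := hu t ht
  simp only [Matrix.nonsing_inv_eq_ringInverse]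
  have h1 : ContinuousAt Ring.inverse (f t) := hu ▸ NormedRing.inverse_continuousAt u
  exact h1.comp_continuousWithinAt (hf t ht)

end Matrices

/-! ### The assumptions in operator form. -/

section Data

variable {nx nu : ℕ}

/-- The operators of a linear-quadratic problem given by matrices. -/
def LQData.ops (D : LQData nx nu) : LQOps (Vec nx) (Vec nu) where
  A t := toCLM (D.A t)
  B t := toCLM (D.B t)
  Q t := toCLM (D.Q t)
  H t := toCLM (D.H t)
  R t := toCLM (D.R t)
  Ri t := toCLM (D.R t)⁻¹

variable {D : LQData nx nu} {T : ℝ} {C : Constants}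

lemma LQData.isUnit_R (hC : C.Positive) (hco : D.Coercive T C) {t : ℝ} (ht : t ∈ Icc 0 T) :
    IsUnit (D.R t) :=
  (posDef_of_smul_one_le hC.gR (hco.R_lower t ht)).isUnit

lemma LQData.ops_cont (hC : C.Positive) (hb : D.Bounded T C) (hco : D.Coercive T C) :
    D.ops.Cont (Icc 0 T) where
  A := toCLM.continuous.comp_continuousOn hb.contA
  B := toCLM.continuous.comp_continuousOn hb.contB
  Q := toCLM.continuous.comp_continuousOn hb.contQ
  H := toCLM.continuous.comp_continuousOn hb.contH
  R := toCLM.continuous.comp_continuousOn hb.contR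
  Ri := toCLM.continuous.comp_continuousOn
    (continuousOn_matrix_inv hb.contR fun _ ht => D.isUnit_R hC hco ht)

/-- Coercivity makes both `R` and the Schur complement symmetric, hence also their combination `Q`.
-/
lemma LQData.isHermitian_Q (hco : D.Coercive T C) {t : ℝ} (ht : t ∈ Icc 0 T) :
    (D.Q t).IsHermitian := by
  have h1 := isHermitian_of_smul_one_le (hco.Q_lower t ht)
  have h2 := (isHermitian_of_smul_one_le (hco.R_lower t ht)).inv
  have h3 : ((D.H t)ᵀ * (D.R t)⁻¹ * D.H t).IsHermitian := by
    have := Matrix.isHermitian_conjTranspose_mul_mul (D.H t) h2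
    rwa [Matrix.conjTranspose_eq_transpose_of_trivial] at this
  simpa using h1.add h3

lemma LQData.ops_regularAt (hC : C.Positive) (hb : D.Bounded T C) (hco : D.Coercive T C) {t : ℝ}
    (ht : t ∈ Icc 0 T) : D.ops.RegularAt C t where
  boundA := (norm_toCLM _).trans_le (hb.boundA t ht)
  boundB := (norm_toCLM _).trans_le (hb.boundB t ht)
  boundQ := (norm_toCLM _).trans_le (hb.boundQ t ht)
  boundH := (norm_toCLM _).trans_le (hb.boundH t ht)
  boundR := (norm_toCLM _).trans_le (hb.boundR t ht)
  symmQ := inner_toCLM_symm (D.isHermitian_Q hco ht)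
  symmR := inner_toCLM_symm (isHermitian_of_smul_one_le (hco.R_lower t ht))
  R_Ri w := by
    have h := (Matrix.isUnit_iff_isUnit_det _).1 (D.isUnit_R hC hco ht)
    change (toCLM (D.R t) ∘L toCLM (D.R t)⁻¹) w = w
    rw [← toCLM_mul, Matrix.mul_nonsing_inv _ h, toCLM_one]; rfl
  Ri_R w := by
    have h := (Matrix.isUnit_iff_isUnit_det _).1 (D.isUnit_R hC hco ht)
    change (toCLM (D.R t)⁻¹ ∘L toCLM (D.R t)) w = w
    rw [← toCLM_mul, Matrix.nonsing_inv_mul _ h, toCLM_one]; rfl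
  R_lower w := by
    have := inner_toCLM_le (hco.R_lower t ht) w
    rwa [inner_toCLM_smul_one] at this
  Q_lower x := by
    have := inner_toCLM_le (hco.Q_lower t ht) x
    rw [inner_toCLM_smul_one, map_sub, sub_apply, inner_sub_right, toCLM_mul, toCLM_mul] at this
    refine this.trans (le_of_eq ?_)
    change _ - ⟪x, toCLM (D.H t)ᵀ (toCLM (D.R t)⁻¹ (toCLM (D.H t) x))⟫_ℝ
      = ⟪x, toCLM (D.Q t) x⟫_ℝ - ⟪toCLM (D.H t) x, toCLM (D.R t)⁻¹ (toCLM (D.H t) x)⟫_ℝ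
    rw [toCLM_transpose, ContinuousLinearMap.adjoint_inner_right]

lemma LQData.isWeight_Q (hC : C.Positive) (hb : D.Bounded T C) (hco : D.Coercive T C) {t : ℝ}
    (ht : t ∈ Icc 0 T) : IsWeight C (toCLM (D.Q t)) where
  symm := inner_toCLM_symm (D.isHermitian_Q hco ht)
  lower x := by
    have h := D.ops_regularAt hC hb hco ht
    have h1 := h.Q_lower x
    have h2 := h.inner_Ri_nonneg hC (D.ops.H t x)
    change _ ≤ ⟪x, D.ops.Q t x⟫_ℝ
    linarith
  upper x := (D.ops_regularAt hC hb hco ht).inner_Q_le x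

lemma LQData.isWeight_QT (hco : D.Coercive T C) : IsWeight C (toCLM D.QT) where
  symm := inner_toCLM_symm (isHermitian_of_smul_one_le hco.QT_lower)
  lower x := by
    have := inner_toCLM_le hco.QT_lower x
    rwa [inner_toCLM_smul_one] at this
  upper x := by
    have := inner_toCLM_le hco.QT_upper x
    rwa [inner_toCLM_smul_one] at this

/-! ### The evolution operator and controllability -/

/-- Every evolution operator factors through a fundamental matrix and its inverse. -/
lemma exists_fundamental_matrix {A : ℝ → Mat nx nx} (hT : 0 ≤ T) (hA : ContinuousOn A (Icc 0 T)) :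
    ∃ F N : ℝ → Mat nx nx, (∀ t ∈ Icc 0 T, HasDerivWithinAt F (A t * F t) (Icc 0 T) t) ∧
      (∀ t ∈ Icc 0 T, HasDerivWithinAt N (-(N t * A t)) (Icc 0 T) t) ∧
      (∀ t ∈ Icc 0 T, N t * F t = 1) ∧ ∀ t ∈ Icc 0 T, F t * N t = 1 := by
  have hl : ContinuousOn (fun t => ContinuousLinearMap.mul ℝ (Mat nx nx) (A t)) (Icc 0 T) :=
    (ContinuousLinearMap.mul ℝ (Mat nx nx)).continuous.comp_continuousOn hA
  have hr : ContinuousOn (fun t => -(ContinuousLinearMap.mul ℝ (Mat nx nx)).flip (A t)) (Icc 0 T) :=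
    ((ContinuousLinearMap.mul ℝ (Mat nx nx)).flip.continuous.comp_continuousOn hA).neg
  obtain ⟨F, hF0, hF⟩ := exists_linear_solution hT hl (g := fun _ => 0) continuousOn_const 1
  obtain ⟨N, hN0, hN⟩ := exists_linear_solution hT hr (g := fun _ => 0) continuousOn_const 1
  have hF' : ∀ t ∈ Icc 0 T, HasDerivWithinAt F (A t * F t) (Icc 0 T) t :=
    fun t ht => by simpa using hF t ht
  have hN' : ∀ t ∈ Icc 0 T, HasDerivWithinAt N (-(N t * A t)) (Icc 0 T) t :=
    fun t ht => by simpa using hN t ht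
  -- `N` solves the adjoint-side equation, so the product has zero derivative and `F` is invertible
  -- without a determinant argument.
  have hNF : ∀ t ∈ Icc 0 T, N t * F t = 1 := by
    intro t ht
    have := eq_of_hasDerivWithinAt_zero (f := fun t => N t * F t) (fun s hs => by
      convert! (hN' s hs).mul (hF' s hs) using 1
      noncomm_ring) ht (left_mem_Icc.2 hT)
    simpa [hF0, hN0] using this
  exact ⟨F, N, hF', hN', hNF, fun t ht => mul_eq_one_comm.1 (hNF t ht)⟩

/-- The evolution is defined by choice. Existence comes from `F t * N s`, and uniqueness holds
because `N r * Φ(r, s)` is constant in `r`. -/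
lemma evolution_eq {A : ℝ → Mat nx nx} {F N : ℝ → Mat nx nx}
    (hF : ∀ t ∈ Icc 0 T, HasDerivWithinAt F (A t * F t) (Icc 0 T) t)
    (hN : ∀ t ∈ Icc 0 T, HasDerivWithinAt N (-(N t * A t)) (Icc 0 T) t)
    (hFN : ∀ t ∈ Icc 0 T, F t * N t = 1) {s t : ℝ} (hs : s ∈ Icc 0 T) (ht : t ∈ Icc 0 T) :
    evolution A T t s = F t * N s := by
  have hex : IsEvolution A T (fun t s => F t * N s) := fun s hs =>
    ⟨hFN s hs, fun t ht => by
      have := (hF t ht).mul_const (N s)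
      rwa [mul_assoc] at this⟩
  have hev : IsEvolution A T (evolution A T) :=
    Classical.epsilon_spec (p := IsEvolution A T) ⟨_, hex⟩
  obtain ⟨h1, h2⟩ := hev s hs
  have := eq_of_hasDerivWithinAt_zero (f := fun r => N r * evolution A T r s) (fun r hr => by
    convert! (hN r hr).mul (h2 r hr) using 1
    noncomm_ring) ht hs
  simp only [h1, mul_one] at this
  rw [← this, ← mul_assoc, hFN t ht, one_mul]

lemma LQData.steersToZero (hC : C.Positive) (hT : 0 ≤ T) (hb : D.Bounded T C) (hco : D.Coercive T C)
    (hucc : D.UCC T C) {t : ℝ} (ht0 : 0 ≤ t) (htT : t + C.σ ≤ T) : D.ops.SteersToZero C t := by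
  have hσ := hC.σ
  obtain ⟨F, N, hF, hN, hNF, hFN⟩ := exists_fundamental_matrix hT hb.contA
  obtain ⟨t₁, ht₁, hlow, hup, -⟩ := hucc t ⟨ht0, by linarith⟩
  have hsub : Icc t t₁ ⊆ Icc 0 T := Icc_subset_Icc ht0 (ht₁.2.trans htT)
  have htT' : t ∈ Icc 0 T := ⟨ht0, by linarith⟩
  have hNc : ContinuousOn N (Icc 0 T) := fun s hs => (hN s hs).continuousWithinAt
  have htrc : ∀ {p q : ℕ} {f : ℝ → Mat p q} {s : Set ℝ}, ContinuousOn f s →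
      ContinuousOn (fun t => (f t)ᵀ) s := fun hf =>
    (continuous_id.matrix_transpose).comp_continuousOn hf
  set g : ℝ → Mat nx nx := fun s => (F t * N s) * D.B s * (D.B s)ᵀ * (F t * N s)ᵀ with hg
  have hgc : ContinuousOn g (Icc t t₁) := by
    have h1 : ContinuousOn (fun s => F t * N s) (Icc t t₁) := continuousOn_const.mul (hNc.mono hsub)
    have h2 : ContinuousOn D.B (Icc t t₁) := hb.contB.mono hsub
    have h3 : ContinuousOn (fun s => F t * N s * D.B s) (Icc t t₁) := by
      rw [continuousOn_iff_continuous_domRestrict] at h1 h2 ⊢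
      exact h1.matrix_mul h2
    have h4 : ContinuousOn (fun s => (F t * N s * D.B s) * (F t * N s * D.B s)ᵀ) (Icc t t₁) := by
      have h3' := htrc h3
      rw [continuousOn_iff_continuous_domRestrict] at h3 h3' ⊢
      exact h3.matrix_mul h3'
    refine h4.congr fun s _ => ?_
    simp only [hg, Matrix.transpose_mul, Matrix.mul_assoc]
  have hgram : gramian D.A D.B T t t₁ = ∫ s in t..t₁, g s := by
    unfold gramian
    refine intervalIntegral.integral_congr fun s hs => ?_
    rw [uIcc_of_le ht₁.1] at hs
    simp only [evolution_eq hF hN hFN (hsub hs) htT', hg]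
  rw [hgram] at hlow hup
  refine LQOps.steersToZero_of_gramian hC ht₁
    -- The Gramian over `[s, t₁]` is written as a difference of integrals from `t`, so that only the
    -- upper limit is differentiated.
    (fun s hs => D.ops_regularAt hC hb hco (hsub hs)) (F := fun s => toCLM (F s * N t))
    (N := fun s => toCLM (F t * N s))
    (D := fun s => toCLM ((∫ r in t..t₁, g r) - ∫ r in t..s, g r)) ?_ ?_ ?_ ?_ ?_ ?_ ?_ ?_ ?_
  · intro s hs
    have := toCLM.hasFDerivAt.comp_hasDerivWithinAt s
      (((hF s (hsub hs)).mono hsub).mul_const (N t))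
    convert! this using 1
    rw [Matrix.mul_assoc, toCLM_mul (D.A s)]; rfl
  · intro s hs
    have := toCLM.hasFDerivAt.comp_hasDerivWithinAt s
      (((hN s (hsub hs)).mono hsub).const_mul (F t))
    convert! this using 1
    rw [Matrix.mul_neg, map_neg, ← Matrix.mul_assoc, toCLM_mul (F t * N s)]; rfl
  · intro s hs
    have : toCLM (F s * N t) * toCLM (F t * N s) = toCLM ((F s * N t) * (F t * N s)) :=
      (toCLM_mul _ _).symm
    rw [this, Matrix.mul_assoc, ← Matrix.mul_assoc (N t), hNF t htT', Matrix.one_mul,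
      hFN s (hsub hs), toCLM_one]
  · simp only [hFN t htT', toCLM_one]
  · simp only [hFN t htT', toCLM_one]
  · intro s hs
    have := toCLM.hasFDerivAt.comp_hasDerivWithinAt s
      ((hasDerivWithinAt_integral hgc hs).const_sub (∫ r in t..t₁, g r))
    convert! this using 1
    rw [map_neg, ← toCLM_transpose]
    change -(toCLM (F t * N s) ∘L toCLM (D.B s) ∘L (toCLM (D.B s)).adjoint ∘L toCLM (F t * N s)ᵀ) = _
    rw [← toCLM_transpose, ← toCLM_mul, ← toCLM_mul, ← toCLM_mul]
    simp only [hg, Matrix.mul_assoc]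
  · simp
  · intro ξ
    have := inner_toCLM_le hlow ξ
    rw [inner_toCLM_smul_one] at this
    simpa using this
  · intro ξ
    have := inner_toCLM_le hup ξ
    rw [inner_toCLM_smul_one] at this
    simpa using this

end Data

/-! ### Solutions satisfy the optimality system -/

section Solutions

variable {nx nu : ℕ} {D : LQData nx nu} {T : ℝ} {C : Constants}

lemma LQData.stage_eq_form (t : ℝ) (x : Vec nx) (u : Vec nu) :
    D.stage t x u = D.ops.form t x u x u := by
  have h : bil x (D.H t)ᵀ u = ⟪u, toCLM (D.H t) x⟫_ℝ := by
    change ⟪x, toCLM (D.H t)ᵀ u⟫_ℝ = _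
    rw [toCLM_transpose, ContinuousLinearMap.adjoint_inner_right, real_inner_comm]
  unfold LQData.stage
  rw [h]
  rfl

lemma gradient_quadratic {n : ℕ} {G : Mat n n} (hG : G.IsHermitian) (q y : Vec n) :
    gradient (fun y => (1 / 2) * bil y G y - bil y G q) y = toCLM G y - toCLM G q := by
  refine HasGradientAt.gradient ?_
  rw [hasGradientAt_iff_hasFDerivAt]
  have h1 : HasFDerivAt (fun y : Vec n => (1 / 2) * ⟪y, toCLM G y⟫_ℝ - ⟪y, toCLM G q⟫_ℝ) _ y :=
    (((hasFDerivAt_id y).inner ℝ ((toCLM G).hasFDerivAt (x := y))).const_mul (1 / 2)).sub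
      ((hasFDerivAt_id y).inner ℝ (hasFDerivAt_const (toCLM G q) y))
  refine h1.congr_fderiv ?_
  ext v
  have e1 : ⟪y, toCLM G v⟫_ℝ = ⟪toCLM G y, v⟫_ℝ := (inner_toCLM_symm hG y v).symm
  have e2 : ⟪v, toCLM G y⟫_ℝ = ⟪toCLM G y, v⟫_ℝ := real_inner_comm _ _
  have e3 : ⟪v, toCLM G q⟫_ℝ = ⟪toCLM G q, v⟫_ℝ := real_inner_comm _ _
  simp only [sub_apply, smul_apply, ContinuousLinearMap.comp_apply, ContinuousLinearMap.prod_apply,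
    fderivInnerCLM_apply, InnerProductSpace.toDual_apply_apply, inner_sub_left, smul_eq_mul, id_eq,
    ContinuousLinearMap.id_apply, e1, e2, e3, zero_apply, inner_zero_right, zero_add]
  ring

lemma LQData.IsSolution.left_eq {a b : ℝ} {p : Vec nx} {L : Vec nx → ℝ} {z : Trajectory nx nu}
    (h : D.IsSolution a b p L z) (hab : a ≤ b) : z.x a = p := by
  simpa using h.admissible.state_eq a (left_mem_Icc.2 hab)

/-- Every perturbation of the minimizer by a trajectory with continuous control and zero initial
state is admissible, which is all the variational argument requires. -/
lemma LQData.IsSolution.isHam (hC : C.Positive) (hb : D.Bounded T C) (hco : D.Coercive T C)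
    {a b : ℝ} (ha : 0 ≤ a) (hab : a < b) (hbT : b ≤ T) {p q : Vec nx} {G : Mat nx nx}
    (hG : G.IsHermitian) {L : Vec nx → ℝ}
    (hL : L = fun y => (1 / 2) * bil y G y - bil y G q) {z : Trajectory nx nu}
    (h : D.IsSolution a b p L z) :
    D.ops.IsHam a b z.x z.u z.lam ∧ z.lam b = toCLM G (z.x b) - toCLM G q := by
  have hsub : Icc a b ⊆ Icc 0 T := Icc_subset_Icc ha hbT
  have hc : D.ops.Cont (Icc a b) := (D.ops_cont hC hb hco).mono hsub
  have hr : ∀ s ∈ Icc a b, D.ops.RegularAt C s := fun s hs => D.ops_regularAt hC hb hco (hsub hs)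
  have hlb : z.lam b = toCLM G (z.x b) - toCLM G q := by
    rw [h.adjoint_end, hL, gradient_quadratic hG]
  refine ⟨?_, hlb⟩
  have hxc := h.admissible.state_cont
  have huc := h.control_cont
  have hrhs : ∀ {x : ℝ → Vec nx} {u : ℝ → Vec nu}, ContinuousOn x (Icc a b) →
      ContinuousOn u (Icc a b) →
      ContinuousOn (fun s => D.ops.A s (x s) + D.ops.B s (u s)) (Icc a b) := fun hx hu =>
    (hc.A.clm_apply hx).add (hc.B.clm_apply hu)
  have htraj : D.ops.IsTraj a b z.x z.u := by
    intro s hs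
    have := (hasDerivWithinAt_integral (hrhs hxc huc) hs).const_add p
    exact this.congr_of_mem (fun r hr' => h.admissible.state_eq r hr') hs
  have hcost : ∀ x u, D.cost a b L x u = D.ops.quadCost a b (toCLM G) (toCLM G q) x u := by
    intro x u
    unfold LQData.cost LQOps.quadCost
    simp only [LQData.stage_eq_form, hL]
    rfl
  refine LQOps.isHam_of_optimal hab hc hr (inner_toCLM_symm hG) huc htraj ?_ hlb ?_
  · intro s hs
    have := h.adjoint_eq s hs
    convert! this using 1
    change -((toCLM (D.A s)).adjoint (z.lam s)) - toCLM (D.Q s) (z.x s)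
      - (toCLM (D.H s)).adjoint (z.u s) = _
    rw [← toCLM_transpose, ← toCLM_transpose]
    rfl
  · intro y w hw hy hya ε
    rw [← hcost, ← hcost]
    have hyc : ContinuousOn y (Icc a b) := fun s hs => (hy s hs).continuousWithinAt
    have huw : ContinuousOn (fun t => z.u t + ε • w t) (Icc a b) := huc.add (hw.const_smul ε)
    have hxy : ContinuousOn (fun t => z.x t + ε • y t) (Icc a b) := hxc.add (hyc.const_smul ε)
    refine h.optimal _ _ ⟨huw.aestronglyMeasurable measurableSet_Icc,
      isCompact_Icc.exists_bound_of_continuousOn huw, hxy, fun t ht => ?_⟩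
    have := integral_eq_sub_of_hasDerivWithinAt_Icc (f := fun t => z.x t + ε • y t) (t := t)
      (hrhs hxy huw) (fun s hs => by
        convert! (htraj s hs).add ((hy s hs).const_smul ε) using 1
        simp only [map_add, map_smul, smul_add]
        abel) ht
    change z.x t + ε • y t = p + ∫ s in a..t,
      (D.ops.A s (z.x s + ε • y s) + D.ops.B s (z.u s + ε • w s))
    rw [this, hya, h.left_eq hab.le]
    simp

end Solutions

/-! ### The overlapping decomposition -/

namespace Decomposition

variable {T : ℝ} {m : ℕ} (P : Decomposition T m)

lemma t_nonneg (i : Fin (m + 1)) : 0 ≤ P.t i := by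
  rw [← P.t_first]; exact P.t_mono.monotone (Fin.zero_le i)

lemma t_le (i : Fin (m + 1)) : P.t i ≤ T := by
  calc P.t i ≤ P.t (Fin.last m) := P.t_mono.monotone (Fin.le_last i)
    _ = T := P.t_last

lemma τ_le (j : Fin m) : P.τ ≤ P.τ₀ j ∧ P.τ ≤ P.τ₁ j := by
  have h : P.τ ≤ min (P.τ₀ j) (P.τ₁ j) := ciInf_le (Set.finite_range _).bddBelow j
  exact ⟨h.trans (min_le_left _ _), h.trans (min_le_right _ _)⟩

lemma left_nonneg (j : Fin m) : 0 ≤ P.left j := le_max_right _ _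

lemma right_le (j : Fin m) : P.right j ≤ T := min_le_right _ _

lemma left_le (j : Fin m) : P.left j ≤ P.t j.castSucc :=
  max_le (by linarith [P.τ₀_pos j]) (P.t_nonneg _)

lemma le_right (j : Fin m) : P.t j.succ ≤ P.right j :=
  le_min (by linarith [P.τ₁_pos j]) (P.t_le _)

lemma left_lt_right (j : Fin m) : P.left j < P.right j :=
  (P.left_le j).trans_lt ((P.t_mono Fin.castSucc_lt_succ).trans_le (P.le_right j))

lemma piece_subset (j : Fin m) : P.piece j ⊆ Icc (P.t j.castSucc) (P.t j.succ) := by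
  unfold piece
  split_ifs
  · exact subset_rfl
  · exact Ico_subset_Icc_self

lemma succ_eq_last {j : Fin m} (hj : (j : ℕ) + 1 = m) : P.t j.succ = T :=
  (congrArg P.t (Fin.ext (by simpa using hj))).trans P.t_last

lemma right_of_last {j : Fin m} (hj : (j : ℕ) + 1 = m) : P.right j = T :=
  le_antisymm (P.right_le j) ((P.succ_eq_last hj).symm.le.trans (P.le_right j))

lemma exists_mem_piece {t : ℝ} (hm : 0 < m) (ht : t ∈ Icc 0 T) : ∃ j, t ∈ P.piece j := by
  classical
  obtain ⟨n, hn⟩ : ∃ n, n + 1 = m := ⟨m - 1, by omega⟩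
  subst hn
  -- The piece containing `t` has the largest index whose left breakpoint does not exceed `t`.
  set s := Finset.univ.filter (fun j : Fin (n + 1) => P.t j.castSucc ≤ t) with hs
  have hne : s.Nonempty := ⟨0, by simp [hs, P.t_first, ht.1]⟩
  refine ⟨s.max' hne, ?_⟩
  set j := s.max' hne with hj
  have hjm : P.t j.castSucc ≤ t := by
    have := s.max'_mem hne
    simpa [hs] using this
  unfold piece
  split_ifs with hlast
  · exact ⟨hjm, by rw [P.succ_eq_last hlast]; exact ht.2⟩
  · refine ⟨hjm, ?_⟩
    by_contra hcon
    have hlt : (j : ℕ) + 1 < n + 1 := by omega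
    set j' : Fin (n + 1) := ⟨j + 1, hlt⟩ with hj'
    have hmem : j' ∈ s := by
      have : j'.castSucc = j.succ := by ext; simp [hj']
      simp only [hs, Finset.mem_filter, Finset.mem_univ, true_and, this]
      exact not_lt.1 hcon
    have := s.le_max' j' hmem
    rw [← hj] at this
    have : (j : ℕ) + 1 ≤ j := this
    omega

end Decomposition

/-! ### One step of the iteration -/

section Step

variable {nx nu m : ℕ} {D : LQData nx nu} {T : ℝ} {C : Constants} {P : Decomposition T m}
  {x0 : Vec nx}

lemma LQData.ops_problem (hC : C.Positive) (hT : 0 ≤ T) (hb : D.Bounded T C) (hucc : D.UCC T C)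
    (hco : D.Coercive T C) {a b : ℝ} (ha : 0 ≤ a) (hab : a ≤ b) (hbT : b ≤ T)
    {G : Vec nx →L[ℝ] Vec nx} (hG : IsWeight C G) : D.ops.Problem C a b G where
  pos := hC
  le := hab
  cont := (D.ops_cont hC hb hco).mono (Icc_subset_Icc ha hbT)
  reg _ hs := D.ops_regularAt hC hb hco ⟨ha.trans hs.1, hs.2.trans hbT⟩
  weight := hG
  steers _ ht htb := D.steersToZero hC hT hb hco hucc (ha.trans ht.1) (htb.trans hbT)

lemma LQData.IsFullSolution.isHam (hC : C.Positive) (hT : 0 < T) (hb : D.Bounded T C)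
    (hco : D.Coercive T C) {zs : Trajectory nx nu} (h : D.IsFullSolution T x0 zs) :
    D.ops.IsHam 0 T zs.x zs.u zs.lam ∧ zs.lam T = toCLM D.QT (zs.x T) := by
  have := LQData.IsSolution.isHam hC hb hco le_rfl hT le_rfl (q := 0)
    (isHermitian_of_smul_one_le hco.QT_lower)
    (by funext y; simp [LQData.fullTerminal, bil]) h
  simpa using this

/-- The first subdomain is clipped at 0 and passes the initial state on. Any subdomain whose left
end is clipped to 0 therefore receives an exact initial state. -/
lemma LQData.IsSchwarzRun.state_zero (hm : 0 < m) {z : ℕ → Trajectory nx nu}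
    (h : D.IsSchwarzRun P x0 z) (k : ℕ) : (z k).x 0 = x0 := by
  induction k with
  | zero => exact h.1
  | succ k ih =>
    obtain ⟨y, hy, hnext⟩ := h.step k ⟨0, hm⟩
    have ht0 : P.t (Fin.castSucc ⟨0, hm⟩) = 0 := P.t_first
    have hleft : P.left ⟨0, hm⟩ = 0 := by
      unfold Decomposition.left
      rw [ht0, max_eq_right]
      linarith [P.τ₀_pos ⟨0, hm⟩]
    have hlt := P.t_mono (Fin.castSucc_lt_succ (i := (⟨0, hm⟩ : Fin m)))
    rw [ht0] at hlt
    have hmem : (0 : ℝ) ∈ P.piece ⟨0, hm⟩ := by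
      unfold Decomposition.piece
      split_ifs
      · exact ⟨ht0.le, hlt.le⟩
      · exact ⟨ht0.le, hlt⟩
    have := LQData.IsSolution.left_eq hy (P.left_lt_right _).le
    rw [hleft] at this
    rw [(hnext 0 hmem).1, this, ih]

lemma toCLM_inv_le (hC : C.Positive) {G : Mat nx nx} (hG : C.gQ • (1 : Mat nx nx) ≤ G) (v : Vec nx) :
    toCLM G (toCLM G⁻¹ v) = v ∧ ‖toCLM G⁻¹ v‖ ≤ ‖v‖ / C.gQ := by
  have hgQ := hC.gQ
  have hu := (Matrix.isUnit_iff_isUnit_det _).1 (posDef_of_smul_one_le hgQ hG).isUnit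
  have hinv : toCLM G (toCLM G⁻¹ v) = v := by
    change (toCLM G ∘L toCLM G⁻¹) v = v
    rw [← toCLM_mul, Matrix.mul_nonsing_inv _ hu, toCLM_one]; rfl
  refine ⟨hinv, ?_⟩
  have h1 := inner_toCLM_le hG (toCLM G⁻¹ v)
  rw [inner_toCLM_smul_one, hinv] at h1
  have h2 := real_inner_le_norm (toCLM G⁻¹ v) v
  rw [le_div_iff₀ hgQ]
  by_cases h0 : ‖toCLM G⁻¹ v‖ = 0
  · rw [h0]; simp
  · have h3 : 0 < ‖toCLM G⁻¹ v‖ := lt_of_le_of_ne (norm_nonneg _) (Ne.symm h0)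
    refine le_of_mul_le_mul_left ?_ h3
    nlinarith

/-- `Q` exceeds its Schur complement by `Hᵀ R⁻¹ H`, which is positive semidefinite. -/
lemma LQData.smul_one_le_Q (hC : C.Positive) (hco : D.Coercive T C) {t : ℝ}
    (ht : t ∈ Icc 0 T) : C.gQ • (1 : Mat nx nx) ≤ D.Q t := by
  refine (hco.Q_lower t ht).trans ?_
  rw [Matrix.le_iff, sub_sub_cancel]
  have := ((posDef_of_smul_one_le hC.gR (hco.R_lower t ht)).inv.posSemidef).conjTranspose_mul_mul_same
    (D.H t)
  rwa [Matrix.conjTranspose_eq_transpose_of_trivial] at this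

/-- The error after one step on the `j`-th piece, given an error bound `ω` for the previous
iterate. -/
lemma LQData.norm_error_le (hC : C.Positive) (hT : 0 < T) (hb : D.Bounded T C) (hucc : D.UCC T C)
    (hco : D.Coercive T C) (hfit : ∀ j : Fin m, (j : ℕ) + 1 < m → P.t j.succ + P.τ ≤ T)
    {zs cur z : Trajectory nx nu} (hzs : D.IsFullSolution T x0 zs) (hcur0 : cur.x 0 = x0) {ω : ℝ}
    (hx : ∀ t ∈ Icc 0 T, ‖cur.x t - zs.x t‖ ≤ ω) (hl : ∀ t ∈ Icc 0 T, ‖cur.lam t - zs.lam t‖ ≤ ω)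
    {j : Fin m} (hz : D.IsSubSolution P j (cur.x (P.left j))
      (cur.x (P.right j) - mulV (D.Q (P.right j))⁻¹ (cur.lam (P.right j))) z)
    {t : ℝ} (ht : t ∈ P.piece j) :
    let K := 3 * C.c * Real.exp (-C.ρZ * P.τ) * ω
    ‖z.x t - zs.x t‖ ≤ K ∧ ‖z.u t - zs.u t‖ ≤ K ∧ ‖z.lam t - zs.lam t‖ ≤ K := by
  intro K
  set a := P.left j with ha
  set b := P.right j with hbdef
  have hab : a < b := P.left_lt_right j
  have ha0 : 0 ≤ a := P.left_nonneg j
  have hbT : b ≤ T := P.right_le j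
  have hgQ := hC.gQ
  have hlQ := hC.lQ
  have hρ := hC.ρZ_pos
  have hΛ := hC.Λb_pos
  have haT : a ∈ Icc 0 T := ⟨ha0, hab.le.trans hbT⟩
  have hbT' : b ∈ Icc 0 T := ⟨ha0.trans hab.le, hbT⟩
  have htp := P.piece_subset j ht
  have htab : t ∈ Icc a b := ⟨(P.left_le j).trans htp.1, htp.2.trans (P.le_right j)⟩
  have hω : 0 ≤ ω := (norm_nonneg _).trans (hx a haT)
  obtain ⟨hsH, hsT⟩ := hzs.isHam hC hT hb hco
  have hsH' := hsH.mono (Icc_subset_Icc ha0 hbT)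
  have hza : z.x a = cur.x a := LQData.IsSolution.left_eq hz hab.le
  have hpa : Real.exp (-C.ρZ * (t - a)) * ‖z.x a - zs.x a‖ ≤ Real.exp (-C.ρZ * P.τ) * ω := by
    rw [hza]
    -- Either the left end is 0, where the error vanishes, or it lies at distance at least `τ` from
    -- the piece.
    by_cases hclip : P.t j.castSucc - P.τ₀ j ≤ 0
    · have : a = 0 := max_eq_right hclip
      have h0 : zs.x 0 = x0 := LQData.IsSolution.left_eq hzs hT.le
      rw [this, hcur0, h0, sub_self, norm_zero, mul_zero]
      positivity
    · have : a = P.t j.castSucc - P.τ₀ j := max_eq_left (not_le.1 hclip).le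
      have hτ : P.τ ≤ t - a := by linarith [(P.τ_le j).1, htp.1]
      have h1 : -C.ρZ * (t - a) ≤ -C.ρZ * P.τ := by nlinarith
      have h2 := hx a haT
      gcongr
  -- All that remains is to put the terminal condition of the error in the form required by
  -- `norm_le_Λb`, with `G` the weight of the subproblem.
  suffices hmain : ∃ (G : Vec nx →L[ℝ] Vec nx) (e : Vec nx) (q : ℝ), IsWeight C G ∧
      D.ops.IsHam a b z.x z.u z.lam ∧
      z.lam b - zs.lam b = G (z.x b - zs.x b) + e ∧ 0 ≤ q ∧ ‖e‖ ≤ C.lQ * q ∧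
      Real.exp (-C.ρZ * (b - t)) * q ≤ (1 + 1 / C.gQ) * (Real.exp (-C.ρZ * P.τ) * ω) by
    obtain ⟨G, e, q, hG, hzH, hend, hq0, heq, hqb⟩ := hmain
    have hp := D.ops_problem hC hT.le hb hucc hco ha0 hab.le hbT hG
    have hfin := hp.norm_le_Λb (hzH.sub hsH') hend hq0 heq htab rfl
    have hK : C.Λb * (Real.exp (-C.ρZ * (t - a)) * ‖z.x a - zs.x a‖
        + Real.exp (-C.ρZ * (b - t)) * q) ≤ K := by
      have hω' : 0 ≤ Real.exp (-C.ρZ * P.τ) * ω := by positivity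
      have h1 : 0 ≤ 1 / C.gQ * (Real.exp (-C.ρZ * P.τ) * ω) := by positivity
      -- The two boundary contributions add up to `2 + 1 / γ_Q` times the common factor; 3 is not
      -- sharp.
      calc _ ≤ C.Λb * (3 * ((1 + 1 / C.gQ) * (Real.exp (-C.ρZ * P.τ) * ω))) := by
            gcongr
            linarith
        _ = K := by simp only [K, Constants.c]; ring
    exact ⟨hfin.1.trans hK, hfin.2.1.trans hK, hfin.2.2.trans hK⟩
  by_cases hlast : (j : ℕ) + 1 = m
  · have hbeq : b = T := P.right_of_last hlast
    obtain ⟨h1, h2⟩ := LQData.IsSolution.isHam hC hb hco ha0 hab hbT (q := 0)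
      (isHermitian_of_smul_one_le hco.QT_lower)
      (by funext y; simp [LQData.subTerminal, hlast, bil]) hz
    refine ⟨toCLM D.QT, 0, 0, D.isWeight_QT hco, h1, ?_, le_rfl, by simp, ?_⟩
    · rw [map_zero, sub_zero] at h2
      rw [h2, hbeq, hsT, map_sub, add_zero]
    · rw [mul_zero]; positivity
  · have hQ := D.smul_one_le_Q hC hco hbT'
    set q := cur.x b - mulV (D.Q b)⁻¹ (cur.lam b) with hq
    obtain ⟨h1, h2⟩ := LQData.IsSolution.isHam hC hb hco ha0 hab hbT (q := q)
      (isHermitian_of_smul_one_le hQ)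
      (by funext y; simp [LQData.subTerminal, hlast]; rfl) hz
    -- `q'` is the error of the boundary parameter relative to the one read off the exact solution.
    -- With that exact parameter the full solution would satisfy the terminal condition at `b`, so
    -- the defect is `-Q q'`.
    set q' := (cur.x b - zs.x b) - toCLM (D.Q b)⁻¹ (cur.lam b - zs.lam b) with hq'
    refine ⟨toCLM (D.Q b), -toCLM (D.Q b) q', ‖q'‖, D.isWeight_Q hC hb hco hbT', h1, ?_,
      norm_nonneg _, ?_, ?_⟩
    · have e1 := (toCLM_inv_le hC hQ (cur.lam b)).1
      have e2 := (toCLM_inv_le hC hQ (cur.lam b - zs.lam b)).1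
      have e3 : toCLM (D.Q b) q = toCLM (D.Q b) (cur.x b) - cur.lam b := by
        rw [hq, map_sub]
        congr 1
      rw [h2, e3, hq']
      simp only [map_sub (toCLM (D.Q b)), e2]
      abel
    · rw [norm_neg]
      exact (toCLM (D.Q b)).le_of_opNorm_le ((norm_toCLM _).trans_le (hb.boundQ b hbT')) _
    · have hqn : ‖q'‖ ≤ (1 + 1 / C.gQ) * ω := by
        calc ‖q'‖ ≤ ‖cur.x b - zs.x b‖ + ‖toCLM (D.Q b)⁻¹ (cur.lam b - zs.lam b)‖ := norm_sub_le _ _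
          _ ≤ ω + ω / C.gQ := by
            have h3 := (toCLM_inv_le hC hQ (cur.lam b - zs.lam b)).2
            have h4 := hl b hbT'
            have h5 : ‖cur.lam b - zs.lam b‖ / C.gQ ≤ ω / C.gQ := by gcongr
            exact add_le_add (hx b hbT') (h3.trans h5)
          _ = _ := by ring
      -- The fit assumption ensures that clipping at `T` leaves an overlap of at least `τ` on the
      -- right.
      have hτ : P.τ ≤ b - t := by
        have h3 : P.t j.succ + P.τ ≤ b :=
          le_min (by linarith [(P.τ_le j).2]) (hfit j (by omega))
        linarith [htp.2]
      have h6 : -C.ρZ * (b - t) ≤ -C.ρZ * P.τ := by nlinarith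
      calc _ ≤ Real.exp (-C.ρZ * P.τ) * ((1 + 1 / C.gQ) * ω) := by gcongr
        _ = _ := by ring

end Step

/-! ### Sup norms and the contraction estimate. -/

lemma supNorm_le {n : ℕ} {T K : ℝ} {f : ℝ → Vec n} (h : ∀ t ∈ Icc 0 T, ‖f t‖ ≤ K) :
    supNorm T f ≤ ENNReal.ofReal K :=
  iSup₂_le fun t ht => by
    rw [← ofReal_norm]
    exact ENNReal.ofReal_le_ofReal (h t ht)

lemma norm_le_of_supNorm_le {n : ℕ} {T : ℝ} {f : ℝ → Vec n} {ω : ℝ≥0∞} (hω : ω ≠ ∞)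
    (h : supNorm T f ≤ ω) {t : ℝ} (ht : t ∈ Icc 0 T) : ‖f t‖ ≤ ω.toReal := by
  have h1 : ‖f t‖ₑ ≤ ω := (le_iSup₂ (f := fun t (_ : t ∈ Icc 0 T) => ‖f t‖ₑ) t ht).trans h
  have := ENNReal.toReal_mono hω h1
  simpa using this

end Schwarz

end

theorem mainTheorem1 {nx nu m : ℕ} (C : Schwarz.Constants) (hC : C.Positive)
    (T : ℝ) (hσT : C.σ < T) (D : Schwarz.LQData nx nu)
    (hbdd : D.Bounded T C) (hucc : D.UCC T C) (hcoer : D.Coercive T C)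
    (P : Schwarz.Decomposition T m)
    (hfit : ∀ j : Fin m, (j : ℕ) + 1 < m → P.t j.succ + P.τ ≤ T)
    (x0 : Schwarz.Vec nx) (zs : Schwarz.Trajectory nx nu) (hzs : D.IsFullSolution T x0 zs)
    (z : ℕ → Schwarz.Trajectory nx nu) (hz : D.IsSchwarzRun P x0 z) :
    0 < C.c ∧ 0 < C.ρZ ∧
    ∀ k : ℕ, Schwarz.omega T (z (k + 1)) zs ≤
      ENNReal.ofReal (3 * C.c * Real.exp (-C.ρZ * P.τ)) * Schwarz.omega T (z k) zs := by
  have hc := hC.c_pos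
  refine ⟨hc, hC.ρZ_pos, fun k => ?_⟩
  have hT : 0 < T := hC.σ.trans hσT
  have hm : 0 < m := by
    rcases Nat.eq_zero_or_pos m with rfl | h
    · have h1 := P.t_first
      have h2 := P.t_last
      exact absurd (h2.symm.trans h1) hT.ne'
    · exact h
  have hpos : 0 < 3 * C.c * Real.exp (-C.ρZ * P.τ) := by positivity
  -- An infinite error makes the right side infinite, as the factor is positive; otherwise the
  -- estimate is one between real numbers.
  by_cases hω : Schwarz.omega T (z k) zs = ∞
  · rw [hω, ENNReal.mul_top (by simpa using hpos)]
    exact le_top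
  set ω := Schwarz.omega T (z k) zs with hωdef
  have hx : ∀ t ∈ Icc 0 T, ‖(z k).x t - zs.x t‖ ≤ ω.toReal := fun t ht =>
    Schwarz.norm_le_of_supNorm_le hω (le_max_left _ _) ht
  have hl : ∀ t ∈ Icc 0 T, ‖(z k).lam t - zs.lam t‖ ≤ ω.toReal := fun t ht =>
    Schwarz.norm_le_of_supNorm_le hω ((le_max_right _ _).trans (le_max_right _ _)) ht
  have h0 := hz.state_zero hm k
  have key : ∀ t ∈ Icc 0 T,
      ‖(z (k + 1)).x t - zs.x t‖ ≤ 3 * C.c * Real.exp (-C.ρZ * P.τ) * ω.toReal ∧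
      ‖(z (k + 1)).u t - zs.u t‖ ≤ 3 * C.c * Real.exp (-C.ρZ * P.τ) * ω.toReal ∧
      ‖(z (k + 1)).lam t - zs.lam t‖ ≤ 3 * C.c * Real.exp (-C.ρZ * P.τ) * ω.toReal := by
    intro t ht
    obtain ⟨j, hj⟩ := P.exists_mem_piece hm ht
    obtain ⟨y, hy, hnext⟩ := hz.step k j
    obtain ⟨e1, e2, e3⟩ := hnext t hj
    rw [e1, e2, e3]
    exact Schwarz.LQData.norm_error_le hC hT hbdd hucc hcoer hfit hzs h0 hx hl hy hj
  have hrhs : ENNReal.ofReal (3 * C.c * Real.exp (-C.ρZ * P.τ)) * ω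
      = ENNReal.ofReal (3 * C.c * Real.exp (-C.ρZ * P.τ) * ω.toReal) := by
    rw [ENNReal.ofReal_mul hpos.le, ENNReal.ofReal_toReal hω]
  rw [hrhs]
  exact max_le (Schwarz.supNorm_le fun t ht => (key t ht).1)
    (max_le (Schwarz.supNorm_le fun t ht => (key t ht).2.1)
      (Schwarz.supNorm_le fun t ht => (key t ht).2.2))
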